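/- **Setting.** Let $Z$ be a real Hilbert space and let $A$ generate an exponentially stable analytic semigroup $e^{At}$ on $Z$. For $s\ge 0$ let $Z^{s}=\operatorname{ran}(-A)^{-s}$ with $\|\varphi\|_s=\|(-A)^s\varphi\|$, and let $Z^{-s}$ be the completion of $Z$ in the norm $\|\varphi\|_{-s}=\|(-A)^{-s}\varphi\|$. Input, disturbance and output are scalar. Let $\sigma,s_c\ge 0$ and $s_1>0$ with $s_c+\sigma<1$ and $s_1+\sigma<1$; let $B_{\rm in}v=v\,b_{\rm in}$ and $B_{\rm d}v=v\,b_{\rm d}$ with $b_{\rm in},b_{\rm d}\in Z^{-\sigma}$ (if $b_{\rm in}\in Z^{-s_b}$ and $b_{\rm d}\in Z^{-s_d}$, take $\sigma=\max\{s_b,s_d\}$), and let $C:Z^{s_c}\to\mathbb R$ be a bounded linear functional. Let $f:Z\to Z$ satisfy $f(0)=0$ and $\|f(\varphi_1)-f(\varphi_2)\|\le\epsilon\|\varphi_1-\varphi_2\|_{s_1}$ for $\varphi_1,\varphi_2\in Z^{s_1}$, with $\epsilon\ge 0$. Denote the extension of $A$ to $Z^{-\sigma}$ also by $A$, assume $G=C(-A)^{-1}B_{\rm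 in}\ne0$, and put $B=B_{\rm in}G^{-1}$, $I_0=I+BCA^{-1}$. Let $0<\beta<1$ and $A_\beta=A-\frac{1-\beta}{\beta}BC$ (an operator in $Z^{-\sigma}$), and assume that $A_\beta$ generates an exponentially stable semigroup $e^{A_\beta t}$ on $Z^{-\sigma}$. **Iteration.** Let $r,d\in C_b^2([0,\infty))$ (twice continuously differentiable, bounded together with their first two derivatives) and $z_0\in Z$. Let $z^0$ and $z^1$ be mild solutions on $[0,\infty)$, continuous on $(0,\infty)$ with values in $Z^{s_1}$, of $$\dot z^{0}=A_\beta z^0+I_0\big(f(z^0)+B_{\rm d}d\big)+\tfrac1\beta Br,\quad z^0(0)=z_0,$$ $$\dot z^{1}=A_\beta z^1+I_0\big(f(z^0+z^1)-f(z^0)\big)+\tfrac1\beta Be_0,\quad z^1(0)=0,$$ where $e_0=r-Cz^0$, and let $e_1=e_0-Cz^1$ be the error of the second iteration. **Constants.** Let $K(t)=-\frac1\beta CA_\beta^{-1}e^{A_\beta t}B$, $K_d(t)=-CA_\beta^{-1}e^{A_\beta t}I_0B_{\rm d}$, and $$D=\int_0^\infty|K|\,dt,\quad D_d=\int_0^\infty|K_d|\,dt,\quad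 D_H=\int_0^\infty\|Ce^{A_\beta t}I_0\|_{\mathcal L(Z,\mathbb R)}dt,$$ $$D_B=\int_0^\infty\big\|\tfrac1\beta e^{A_\beta t}B\big\|_{\mathcal L(\mathbb R,Z^{s_1})}dt,\quad D_{A_\beta}=\int_0^\infty\|e^{A_\beta t}I_0\|_{\mathcal L(Z,Z^{s_1})}dt,\quad D_{B_{\rm d}}=\int_0^\infty\|e^{A_\beta t}I_0B_{\rm d}\|_{\mathcal L(\mathbb R,Z^{s_1})}dt,$$ assume $\epsilon D_{A_\beta}<1$, and put $$\mathcal D=D_H\,\frac{D_B\,\epsilon}{1-\epsilon D_{A_\beta}},\qquad \mathcal D_d=D_H\,\frac{D_{B_{\rm d}}\,\epsilon}{1-\epsilon D_{A_\beta}}.$$ Write $\limsup\|\varphi\|_2=\limsup_{t\to\infty}\max_{0\le j\le2}|\varphi^{(j)}(t)|$. **Theorem.** Then $0<D+\mathcal D<\infty$, $D_d+\mathcal D_d<\infty$, and $$\limsup_{t\to\infty}|e_1(t)|\le (D+\mathcal D)^2\left[\limsup\|r\|_2+\frac{D_d+\mathcal D_d}{D+\mathcal D}\,\limsup\|d\|_2\right].$$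 -/

import Mathlib

open Set Filter Topology MeasureTheory
open scoped ENNReal NNReal

noncomputable section

set_option linter.unusedSectionVars false

/-! ### Complexification of a real Hilbert space -/

/-- The Hilbert space complexification `E + iE` of a real Hilbert space `E`, with
`‖x + iy‖² = ‖x‖² + ‖y‖²`. -/
def Complexify (E : Type*) : Type _ := WithLp 2 (E × E)

namespace Complexify

variable {E : Type*} [NormedAddCommGroup E] [InnerProductSpace ℝ E]

instance : NormedAddCommGroup (Complexify E) :=
  inferInstanceAs (NormedAddCommGroup (WithLp 2 (E × E)))

/-- The element `x + iy`. -/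
def mk (x y : E) : Complexify E := WithLp.toLp 2 (x, y)

/-- Real part of `x + iy`. -/
def re (p : Complexify E) : E := (WithLp.ofLp p).1

/-- Imaginary part of `x + iy`. -/
def im (p : Complexify E) : E := (WithLp.ofLp p).2

theorem ext' {p q : Complexify E} (h₁ : p.re = q.re) (h₂ : p.im = q.im) : p = q :=
  (WithLp.ofLp_injective 2) (Prod.ext h₁ h₂)

@[simp] theorem re_mk (x y : E) : (mk x y).re = x := rfl
@[simp] theorem im_mk (x y : E) : (mk x y).im = y := rfl
@[simp] theorem re_add (p q : Complexify E) : (p + q).re = p.re + q.re := rfl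
@[simp] theorem im_add (p q : Complexify E) : (p + q).im = p.im + q.im := rfl
@[simp] theorem re_zero : (0 : Complexify E).re = 0 := rfl
@[simp] theorem im_zero : (0 : Complexify E).im = 0 := rfl

/-- `(a + ib)(x + iy) = (ax - by) + i(bx + ay)`. -/
instance : SMul ℂ (Complexify E) :=
  ⟨fun c p => mk (c.re • p.re - c.im • p.im) (c.im • p.re + c.re • p.im)⟩

@[simp] theorem re_smul (c : ℂ) (p : Complexify E) :
    (c • p).re = c.re • p.re - c.im • p.im := rfl
@[simp] theorem im_smul (c : ℂ) (p : Complexify E) :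
    (c • p).im = c.im • p.re + c.re • p.im := rfl

theorem norm_sq (p : Complexify E) : ‖p‖ ^ 2 = ‖p.re‖ ^ 2 + ‖p.im‖ ^ 2 :=
  WithLp.prod_norm_sq_eq_of_L2 (α := E) (β := E) p

instance : Module ℂ (Complexify E) where
  one_smul p := by apply ext' <;> simp
  mul_smul a b p := by
    apply ext'
    · simp only [re_smul, im_smul, Complex.mul_re, Complex.mul_im]; module
    · simp only [re_smul, im_smul, Complex.mul_re, Complex.mul_im]; module
  smul_zero a := by apply ext' <;> simp
  smul_add a p q := by
    apply ext'
    · simp only [re_smul, re_add, im_add]; module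
    · simp only [im_smul, re_add, im_add]; module
  add_smul a b p := by
    apply ext'
    · simp only [re_smul, re_add, Complex.add_re, Complex.add_im]; module
    · simp only [im_smul, im_add, Complex.add_re, Complex.add_im]; module
  zero_smul p := by apply ext' <;> simp

instance : NormedSpace ℂ (Complexify E) where
  norm_smul_le c p := by
    have h : ‖c • p‖ ^ 2 = (‖c‖ * ‖p‖) ^ 2 := by
      rw [mul_pow, norm_sq, norm_sq, ← Complex.normSq_eq_norm_sq, Complex.normSq_apply,
        re_smul, im_smul, @norm_sub_sq ℝ, @norm_add_sq ℝ]
      simp only [norm_smul, inner_smul_left, inner_smul_right, Real.norm_eq_abs, mul_pow, sq_abs,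
        RCLike.conj_to_real, RCLike.re_to_real]
      ring
    exact (pow_le_pow_iff_left₀ (norm_nonneg _) (by positivity) two_ne_zero).1 h.le

end Complexify

/-! ### Semigroups and generators -/

/-- `T(t)`, `t ≥ 0`, is a strongly continuous semigroup (values at negative times are irrelevant). -/
structure IsC0Semigroup {E : Type*} [NormedAddCommGroup E] [NormedSpace ℝ E]
    (T : ℝ → E →L[ℝ] E) : Prop where
  map_zero : T 0 = ContinuousLinearMap.id ℝ E
  map_add : ∀ s t : ℝ, 0 ≤ s → 0 ≤ t → T (s + t) = (T s).comp (T t)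
  tendsto_zero : ∀ x : E, Tendsto (fun t => T t x) (𝓝[>] 0) (𝓝 x)

/-- `A` (with its domain) is the infinitesimal generator of `T`. -/
def IsGenerator {E : Type*} [NormedAddCommGroup E] [NormedSpace ℝ E]
    (A : E →ₗ.[ℝ] E) (T : ℝ → E →L[ℝ] E) : Prop :=
  ∀ x y : E, (x, y) ∈ A.graph ↔ Tendsto (fun h : ℝ => h⁻¹ • (T h x - x)) (𝓝[>] 0) (𝓝 y)

/-- `‖T(t)‖ ≤ M e^{-ωt}` for some `ω > 0`. -/
def IsExpStable {E : Type*} [NormedAddCommGroup E] [NormedSpace ℝ E]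
    (T : ℝ → E →L[ℝ] E) : Prop :=
  ∃ M ω : ℝ, 0 < ω ∧ ∀ t : ℝ, 0 ≤ t → ‖T t‖ ≤ M * Real.exp (-ω * t)

/-- A semigroup on a real Hilbert space is (bounded) analytic if its complexification extends to a
bounded holomorphic operator-valued function on a sector `{z ≠ 0 : |arg z| < θ}`.  (The semigroup
law on the sector follows from the one on the half-line by the identity theorem.) -/
def IsAnalyticSemigroup {E : Type*} [NormedAddCommGroup E] [InnerProductSpace ℝ E]
    (T : ℝ → E →L[ℝ] E) : Prop :=
  ∃ θ : ℝ, 0 < θ ∧ θ ≤ Real.pi / 2 ∧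
    ∃ V : ℂ → (Complexify E →L[ℂ] Complexify E),
      DifferentiableOn ℂ V {z : ℂ | z ≠ 0 ∧ |z.arg| < θ} ∧
      (∀ t : ℝ, 0 < t → ∀ x y : E, V (t : ℂ) (Complexify.mk x y) = Complexify.mk (T t x) (T t y)) ∧
      ∃ M : ℝ, ∀ z : ℂ, z ≠ 0 → |z.arg| < θ → ‖V z‖ ≤ M

/-- Evaluation of a partially defined operator, with the value `0` off its domain. -/
def LinearPMap.total {E F : Type*} [AddCommGroup E] [Module ℝ E] [AddCommGroup F] [Module ℝ F]
    (A : E →ₗ.[ℝ] F) (x : E) : F :=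
  open Classical in if h : x ∈ A.domain then A ⟨x, h⟩ else 0

/-! ### The scale of spaces generated by `A` -/

/-- The fractional power `(-A)^{-s}`, `s ≥ 0`, where `A` generates the exponentially stable
analytic semigroup `T`: `(-A)^{-s} = Γ(s)⁻¹ ∫₀^∞ t^{s-1} T(t) dt` for `s > 0`. -/
def negPow {Z : Type*} [NormedAddCommGroup Z] [NormedSpace ℝ Z]
    (T : ℝ → Z →L[ℝ] Z) (s : ℝ) : Z →L[ℝ] Z :=
  open Classical in
  if s = 0 then ContinuousLinearMap.id ℝ Z
  else (Real.Gamma s)⁻¹ • ∫ t in Ioi (0 : ℝ), t ^ (s - 1) • T t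

/-- `ι : Z → X` exhibits the Banach space `X` as the space `Z^{-σ}`, the completion of `Z` for
the norm `‖φ‖_{-σ} = ‖(-A)^{-σ} φ‖`. -/
structure IsNegSpace {Z X : Type*} [NormedAddCommGroup Z] [NormedSpace ℝ Z]
    [NormedAddCommGroup X] [NormedSpace ℝ X]
    (T : ℝ → Z →L[ℝ] Z) (σ : ℝ) (ι : Z →L[ℝ] X) : Prop where
  norm_eq : ∀ φ : Z, ‖ι φ‖ = ‖negPow T σ φ‖
  dense : DenseRange ι

/-- The space `Z^s = ran (-A)^{-s}`, `s ≥ 0`, as a subspace of `X = Z^{-σ}`. -/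
def posSpace {Z X : Type*} [NormedAddCommGroup Z] [NormedSpace ℝ Z]
    [NormedAddCommGroup X] [NormedSpace ℝ X]
    (T : ℝ → Z →L[ℝ] Z) (ι : Z →L[ℝ] X) (s : ℝ) : Submodule ℝ X :=
  LinearMap.range ((ι.comp (negPow T s)) : Z →ₗ[ℝ] X)

/-- The norm `‖x‖_s = ‖(-A)^s x‖` of `x ∈ Z^s ⊆ X`, `s ≥ 0`, with the value `∞` if `x ∉ Z^s`. -/
def posNorm {Z X : Type*} [NormedAddCommGroup Z] [NormedSpace ℝ Z]
    [NormedAddCommGroup X] [NormedSpace ℝ X]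
    (T : ℝ → Z →L[ℝ] Z) (ι : Z →L[ℝ] X) (s : ℝ) (x : X) : ℝ≥0∞ :=
  ⨅ (y : Z) (_ : ι (negPow T s y) = x), ‖y‖ₑ

/-! ### Signals -/

/-- `φ ∈ C_b^N([0,∞))`: `N` times continuously differentiable, bounded derivatives of orders
`0, …, N`. -/
def IsCb (N : ℕ) (φ : ℝ → ℝ) : Prop :=
  ContDiffOn ℝ N φ (Ici 0) ∧
    ∃ M : ℝ, ∀ j ≤ N, ∀ t : ℝ, 0 ≤ t → |iteratedDerivWithin j φ (Ici 0) t| ≤ M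

/-- `limsup ‖φ‖_N = limsup_{t → ∞} max_{0 ≤ j ≤ N} |φ^{(j)}(t)|`. -/
def limsupNorm (N : ℕ) (φ : ℝ → ℝ) : ℝ≥0∞ :=
  limsup (fun t : ℝ => (Finset.range (N + 1)).sup
    fun j => ‖iteratedDerivWithin j φ (Ici 0) t‖ₑ) atTop

/-! ### The regulated system -/

/-- The data of the nonlinear control system `z' = Az + f(z) + B_in u + B_d d`, `y = Cz`, with
scalar input, disturbance and output, together with the regularization parameter `β`.
`X` plays the role of the extrapolation space `Z^{-σ}`, which contains the vectors `b_in`, `b_d`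
representing `B_in` and `B_d`; `S(t)` stands for `e^{A_β t}`.  The conditions that these data
satisfy are listed in `RegulatedSystem.Standing`. -/
structure RegulatedSystem (Z X : Type*) [NormedAddCommGroup Z] [InnerProductSpace ℝ Z]
    [NormedAddCommGroup X] [NormedSpace ℝ X] where
  /-- the operator `A`, with its domain -/
  A : Z →ₗ.[ℝ] Z
  /-- the semigroup `e^{At}` -/
  T : ℝ → Z →L[ℝ] Z
  /-- `B_in, B_d ∈ Z^{-σ}` -/
  σ : ℝ
  /-- the inclusion `Z ⊆ Z^{-σ}` -/
  ι : Z →L[ℝ] X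
  /-- the output operator acts on `Z^{s_c}` -/
  sc : ℝ
  /-- the output operator -/
  C : posSpace T ι sc →ₗ[ℝ] ℝ
  /-- `B_in v = v b_in` -/
  bIn : X
  /-- `B_d v = v b_d` -/
  bd : X
  /-- the nonlinearity -/
  f : Z → Z
  /-- the nonlinearity is Lipschitz for the norm of `Z^{s₁}` -/
  s₁ : ℝ
  /-- the Lipschitz constant of the nonlinearity -/
  ε : ℝ≥0
  /-- the regularization parameter -/
  β : ℝ
  /-- the semigroup `e^{A_β t}` -/
  S : ℝ → X →L[ℝ] X

namespace RegulatedSystem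

variable {Z X : Type*} [NormedAddCommGroup Z] [InnerProductSpace ℝ Z]
  [NormedAddCommGroup X] [NormedSpace ℝ X] (P : RegulatedSystem Z X)

/-- The norm `‖x‖_s`, `s ≥ 0`. -/
def snorm (s : ℝ) (x : X) : ℝ≥0∞ := posNorm P.T P.ι s x

/-- `C x` for `x ∈ Z^{s_c}` (and `0` for other `x`). -/
def Cx (x : X) : ℝ := LinearPMap.total (⟨posSpace P.T P.ι P.sc, P.C⟩ : X →ₗ.[ℝ] ℝ) x

/-- The extension of `A` to a closed operator in `X = Z^{-σ}`: the graph is the closure of the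
graph of `A`. -/
def AX : X →ₗ.[ℝ] X :=
  ((P.A.graph.map ((P.ι.prodMap P.ι) : Z × Z →ₗ[ℝ] X × X)).topologicalClosure).toLinearPMap

/-- `A⁻¹` on `X`. -/
def AInv (x : X) : X := P.AX.inverse.total x

/-- `G = C (-A)⁻¹ B_in`. -/
def G : ℝ := -P.Cx (P.AInv P.bIn)

/-- The vector `b` with `B v = v b`, where `B = B_in G⁻¹`. -/
def b : X := P.G⁻¹ • P.bIn

/-- `I₀ = I + B C A⁻¹`. -/
def I₀ (x : X) : X := x + P.Cx (P.AInv x) • P.b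

/-- `A_β = A - ((1-β)/β) B C`, an operator in `X`. -/
def Aβ : X →ₗ.[ℝ] X :=
  P.AX - ((1 - P.β) / P.β) •
    (⟨posSpace P.T P.ι P.sc, P.C.smulRight P.b⟩ : X →ₗ.[ℝ] X)

/-- `A_β⁻¹` on `X`. -/
def AβInv (x : X) : X := P.Aβ.inverse.total x

/-- The standing assumptions. -/
structure Standing : Prop where
  /-- `A` generates the exponentially stable analytic semigroup `T` on `Z`. -/
  semigroup : IsC0Semigroup P.T
  generator : IsGenerator P.A P.T
  analytic : IsAnalyticSemigroup P.T
  stable : IsExpStable P.T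
  /-- the exponents -/
  σ_nonneg : 0 ≤ P.σ
  sc_nonneg : 0 ≤ P.sc
  s₁_pos : 0 < P.s₁
  sc_add_σ : P.sc + P.σ < 1
  s₁_add_σ : P.s₁ + P.σ < 1
  /-- `X` is the space `Z^{-σ}`. -/
  negSpace : IsNegSpace P.T P.σ P.ι
  /-- `C` is bounded on `Z^{s_c}`. -/
  C_bounded : ∃ c : ℝ≥0, ∀ φ : posSpace P.T P.ι P.sc, ‖P.C φ‖ₑ ≤ c * P.snorm P.sc φ
  /-- `f` vanishes at the equilibrium and `‖f(φ₁) - f(φ₂)‖ ≤ ε ‖φ₁ - φ₂‖_{s₁}` on `Z^{s₁}`. -/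
  f_zero : P.f 0 = 0
  f_lipschitz : ∀ φ₁ φ₂ : Z, P.ι φ₁ ∈ posSpace P.T P.ι P.s₁ → P.ι φ₂ ∈ posSpace P.T P.ι P.s₁ →
    ‖P.f φ₁ - P.f φ₂‖ₑ ≤ P.ε * P.snorm P.s₁ (P.ι (φ₁ - φ₂))
  /-- `G` is invertible. -/
  G_ne_zero : P.G ≠ 0
  /-- `0 < β < 1` and `S(t) = e^{A_β t}` is exponentially stable. -/
  β_pos : 0 < P.β
  β_lt_one : P.β < 1
  semigroup_β : IsC0Semigroup P.S
  generator_β : IsGenerator P.Aβ P.S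
  stable_β : IsExpStable P.S

/-! #### The constants of the error estimate -/

/-- `K(t) = -(1/β) C A_β⁻¹ e^{A_β t} B`. -/
def K (t : ℝ) : ℝ := -(1 / P.β) * P.Cx (P.AβInv (P.S t P.b))

/-- `K_d(t) = -C A_β⁻¹ e^{A_β t} I₀ B_d`. -/
def Kd (t : ℝ) : ℝ := -P.Cx (P.AβInv (P.S t (P.I₀ P.bd)))

/-- `D = ∫₀^∞ ‖K(t)‖ dt`. -/
def D : ℝ≥0∞ := ∫⁻ t in Ioi (0 : ℝ), ‖P.K t‖ₑ

/-- `D_d = ∫₀^∞ ‖K_d(t)‖ dt`. -/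
def Dd : ℝ≥0∞ := ∫⁻ t in Ioi (0 : ℝ), ‖P.Kd t‖ₑ

/-- `D_H = ∫₀^∞ ‖C e^{A_β t} I₀‖ dt`, with the norm of `L(Z, ℝ)`. -/
def DH : ℝ≥0∞ :=
  ∫⁻ t in Ioi (0 : ℝ), ⨆ (φ : Z) (_ : ‖φ‖ ≤ 1), ‖P.Cx (P.S t (P.I₀ (P.ι φ)))‖ₑ

/-- `D_B = ∫₀^∞ ‖(1/β) e^{A_β t} B‖ dt`, with the norm of `L(ℝ, Z^{s₁})`. -/
def DB : ℝ≥0∞ := ∫⁻ t in Ioi (0 : ℝ), P.snorm P.s₁ ((1 / P.β) • P.S t P.b)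

/-- `D_{A_β} = ∫₀^∞ ‖e^{A_β t} I₀‖ dt`, with the norm of `L(Z, Z^{s₁})`. -/
def DA : ℝ≥0∞ :=
  ∫⁻ t in Ioi (0 : ℝ), ⨆ (φ : Z) (_ : ‖φ‖ ≤ 1), P.snorm P.s₁ (P.S t (P.I₀ (P.ι φ)))

/-- `D_{B_d} = ∫₀^∞ ‖e^{A_β t} I₀ B_d‖ dt`, with the norm of `L(ℝ, Z^{s₁})`. -/
def DBd : ℝ≥0∞ := ∫⁻ t in Ioi (0 : ℝ), P.snorm P.s₁ (P.S t (P.I₀ P.bd))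

/-- `𝒟 = D_H D_B ε / (1 - ε D_{A_β})`. -/
def calD : ℝ≥0∞ := P.DH * (P.DB * P.ε / (1 - P.ε * P.DA))

/-- `𝒟_d = D_H D_{B_d} ε / (1 - ε D_{A_β})`. -/
def calDd : ℝ≥0∞ := P.DH * (P.DBd * P.ε / (1 - P.ε * P.DA))

/-! #### The iteration -/

/-- `z` is a mild solution on `[0, ∞)` of `z' = A_β z + g`, `z(0) = z₀` (variation of parameters
formula in `X`), which for `t > 0` is a continuous function with values in `Z^{s₁}`. -/
structure IsMildSolution (z₀ : Z) (g : ℝ → X) (z : ℝ → Z) : Prop where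
  mem : ∀ t : ℝ, 0 < t → P.ι (z t) ∈ posSpace P.T P.ι P.s₁
  continuous : ∀ t : ℝ, 0 < t →
    Tendsto (fun τ => P.snorm P.s₁ (P.ι (z τ - z t))) (𝓝 t) (𝓝 0)
  integrable : ∀ t : ℝ, 0 ≤ t → IntervalIntegrable g volume 0 t
  eq : ∀ t : ℝ, 0 ≤ t → P.ι (z t) = P.S t (P.ι z₀) + ∫ τ in (0 : ℝ)..t, P.S (t - τ) (g τ)

/-- The first system of the iteration:
`(z⁰)' = A_β z⁰ + I₀ (f(z⁰) + B_d d) + (1/β) B r`, `z⁰(0) = z₀`. -/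
def IsStepZero (r d : ℝ → ℝ) (z₀ : Z) (z : ℝ → Z) : Prop :=
  P.IsMildSolution z₀
    (fun t => P.I₀ (P.ι (P.f (z t)) + d t • P.bd) + (1 / P.β) • (r t • P.b)) z

/-- The error `e₀ = r - C z⁰`. -/
def e₀ (r : ℝ → ℝ) (z : ℝ → Z) (t : ℝ) : ℝ := r t - P.Cx (P.ι (z t))

/-- The second system of the iteration:
`(z¹)' = A_β z¹ + I₀ F₁ + (1/β) B e₀`, `z¹(0) = 0`, where `F₁ = f(z⁰ + z¹) - f(z⁰)`. -/
def IsStepOne (r : ℝ → ℝ) (z w : ℝ → Z) : Prop :=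
  P.IsMildSolution 0
    (fun t => P.I₀ (P.ι (P.f (z t + w t) - P.f (z t))) + (1 / P.β) • (P.e₀ r z t • P.b)) w

/-- The error `e₁ = e₀ - C z¹`. -/
def e₁ (r : ℝ → ℝ) (z w : ℝ → Z) (t : ℝ) : ℝ := P.e₀ r z t - P.Cx (P.ι (w t))

end RegulatedSystem

end

set_option linter.unusedSectionVars false

noncomputable section

/-! ### Strongly continuous semigroups -/

namespace IsC0Semigroup

variable {E : Type*} [NormedAddCommGroup E] [NormedSpace ℝ E] {T : ℝ → E →L[ℝ] E}

/-! Why one iteration regulates. Put ℓ = −C A⁻¹, so that ℓ(b) = 1. With N = (−A)⁻¹ on Z^{-σ} one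
finds A_β⁻¹ p = −N(p − (1−β) ℓ(p) b), hence C A_β⁻¹ = −β ℓ is bounded although C is not, and the
derivative of β ℓ(e^{A_β t} x) is −C e^{A_β t} x. Integrate the variation of parameters formula by
parts. Up to decaying terms, the driver (1/β) B ρ has output ρ(t) − ∫ K(s) ρ'(t−s) ds, and the
disturbance has output −∫ K_d(s) d'(t−s) ds, because ℓ I₀ = 0. So the linear part of the error ρ − C
z sees only derivatives, with gains D and D_d (`c_conv_smul`, `limsup_sub_c_conv_le`).

The nonlinearity is controlled by small gain: since ε D_{A_β} < 1, limsup ‖z‖_{s₁} is at most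
(D_{B_d} limsup |d| + D_B limsup |ρ|) / (1 − ε D_{A_β}) (`limsup_state_le`). Passed through ε and
D_H this adds 𝒟 and 𝒟_d to the gains (`limsup_error_le_of_deriv`).

The second iteration is driven by e₀, which need not be differentiable because f is only Lipschitz.
But h⁻¹(z⁰(t+h) − z⁰(t)) solves an equation of the same type, so e₀ and all its difference quotients
share one asymptotic bound L = (D+𝒟) limsup ‖r‖₂ + (D_d+𝒟_d) limsup ‖d‖₂. Comparing e₀ with its
average over [t, t+h], whose derivative is a difference quotient, and letting h → 0 gives (D+𝒟) L
for the second error (`limsup_error_le_of_quotient`).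

All this needs kernels that are integrable at 0 and at ∞. An analytic semigroup smooths by the order
a = max(s₁, s_c) + σ < 1 at the cost t^(-a) (`exists_smoothing`). A weakly singular Gronwall
argument carries this over to e^{A_β t}, a rank one perturbation (`exists_bound_small`,
`exists_smooth`). `nonempty_realization` condenses the outcome into bounded operators with e^{A_β t}
= Q R(t) and C Q = c. -/

theorem map_add_apply (hT : IsC0Semigroup T) {s t : ℝ} (hs : 0 ≤ s) (ht : 0 ≤ t) (x : E) :
    T (s + t) x = T s (T t x) := by
  rw [hT.map_add s t hs ht]; rfl

theorem map_zero_apply (hT : IsC0Semigroup T) (x : E) : T 0 x = x := by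
  rw [hT.map_zero]; rfl

theorem comm_apply (hT : IsC0Semigroup T) {s t : ℝ} (hs : 0 ≤ s) (ht : 0 ≤ t) (x : E) :
    T s (T t x) = T t (T s x) := by
  rw [← hT.map_add_apply hs ht, ← hT.map_add_apply ht hs, add_comm]

theorem tendsto_abs (hT : IsC0Semigroup T) (x : E) (t : ℝ) :
    Tendsto (fun s => T |s - t| x) (𝓝 t) (𝓝 x) := by
  have h0 : Tendsto (fun h => T h x) (𝓝[≥] 0) (𝓝 x) := by
    rw [← Ioi_insert, nhdsWithin_insert, tendsto_sup]
    refine ⟨?_, hT.tendsto_zero x⟩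
    rw [tendsto_pure_left]
    intro s hs
    rw [hT.map_zero_apply]
    exact mem_of_mem_nhds hs
  refine h0.comp ?_
  refine tendsto_nhdsWithin_iff.2 ⟨?_, Eventually.of_forall fun s => mem_Ici.2 (abs_nonneg _)⟩
  have : Continuous fun s : ℝ => |s - t| := by fun_prop
  simpa using this.tendsto t

theorem norm_sub_le (hT : IsC0Semigroup T) {M : ℝ} (hM : ∀ t, 0 ≤ t → ‖T t‖ ≤ M) {s t : ℝ}
    (hs : 0 ≤ s) (ht : 0 ≤ t) (x : E) : ‖T s x - T t x‖ ≤ M * ‖T |s - t| x - x‖ := by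
  wlog h : t ≤ s generalizing s t with H
  · rw [norm_sub_rev, abs_sub_comm]
    exact H ht hs (le_of_not_ge h)
  have h1 : T s x = T t (T |s - t| x) := by
    rw [abs_of_nonneg (sub_nonneg.2 h), ← hT.map_add_apply ht (sub_nonneg.2 h)]
    congr 2; ring
  rw [h1, ← map_sub]
  exact (T t).le_of_opNorm_le (hM t ht) _

theorem continuousOn (hT : IsC0Semigroup T) {M : ℝ} (hM : ∀ t, 0 ≤ t → ‖T t‖ ≤ M) (x : E) :
    ContinuousOn (fun t => T t x) (Ici 0) := by
  intro t ht
  rw [ContinuousWithinAt, tendsto_iff_norm_sub_tendsto_zero]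
  have h1 : Tendsto (fun s => M * ‖T |s - t| x - x‖) (𝓝[≥] t ⊔ 𝓝 t) (𝓝 0) := by
    have := ((tendsto_iff_norm_sub_tendsto_zero.1 (hT.tendsto_abs x t)).const_mul M)
    rw [mul_zero] at this
    exact this.mono_left (by simp [nhdsWithin_le_nhds])
  refine squeeze_zero' (Eventually.of_forall fun s => norm_nonneg _) ?_
    (h1.mono_left (nhdsWithin_le_nhds.trans le_sup_right))
  filter_upwards [self_mem_nhdsWithin] with s hs
  exact hT.norm_sub_le hM hs ht x

/-- Joint continuity of `(t, x) ↦ T(t) x` on `[0, ∞) × E`. -/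
theorem continuousOn_uncurry (hT : IsC0Semigroup T) {M : ℝ} (hM : ∀ t, 0 ≤ t → ‖T t‖ ≤ M) :
    ContinuousOn (fun p : ℝ × E => T p.1 p.2) (Ici 0 ×ˢ univ) := by
  rintro ⟨t, x⟩ ⟨ht, -⟩
  have h1 : ContinuousWithinAt (fun p : ℝ × E => T p.1 x) (Ici 0 ×ˢ univ) (t, x) :=
    ContinuousWithinAt.comp (g := fun t => T t x) (f := Prod.fst) (t := Ici 0)
      (hT.continuousOn hM x t ht) continuous_fst.continuousWithinAt (fun p hp => hp.1)
  have h2 : Tendsto (fun p : ℝ × E => T p.1 (p.2 - x)) (𝓝[Ici 0 ×ˢ univ] (t, x)) (𝓝 0) := by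
    rw [tendsto_zero_iff_norm_tendsto_zero]
    have : Tendsto (fun p : ℝ × E => M * ‖p.2 - x‖) (𝓝 (t, x)) (𝓝 0) := by
      have h : Continuous fun p : ℝ × E => M * ‖p.2 - x‖ := by fun_prop
      simpa using h.tendsto (t, x)
    refine squeeze_zero' (Eventually.of_forall fun s => norm_nonneg _) ?_
      (this.mono_left nhdsWithin_le_nhds)
    filter_upwards [self_mem_nhdsWithin] with p hp
    exact (T p.1).le_of_opNorm_le (hM _ hp.1) _
  have h3 := h1.tendsto.add h2
  rw [add_zero] at h3
  refine h3.congr fun p => ?_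
  rw [map_sub]; abel

end IsC0Semigroup

theorem IsExpStable.exists_bound {E : Type*} [NormedAddCommGroup E] [NormedSpace ℝ E]
    {T : ℝ → E →L[ℝ] E} (h : IsExpStable T) :
    ∃ M ω : ℝ, 0 < M ∧ 0 < ω ∧ (∀ t : ℝ, 0 ≤ t → ‖T t‖ ≤ M * Real.exp (-ω * t)) ∧
      ∀ t : ℝ, 0 ≤ t → ‖T t‖ ≤ M := by
  obtain ⟨M, ω, hω, h⟩ := h
  have h' : ∀ t : ℝ, 0 ≤ t → ‖T t‖ ≤ max M 1 * Real.exp (-ω * t) := fun t ht =>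
    (h t ht).trans (by gcongr; exact le_max_left _ _)
  refine ⟨max M 1, ω, by positivity, hω, h', fun t ht => (h' t ht).trans ?_⟩
  have : Real.exp (-ω * t) ≤ 1 := Real.exp_le_one_iff.2 (by nlinarith)
  exact mul_le_of_le_one_right (by positivity) this

/-! ### Analytic semigroups -/

namespace Complexify

variable {E : Type*} [NormedAddCommGroup E] [InnerProductSpace ℝ E]

theorem norm_re_le (p : Complexify E) : ‖p.re‖ ≤ ‖p‖ := by
  refine le_of_sq_le_sq ?_ (norm_nonneg _)
  rw [norm_sq]
  nlinarith [sq_nonneg ‖p.im‖]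

theorem norm_mk_zero (x : E) : ‖mk x 0‖ = ‖x‖ := by
  have : ‖mk x 0‖ ^ 2 = ‖x‖ ^ 2 := by rw [norm_sq]; simp
  exact (pow_left_inj₀ (norm_nonneg _) (norm_nonneg _) two_ne_zero).1 this

theorem re_real_smul (a : ℝ) (p : Complexify E) : (a • p).re = a • p.re := by
  change ((a : ℂ) • p).re = _
  rw [re_smul]; simp

theorem ofReal_smul_mk_zero (a : ℝ) (x : E) : (a : ℂ) • mk x 0 = mk (a • x) 0 := by
  apply ext'
  · rw [re_smul]; simp
  · rw [im_smul]; simp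

/-- The real part of a complex linear operator, as an operator on `E`. -/
def reOp (V : Complexify E →L[ℂ] Complexify E) : E →L[ℝ] E :=
  LinearMap.mkContinuous
    { toFun := fun x => (V (mk x 0)).re
      map_add' := fun x y => by
        rw [← re_add, ← map_add]; congr 2; apply ext' <;> simp
      map_smul' := fun a x => by
        rw [RingHom.id_apply, ← re_real_smul]
        change _ = ((a : ℂ) • V (mk x 0)).re
        rw [← map_smul, ofReal_smul_mk_zero] } ‖V‖ fun x => by
    refine (norm_re_le _).trans ((V.le_opNorm _).trans ?_)
    rw [norm_mk_zero]

theorem reOp_apply (V : Complexify E →L[ℂ] Complexify E) (x : E) :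
    reOp V x = (V (mk x 0)).re := rfl

theorem norm_reOp_le (V : Complexify E →L[ℂ] Complexify E) : ‖reOp V‖ ≤ ‖V‖ := by
  unfold reOp
  exact LinearMap.mkContinuous_norm_le _ (norm_nonneg _) _

/-- `reOp` as a bounded real linear map. -/
def reOpL : (Complexify E →L[ℂ] Complexify E) →L[ℝ] (E →L[ℝ] E) :=
  LinearMap.mkContinuous
    { toFun := reOp
      map_add' := fun V W => by ext x; simp [reOp_apply]
      map_smul' := fun a V => by
        ext x
        simp only [reOp_apply, smul_apply, RingHom.id_apply]
        exact re_real_smul a _ } 1 fun V => by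
    rw [one_mul]
    exact norm_reOp_le V

theorem reOpL_apply (V : Complexify E →L[ℂ] Complexify E) : reOpL V = reOp V := rfl

theorem norm_reOpL_le (V : Complexify E →L[ℂ] Complexify E) : ‖reOpL V‖ ≤ ‖V‖ :=
  norm_reOp_le V

end Complexify

/-- The sector is a cone, so a ball about 1 inside it can be dilated by t. Radii proportional to t
are what make Cauchy's estimate read c / t. -/
theorem exists_closedBall_one_subset_sector {θ : ℝ} (hθ : 0 < θ) :
    ∃ ρ : ℝ, 0 < ρ ∧ ∀ t : ℝ, 0 < t → ∀ z ∈ Metric.closedBall (t : ℂ) (ρ * t),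
      z ≠ 0 ∧ |z.arg| < θ := by
  have h1 : ∀ᶠ z : ℂ in 𝓝 1, z ≠ 0 ∧ |z.arg| < θ := by
    refine Filter.Eventually.and (isOpen_ne.mem_nhds one_ne_zero) ?_
    have : ContinuousAt (fun z : ℂ => |z.arg|) 1 :=
      (Complex.continuousAt_arg (by simp)).abs
    refine this.eventually_lt continuousAt_const ?_
    simpa using hθ
  obtain ⟨ρ, hρ, h⟩ := Metric.nhds_basis_closedBall.eventually_iff.1 h1
  refine ⟨ρ, hρ, fun t ht z hz => ?_⟩
  have ht' : (t : ℂ) ≠ 0 := by exact_mod_cast ht.ne'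
  have h2 : z / t ∈ Metric.closedBall (1 : ℂ) ρ := by
    rw [mem_closedBall_iff_norm] at hz ⊢
    have : z / t - 1 = (z - t) / t := by field_simp
    rw [this, norm_div, Complex.norm_real, Real.norm_of_nonneg ht.le, div_le_iff₀ ht]
    exact hz
  have h3 := h h2
  have h4 : z = (t : ℝ) * (z / t) := by field_simp
  refine ⟨fun h0 => h3.1 (by simp [h0]), ?_⟩
  rw [h4, Complex.arg_real_mul _ ht]
  exact h3.2

/-- A bounded analytic semigroup is differentiable in the operator norm with `‖T'(t)‖ ≤ c / t`. -/
theorem IsAnalyticSemigroup.exists_deriv {E : Type*} [NormedAddCommGroup E]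
    [InnerProductSpace ℝ E] {T : ℝ → E →L[ℝ] E} (h : IsAnalyticSemigroup T) :
    ∃ (T' : ℝ → E →L[ℝ] E) (c : ℝ), 0 ≤ c ∧ (∀ t, 0 < t → HasDerivAt T (T' t) t) ∧
      ∀ t, 0 < t → ‖T' t‖ ≤ c / t := by
  obtain ⟨θ, hθ, -, V, hV, hVT, M, hM⟩ := h
  obtain ⟨ρ, hρ, hs⟩ := exists_closedBall_one_subset_sector hθ
  have hM0 : 0 ≤ M := (norm_nonneg _).trans (hM 1 one_ne_zero (by simpa using hθ))
  -- T(t) is the real part of V(t) on real vectors, so it inherits differentiability from V.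
  have hTV : ∀ t : ℝ, 0 < t → T t = Complexify.reOpL (V t) := by
    intro t ht
    ext x
    rw [Complexify.reOpL_apply, Complexify.reOp_apply, hVT t ht]
    rfl
  have hd : ∀ t : ℝ, 0 < t → DiffContOnCl ℂ V (Metric.ball (t : ℂ) (ρ * t)) := by
    intro t ht
    refine DifferentiableOn.diffContOnCl (hV.mono fun z hz => hs t ht z ?_)
    exact Metric.closure_ball_subset_closedBall hz
  refine ⟨fun t => Complexify.reOpL (deriv V t), M / ρ, by positivity, ?_, ?_⟩
  · intro t ht
    have h1 : HasDerivAt V (deriv V t) (t : ℂ) :=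
      ((hd t ht).differentiableAt Metric.isOpen_ball
        (Metric.mem_ball_self (by positivity))).hasDerivAt
    have h2 : HasDerivAt (fun s : ℝ => V s) (deriv V t) t := by
      have := HasDerivAt.scomp (𝕜 := ℝ) t h1 (Complex.ofRealCLM.hasDerivAt (x := t))
      simpa using! this
    have h3 := (Complexify.reOpL (E := E)).hasFDerivAt.comp_hasDerivAt t h2
    refine h3.congr_of_eventuallyEq ?_
    filter_upwards [lt_mem_nhds ht] with s hs
    exact hTV s hs
  · intro t ht
    refine (Complexify.norm_reOpL_le _).trans ?_
    refine (Complex.norm_deriv_le_of_forall_mem_sphere_norm_le (R := ρ * t) (by positivity)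
      (hd t ht) (C := M) fun z hz => ?_).trans (by rw [div_div])
    obtain ⟨h1, h2⟩ := hs t ht z (Metric.sphere_subset_closedBall hz)
    exact hM z h1 h2

end

noncomputable section

/-! ### Fractional powers -/

/-- The rescaled Beta integral. It serves twice: for the additivity of fractional powers and for the
weakly singular Volterra kernel. -/
theorem Real.integral_rpow_mul_sub_rpow {a b x : ℝ} (ha : 0 < a) (hb : 0 < b) (hx : 0 < x) :
    ∫ t in (0 : ℝ)..x, t ^ (a - 1) * (x - t) ^ (b - 1) =
      x ^ (a + b - 1) * (Real.Gamma a * Real.Gamma b / Real.Gamma (a + b)) := by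
  have h1 := Complex.betaIntegral_scaled a b hx
  have h2 := Complex.Gamma_mul_Gamma_eq_betaIntegral (s := a) (t := b) (by simpa) (by simpa)
  have hG : Complex.Gamma (a + b) ≠ 0 := by
    rw [← Complex.ofReal_add, Complex.Gamma_ofReal]
    exact_mod_cast (Real.Gamma_pos_of_pos (add_pos ha hb)).ne'
  have h3 : Complex.betaIntegral a b =
      ((Real.Gamma a * Real.Gamma b / Real.Gamma (a + b) : ℝ) : ℂ) := by
    rw [← mul_right_inj' hG, ← h2]
    push_cast
    rw [← Complex.Gamma_ofReal, ← Complex.Gamma_ofReal, ← Complex.Gamma_ofReal]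
    push_cast
    field_simp
  rw [h3] at h1
  apply Complex.ofReal_injective
  rw [← intervalIntegral.integral_ofReal]
  have h4 : ((x ^ (a + b - 1) * (Real.Gamma a * Real.Gamma b / Real.Gamma (a + b)) : ℝ) : ℂ) =
      (x : ℂ) ^ ((a : ℂ) + b - 1) *
        ((Real.Gamma a * Real.Gamma b / Real.Gamma (a + b) : ℝ) : ℂ) := by
    rw [Complex.ofReal_mul, Complex.ofReal_cpow hx.le]
    push_cast; rfl
  rw [h4, ← h1]
  refine intervalIntegral.integral_congr fun t ht => ?_
  rw [uIcc_of_le hx.le] at ht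
  rw [Complex.ofReal_mul, Complex.ofReal_cpow ht.1, Complex.ofReal_cpow (sub_nonneg.2 ht.2)]
  push_cast; rfl

theorem Real.integrableOn_rpow_mul_exp {s ω : ℝ} (hs : -1 < s) (hω : 0 < ω) :
    IntegrableOn (fun t : ℝ => t ^ s * Real.exp (-ω * t)) (Ioi 0) := by
  simpa using integrableOn_rpow_mul_exp_neg_mul_rpow (p := 1) hs one_pos hω

/-- The integral behind the constant in `exists_smoothing`: dominated by v^(-a) near 0 and by
v^(-a-1) at infinity. -/
theorem Real.integrableOn_rpow_neg_div_one_add {a : ℝ} (ha : 0 < a) (ha1 : a < 1) :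
    IntegrableOn (fun v : ℝ => v ^ (-a) * (1 + v)⁻¹) (Ioi 0) := by
  have hm : ∀ s ⊆ Ioi (0 : ℝ), MeasurableSet s →
      AEStronglyMeasurable (fun v : ℝ => v ^ (-a) * (1 + v)⁻¹) (volume.restrict s) := by
    intro s hs hms
    refine ContinuousOn.aestronglyMeasurable (fun v hv => ?_) hms
    have h0 : (0 : ℝ) < v := hs hv
    refine ContinuousAt.continuousWithinAt ?_
    exact (continuousAt_id.rpow_const (Or.inl h0.ne')).mul
      ((continuousAt_const.add continuousAt_id).inv₀ (by simp; positivity))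
  rw [← Ioc_union_Ioi_eq_Ioi zero_le_one, integrableOn_union]
  constructor
  · have h := (intervalIntegral.intervalIntegrable_rpow' (a := 0) (b := 1) (r := -a)
      (by linarith))
    rw [intervalIntegrable_iff_integrableOn_Ioc_of_le zero_le_one] at h
    refine h.mono' (hm _ Ioc_subset_Ioi_self measurableSet_Ioc) ?_
    refine (ae_restrict_iff' measurableSet_Ioc).2 (ae_of_all _ fun v hv => ?_)
    have h0 : 0 < v := hv.1
    rw [Real.norm_of_nonneg (by positivity)]
    exact mul_le_of_le_one_right (by positivity) (inv_le_one_of_one_le₀ (by linarith))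
  · have h := integrableOn_Ioi_rpow_of_lt (a := -a - 1) (by linarith) zero_lt_one
    refine h.mono' (hm _ (Ioi_subset_Ioi zero_le_one) measurableSet_Ioi) ?_
    refine (ae_restrict_iff' measurableSet_Ioi).2 (ae_of_all _ fun v hv => ?_)
    have h0 : 0 < v := zero_lt_one.trans hv
    rw [Real.norm_of_nonneg (by positivity), Real.rpow_sub_one h0.ne', div_eq_mul_inv]
    gcongr
    linarith

/-- If `S(t) = Q W(t)` for `t > 0` with `Q` injective and `S` a bounded semigroup, then `W` is
strongly continuous on `(0, ∞)`. -/
theorem IsC0Semigroup.continuousOn_of_factor {E F : Type*} [NormedAddCommGroup E]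
    [NormedSpace ℝ E] [NormedAddCommGroup F] [NormedSpace ℝ F] {S : ℝ → E →L[ℝ] E}
    (hS : IsC0Semigroup S) {M : ℝ} (hM : ∀ t, 0 ≤ t → ‖S t‖ ≤ M) {Q : F →L[ℝ] E}
    (hQ : Function.Injective Q) {W : ℝ → E →L[ℝ] F} (hW : ∀ t, 0 < t → ∀ x, Q (W t x) = S t x) :
    (∀ s t, 0 < s → 0 ≤ t → ∀ x, W (s + t) x = W s (S t x)) ∧
    ContinuousOn (fun p : ℝ × E => W p.1 p.2) (Ioi 0 ×ˢ univ) := by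
  have h1 : ∀ s t, 0 < s → 0 ≤ t → ∀ x, W (s + t) x = W s (S t x) := fun s t hs ht x => hQ <| by
    rw [hW s hs, hW _ (by linarith), hS.map_add_apply hs.le ht]
  refine ⟨h1, ?_⟩
  rintro ⟨t, x⟩ ⟨ht, -⟩
  have ht : 0 < t := ht
  -- Near t one has W(τ) = W(t/2) S(τ − t/2), and the fixed bounded operator W(t/2) passes on the
  -- strong continuity of S.
  have h2 : ContinuousAt (fun p : ℝ × E => W (t / 2) (S (p.1 - t / 2) p.2)) (t, x) := by
    refine (W (t / 2)).continuous.continuousAt.comp ?_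
    have h3 : ContinuousAt (fun p : ℝ × E => S p.1 p.2) (t - t / 2, x) :=
      (hS.continuousOn_uncurry hM).continuousAt
        (prod_mem_nhds (Ici_mem_nhds (by linarith)) univ_mem)
    have h4 : ContinuousAt (fun p : ℝ × E => (p.1 - t / 2, p.2)) (t, x) := by fun_prop
    exact ContinuousAt.comp (g := fun p : ℝ × E => S p.1 p.2)
      (f := fun p : ℝ × E => (p.1 - t / 2, p.2)) (x := (t, x)) h3 h4
  refine (h2.congr ?_).continuousWithinAt
  filter_upwards [prod_mem_nhds (Ioi_mem_nhds (show t / 2 < t by linarith)) univ_mem] with p hp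
  have hp : t / 2 < p.1 := hp.1
  rw [← h1 _ _ (by linarith) (by linarith)]
  congr 2; ring

section NegPow

variable {Z : Type*} [NormedAddCommGroup Z] [InnerProductSpace ℝ Z] [CompleteSpace Z]
  {T : ℝ → Z →L[ℝ] Z}

theorem IsAnalyticSemigroup.continuousOn (ha : IsAnalyticSemigroup T) :
    ContinuousOn T (Ioi 0) := by
  obtain ⟨T', c, -, h, -⟩ := ha.exists_deriv
  exact fun t ht => (h t ht).continuousAt.continuousWithinAt

/-- Integrability in operator norm: measurability rests on the norm continuity on (0, ∞) that
analyticity provides. -/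
theorem integrableOn_rpow_smul_semigroup (hs : IsExpStable T) (ha : IsAnalyticSemigroup T)
    {s : ℝ} (h0 : 0 < s) : IntegrableOn (fun t : ℝ => t ^ (s - 1) • T t) (Ioi 0) := by
  obtain ⟨M, ω, hM, hω, hT, -⟩ := hs.exists_bound
  have h1 := (Real.integrableOn_rpow_mul_exp (s := s - 1) (by linarith) hω).const_mul M
  refine h1.mono' ?_ ?_
  · refine ContinuousOn.aestronglyMeasurable (fun t ht => ?_) measurableSet_Ioi
    have ht : 0 < t := ht
    exact ((continuousAt_id.rpow_const (Or.inl ht.ne')).continuousWithinAt).smul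
      (ha.continuousOn t ht)
  · refine (ae_restrict_iff' measurableSet_Ioi).2 (ae_of_all _ fun t ht => ?_)
    have ht : 0 < t := ht
    rw [norm_smul, Real.norm_of_nonneg (by positivity)]
    have := hT t ht.le
    calc t ^ (s - 1) * ‖T t‖ ≤ t ^ (s - 1) * (M * Real.exp (-ω * t)) := by gcongr
      _ = _ := by ring

theorem negPow_zero : negPow T 0 = ContinuousLinearMap.id ℝ Z := by simp [negPow]

theorem negPow_of_pos {s : ℝ} (h0 : 0 < s) :
    negPow T s = (Real.Gamma s)⁻¹ • ∫ t in Ioi (0 : ℝ), t ^ (s - 1) • T t := by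
  simp [negPow, h0.ne']

/-- The product of two Gamma integrals is the integral of a convolution; by the semigroup law its
inner integral is a Beta integral times T(x). -/
theorem negPow_add (hT : IsC0Semigroup T) (hs : IsExpStable T) (ha : IsAnalyticSemigroup T)
    {a b : ℝ} (h0a : 0 ≤ a) (h0b : 0 ≤ b) :
    negPow T (a + b) = (negPow T a).comp (negPow T b) := by
  rcases h0a.eq_or_lt with rfl | h0a
  · rw [zero_add, negPow_zero]; rfl
  rcases h0b.eq_or_lt with rfl | h0b
  · rw [add_zero, negPow_zero]; rfl
  have hI := integral_posConvolution (integrableOn_rpow_smul_semigroup hs ha h0a)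
    (integrableOn_rpow_smul_semigroup hs ha h0b) (ContinuousLinearMap.compL ℝ Z Z Z)
  have h1 : ∫ x : ℝ in Ioi 0, ∫ t : ℝ in 0..x, (ContinuousLinearMap.compL ℝ Z Z Z)
        (t ^ (a - 1) • T t) ((x - t) ^ (b - 1) • T (x - t)) =
      ∫ x : ℝ in Ioi 0, (Real.Gamma a * Real.Gamma b / Real.Gamma (a + b)) •
        (x ^ (a + b - 1) • T x) := by
    refine setIntegral_congr_fun measurableSet_Ioi fun x hx => ?_
    have hx : 0 < x := hx
    rw [smul_smul, mul_comm, ← Real.integral_rpow_mul_sub_rpow h0a h0b hx,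
      ← intervalIntegral.integral_smul_const (𝕜 := ℝ) (fun t => t ^ (a - 1) * (x - t) ^ (b - 1)) (T x)]
    refine intervalIntegral.integral_congr fun t ht => ?_
    rw [uIcc_of_le hx.le] at ht
    simp only [ContinuousLinearMap.compL_apply, ContinuousLinearMap.smul_comp,
      ContinuousLinearMap.comp_smul]
    rw [← hT.map_add t (x - t) ht.1 (sub_nonneg.2 ht.2), smul_smul, add_sub_cancel]
    congr 1
    ring
  rw [h1, integral_smul, ContinuousLinearMap.compL_apply] at hI
  have ga := Real.Gamma_pos_of_pos h0a
  have gb := Real.Gamma_pos_of_pos h0b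
  have gab := Real.Gamma_pos_of_pos (add_pos h0a h0b)
  rw [negPow_of_pos h0a, negPow_of_pos h0b, negPow_of_pos (add_pos h0a h0b),
    ContinuousLinearMap.smul_comp, ContinuousLinearMap.comp_smul, ← hI, smul_smul, smul_smul]
  congr 1
  field_simp

theorem negPow_comp_apply (hT : IsC0Semigroup T) (hs : IsExpStable T)
    (ha : IsAnalyticSemigroup T) {a b : ℝ} (h0a : 0 ≤ a) (h0b : 0 ≤ b) (x : Z) :
    negPow T a (negPow T b x) = negPow T (a + b) x := by
  rw [negPow_add hT hs ha h0a h0b]; rfl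

theorem negPow_apply (hs : IsExpStable T) (ha : IsAnalyticSemigroup T) {s : ℝ} (h0 : 0 < s)
    (x : Z) : negPow T s x = (Real.Gamma s)⁻¹ • ∫ t in Ioi (0 : ℝ), t ^ (s - 1) • T t x := by
  rw [negPow_of_pos h0, smul_apply,
    ContinuousLinearMap.integral_apply (integrableOn_rpow_smul_semigroup hs ha h0)]
  rfl

theorem negPow_one_apply (hs : IsExpStable T) (ha : IsAnalyticSemigroup T) (x : Z) :
    negPow T 1 x = ∫ t in Ioi (0 : ℝ), T t x := by
  rw [negPow_apply hs ha one_pos]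
  simp

theorem semigroup_negPow_comm (hT : IsC0Semigroup T) (hs : IsExpStable T)
    (ha : IsAnalyticSemigroup T) {a : ℝ} (h0 : 0 ≤ a) {t : ℝ} (ht : 0 ≤ t) (x : Z) :
    T t (negPow T a x) = negPow T a (T t x) := by
  rcases h0.eq_or_lt with rfl | h0
  · rw [negPow_zero]; rfl
  have hi : IntegrableOn (fun t : ℝ => t ^ (a - 1) • T t x) (Ioi 0) :=
    (integrableOn_rpow_smul_semigroup hs ha h0).apply_continuousLinearMap x
  rw [negPow_apply hs ha h0, negPow_apply hs ha h0, map_smul,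
    ← ContinuousLinearMap.integral_comp_comm _ hi]
  congr 1
  refine setIntegral_congr_fun measurableSet_Ioi fun u hu => ?_
  simp only [map_smul]
  rw [hT.comm_apply ht (le_of_lt hu)]

/-- `-negPow T 1` is a right inverse of the generator. -/
theorem tendsto_negPow_one (hT : IsC0Semigroup T) (hs : IsExpStable T)
    (ha : IsAnalyticSemigroup T) (x : Z) :
    Tendsto (fun h : ℝ => h⁻¹ • (T h (negPow T 1 x) - negPow T 1 x)) (𝓝[>] 0) (𝓝 (-x)) := by
  obtain ⟨M, ω, hM, hω, -, hTM⟩ := hs.exists_bound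
  have hi : IntegrableOn (fun t : ℝ => T t x) (Ioi 0) := by
    have h := Integrable.apply_continuousLinearMap
      (integrableOn_rpow_smul_semigroup hs ha one_pos) x
    simp only [sub_self, Real.rpow_zero, one_smul] at h
    exact h
  -- T is arbitrary at negative times; `max t 0` gives an orbit that is continuous on the whole
  -- line.
  have hc : Continuous fun t : ℝ => T (max t 0) x :=
    (hT.continuousOn hTM x).comp_continuous (f := fun t : ℝ => max t 0) (by fun_prop)
      fun t => mem_Ici.2 (le_max_right _ _)
  have hd := (hc.integral_hasStrictDerivAt 0 0).hasDerivAt.hasDerivWithinAt (s := Ioi 0)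
  rw [hasDerivWithinAt_iff_tendsto_slope' self_notMem_Ioi] at hd
  simp only [max_self, hT.map_zero_apply] at hd
  refine hd.neg.congr' ?_
  filter_upwards [self_mem_nhdsWithin] with h hh
  have hh : 0 < h := hh
  rw [slope_def_module, intervalIntegral.integral_same, sub_zero, sub_zero, ← smul_neg]
  congr 1
  -- Applying T(h) moves the range of integration to (h, ∞), so the difference is minus the integral
  -- over (0, h).
  have h1 : T h (negPow T 1 x) = ∫ t in Ioi h, T t x := by
    rw [negPow_one_apply hs ha, ← ContinuousLinearMap.integral_comp_comm _ hi]
    have : ∫ t in Ioi (0 : ℝ), T h (T t x) = ∫ t in Ioi (0 : ℝ), T (t + h) x :=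
      setIntegral_congr_fun measurableSet_Ioi fun t ht => by
        rw [add_comm, hT.map_add_apply hh.le (le_of_lt ht)]
    rw [this]
    have h5 := (measurePreserving_add_right volume h).setIntegral_preimage_emb
      (measurableEmbedding_addRight h) (fun t => T t x) (Ioi h)
    rwa [preimage_add_const_Ioi, sub_self] at h5
  have h2 : ∫ t in (0 : ℝ)..h, T (max t 0) x = ∫ t in (0 : ℝ)..h, T t x := by
    refine intervalIntegral.integral_congr fun t ht => ?_
    rw [uIcc_of_le hh.le] at ht
    simp only [max_eq_left ht.1]
  have h3 := intervalIntegral.integral_Ioi_sub_Ioi hi hh.le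
  rw [h1, h2, negPow_one_apply hs ha, ← h3]
  abel

theorem negPow_one_injective (hT : IsC0Semigroup T) (hs : IsExpStable T)
    (ha : IsAnalyticSemigroup T) : Function.Injective (negPow T 1) := by
  rw [injective_iff_map_eq_zero]
  intro x hx
  have h := tendsto_negPow_one hT hs ha x
  simp only [hx, map_zero, sub_zero, smul_zero] at h
  exact neg_eq_zero.1 (tendsto_nhds_unique h tendsto_const_nhds)

theorem negPow_injective (hT : IsC0Semigroup T) (hs : IsExpStable T)
    (ha : IsAnalyticSemigroup T) {a : ℝ} (h0 : 0 ≤ a) (h1 : a ≤ 1) :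
    Function.Injective (negPow T a) := by
  refine Function.Injective.of_comp (f := negPow T (1 - a)) ?_
  have h : (negPow T (1 - a) ∘ negPow T a) = negPow T 1 := by
    funext x
    rw [Function.comp_apply, negPow_comp_apply hT hs ha (sub_nonneg.2 h1) h0]
    congr 2; ring
  rw [h]
  exact negPow_one_injective hT hs ha

/-- x is the limit of −h⁻¹ (T(h) − 1)(−A)⁻¹ x, and these vectors lie in ran (−A)⁻¹ ⊆ ran (−A)^{-a}.
-/
theorem negPow_denseRange (hT : IsC0Semigroup T) (hs : IsExpStable T)
    (ha : IsAnalyticSemigroup T) {a : ℝ} (h0 : 0 ≤ a) (h1 : a ≤ 1) :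
    DenseRange (negPow T a) := by
  intro x
  have h := (tendsto_negPow_one hT hs ha x).neg
  rw [neg_neg] at h
  refine mem_closure_of_tendsto h ?_
  filter_upwards [self_mem_nhdsWithin] with t ht
  refine ⟨negPow T (1 - a) (-(t⁻¹ • (T t x - x))), ?_⟩
  rw [negPow_comp_apply hT hs ha h0 (sub_nonneg.2 h1), show a + (1 - a) = 1 by ring, map_neg,
    map_smul, map_sub, semigroup_negPow_comm hT hs ha zero_le_one (le_of_lt ht)]

/-- `negPow T 1` is the inverse of −A; every later use of A passes through this bounded operator. -/
theorem IsGenerator.mem_graph_iff {A : Z →ₗ.[ℝ] Z} (hA : IsGenerator A T) (hT : IsC0Semigroup T)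
    (hs : IsExpStable T) (ha : IsAnalyticSemigroup T) (x y : Z) :
    (x, y) ∈ A.graph ↔ x = -negPow T 1 y := by
  rw [hA]
  constructor
  · intro h
    have h1 := ((negPow T 1).continuous.tendsto y).comp h
    have h2 := tendsto_negPow_one hT hs ha x
    have h3 := tendsto_nhds_unique (h1.congr' ?_) h2
    · rw [h3, neg_neg]
    · filter_upwards [self_mem_nhdsWithin] with t ht
      rw [Function.comp_apply, map_smul, map_sub,
        semigroup_negPow_comm hT hs ha zero_le_one (le_of_lt ht)]
  · rintro rfl
    have h := (tendsto_negPow_one hT hs ha y).neg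
    rw [neg_neg] at h
    refine h.congr fun t => ?_
    rw [← smul_neg, map_neg]
    congr 1; abel

/-- Smoothing: `T(t) = (-A)^{-a} W(t)` with `‖W(t)‖ ≤ M t^{-a}`. -/
theorem exists_smoothing (hT : IsC0Semigroup T) (hs : IsExpStable T)
    (ha : IsAnalyticSemigroup T) {a : ℝ} (h0 : 0 < a) (h1 : a < 1) :
    ∃ (W : ℝ → Z →L[ℝ] Z) (M : ℝ), 0 ≤ M ∧ (∀ t, 0 < t → ∀ x, negPow T a (W t x) = T t x) ∧
      ∀ t, 0 < t → ‖W t‖ ≤ M * t ^ (-a) := by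
  obtain ⟨T', c, hc, hT', hb⟩ := ha.exists_deriv
  have hg := Real.Gamma_pos_of_pos (sub_pos.2 h1)
  set κ := ∫ v in Ioi (0 : ℝ), v ^ (-a) * (1 + v)⁻¹ with hκ
  have hκ0 : 0 ≤ κ := setIntegral_nonneg measurableSet_Ioi fun v hv => by
    have hv : 0 < v := hv
    positivity
  have hshift : ∀ t u, 0 < t → 0 < u → (T u).comp (T' t) = T' (t + u) := by
    intro t u ht hu
    have e1 : HasDerivAt (fun s => (T u).comp (T s)) ((T u).comp (T' t)) t :=
      ((ContinuousLinearMap.compL ℝ Z Z Z (T u)).hasFDerivAt.comp_hasDerivAt t (hT' t ht))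
    have e2 : HasDerivAt (fun s => T (s + u)) (T' (t + u)) t :=
      (hT' (t + u) (by linarith)).comp_add_const t u
    refine e1.unique (e2.congr_of_eventuallyEq ?_)
    filter_upwards [lt_mem_nhds ht] with s hs'
    rw [← hT.map_add u s hu.le hs'.le, add_comm]
  -- (−A)^a T(t) = −(−A)^{-(1-a)} T'(t), as T' = A T. In the Gamma integral the bound ‖T'(t+u)‖ ≤
  -- c/(t+u) and the substitution u = t v produce κ t^(-a).
  refine ⟨fun t => -((negPow T (1 - a)).comp (T' t)), (Real.Gamma (1 - a))⁻¹ * (c * κ),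
    by positivity, ?_, ?_⟩
  · intro t ht x
    rw [neg_apply, map_neg, ContinuousLinearMap.comp_apply,
      negPow_comp_apply hT hs ha h0.le (sub_nonneg.2 h1.le), show a + (1 - a) = 1 by ring]
    have e1 : Tendsto (fun h : ℝ => h⁻¹ • (T (t + h) x - T t x)) (𝓝[>] 0) (𝓝 (T' t x)) := by
      have e : HasDerivAt (fun s => T s x) (T' t x) t := by
        have := (ContinuousLinearMap.apply ℝ Z x).hasFDerivAt.comp_hasDerivAt t (hT' t ht)
        simpa using! this
      exact e.tendsto_slope_zero_right
    have e2 := ((negPow T 1).continuous.tendsto _).comp e1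
    have e3 := tendsto_negPow_one hT hs ha (T t x)
    have e4 := tendsto_nhds_unique (e2.congr' ?_) e3
    · rw [e4, neg_neg]
    · filter_upwards [self_mem_nhdsWithin] with h hh
      have hh : 0 < h := hh
      rw [Function.comp_apply, map_smul, map_sub,
        semigroup_negPow_comm hT hs ha zero_le_one hh.le, ← hT.map_add_apply hh.le ht.le,
        add_comm]
  · intro t ht
    rw [norm_neg, negPow_of_pos (sub_pos.2 h1), ContinuousLinearMap.smul_comp, norm_smul,
      Real.norm_of_nonneg (by positivity), mul_assoc]
    gcongr
    have e1 : (∫ u in Ioi (0 : ℝ), u ^ (1 - a - 1) • T u).comp (T' t) =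
        ∫ u in Ioi (0 : ℝ), u ^ (-a) • T' (t + u) := by
      have := ((ContinuousLinearMap.compL ℝ Z Z Z).flip (T' t)).integral_comp_comm
        (integrableOn_rpow_smul_semigroup hs ha (sub_pos.2 h1))
      change ((ContinuousLinearMap.compL ℝ Z Z Z).flip (T' t)) _ = _
      rw [← this]
      refine setIntegral_congr_fun measurableSet_Ioi fun u hu => ?_
      simp only [ContinuousLinearMap.flip_apply, ContinuousLinearMap.compL_apply,
        ContinuousLinearMap.smul_comp]
      rw [hshift t u ht hu]
      congr 2; ring
    have e2 : ∀ u ∈ Ioi (0 : ℝ), t ^ (-a - 1) * ((t⁻¹ * u) ^ (-a) * (1 + t⁻¹ * u)⁻¹) =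
        u ^ (-a) * (t + u)⁻¹ := by
      intro u hu
      have hu : 0 < u := hu
      rw [Real.mul_rpow (by positivity) hu.le, Real.inv_rpow ht.le, Real.rpow_sub_one ht.ne']
      have : t ^ (-a) ≠ 0 := by positivity
      field_simp
    have hint : IntegrableOn (fun u : ℝ => u ^ (-a) * (t + u)⁻¹) (Ioi 0) := by
      have := (integrableOn_Ioi_comp_mul_left_iff (fun v : ℝ => v ^ (-a) * (1 + v)⁻¹) 0
        (inv_pos.2 ht)).2 (by simpa using Real.integrableOn_rpow_neg_div_one_add h0 h1)
      exact IntegrableOn.congr_fun (this.const_mul (t ^ (-a - 1))) e2 measurableSet_Ioi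
    have e3 : ∫ u in Ioi (0 : ℝ), u ^ (-a) * (t + u)⁻¹ = κ * t ^ (-a) := by
      rw [← setIntegral_congr_fun measurableSet_Ioi e2, integral_const_mul,
        integral_comp_mul_left_Ioi (fun v : ℝ => v ^ (-a) * (1 + v)⁻¹) 0 (inv_pos.2 ht),
        mul_zero, ← hκ, inv_inv, smul_eq_mul, Real.rpow_sub_one ht.ne']
      field_simp
    rw [e1, mul_assoc, ← e3, ← integral_const_mul]
    refine norm_integral_le_of_norm_le (hint.const_mul c) ?_
    refine (ae_restrict_iff' measurableSet_Ioi).2 (ae_of_all _ fun u hu => ?_)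
    have hu : 0 < u := hu
    rw [norm_smul, Real.norm_of_nonneg (by positivity)]
    calc u ^ (-a) * ‖T' (t + u)‖ ≤ u ^ (-a) * (c / (t + u)) := by
          gcongr; exact hb _ (by linarith)
      _ = _ := by ring

end NegPow

end

noncomputable section

/-! ### Rank one perturbations of a smoothing semigroup -/

/-- The integral of a non-integrable function is 0 by convention, whereas the Beta value is
positive. -/
theorem intervalIntegrable_rpow_mul_sub_rpow {a x : ℝ} (ha : a < 1) (hx : 0 < x) :
    IntervalIntegrable (fun t : ℝ => t ^ (-a) * (x - t) ^ (-a)) volume 0 x := by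
  have h := Real.integral_rpow_mul_sub_rpow (sub_pos.2 ha) (sub_pos.2 ha) hx
  rw [show 1 - a - 1 = -a by ring] at h
  by_contra hn
  rw [intervalIntegral.integral_undef hn] at h
  have g1 := Real.Gamma_pos_of_pos (sub_pos.2 ha)
  have g2 := Real.Gamma_pos_of_pos (add_pos (sub_pos.2 ha) (sub_pos.2 ha))
  have : 0 < x ^ (1 - a + (1 - a) - 1) *
    (Real.Gamma (1 - a) * Real.Gamma (1 - a) / Real.Gamma (1 - a + (1 - a))) := by positivity
  linarith

/-- The exponent 1 − 2a is split so that x^(-a) is the admissible singularity and x^(1-a) the small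
factor of the Gronwall argument. -/
theorem exists_integral_rpow_mul_sub_rpow {a : ℝ} (ha : a < 1) :
    ∃ κ : ℝ, 0 < κ ∧ ∀ x : ℝ, 0 < x →
      ∫ t in (0 : ℝ)..x, t ^ (-a) * (x - t) ^ (-a) = κ * x ^ (1 - a) * x ^ (-a) := by
  have g1 := Real.Gamma_pos_of_pos (sub_pos.2 ha)
  have g2 := Real.Gamma_pos_of_pos (add_pos (sub_pos.2 ha) (sub_pos.2 ha))
  refine ⟨Real.Gamma (1 - a) * Real.Gamma (1 - a) / Real.Gamma (1 - a + (1 - a)), by positivity,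
    fun x hx => ?_⟩
  have h := Real.integral_rpow_mul_sub_rpow (sub_pos.2 ha) (sub_pos.2 ha) hx
  rw [show 1 - a - 1 = -a by ring] at h
  rw [h, mul_assoc, ← Real.rpow_add hx, mul_comm]
  congr 2; ring

variable {Z X : Type*} [NormedAddCommGroup Z] [NormedSpace ℝ Z] [CompleteSpace Z]
  [NormedAddCommGroup X] [NormedSpace ℝ X] [CompleteSpace X]

/-- A semigroup `S` on `X` whose generator is a rank one perturbation of the generator `-N⁻¹` of a
semigroup `U` that smooths into the range of `Q`: with `ℓ = c V = C N` and `ℓ b = 1`, the generator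
of `S` is minus the inverse of `x ↦ N (x - (1 - β) ℓ(x) b)`. -/
structure RankOnePerturbation (U : ℝ → X →L[ℝ] X) (N : X →L[ℝ] X) (Q : Z →L[ℝ] X)
    (W : ℝ → X →L[ℝ] Z) (V : X →L[ℝ] Z) (c : Z →L[ℝ] ℝ) (b : X) (β a : ℝ)
    (S : ℝ → X →L[ℝ] X) : Prop where
  semigroup : IsC0Semigroup U
  bounded : ∃ M, ∀ t, 0 ≤ t → ‖U t‖ ≤ M
  tendsto : ∀ x, Tendsto (fun h : ℝ => h⁻¹ • (U h (N x) - N x)) (𝓝[>] 0) (𝓝 (-x))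
  injective : Function.Injective Q
  smooth : ∀ t, 0 < t → ∀ x, Q (W t x) = U t x
  smooth_bound : ∃ M, 0 ≤ M ∧ ∀ t, 0 < t → ‖W t‖ ≤ M * t ^ (-a)
  factor : ∀ x, Q (V x) = N x
  dense : DenseRange N
  normalized : c (V b) = 1
  β_pos : 0 < β
  a_pos : 0 < a
  a_lt_one : a < 1
  semigroup' : IsC0Semigroup S
  stable' : IsExpStable S
  tendsto' : ∀ x, Tendsto (fun h : ℝ => h⁻¹ • (S h (N (x - ((1 - β) * c (V x)) • b)) -
    N (x - ((1 - β) * c (V x)) • b))) (𝓝[>] 0) (𝓝 (-x))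
  comm' : ∀ t, 0 ≤ t → ∀ x, S t (N (x - ((1 - β) * c (V x)) • b)) =
    N (S t x - ((1 - β) * c (V (S t x))) • b)

namespace RankOnePerturbation

variable {U : ℝ → X →L[ℝ] X} {N : X →L[ℝ] X} {Q : Z →L[ℝ] X} {W : ℝ → X →L[ℝ] Z}
  {V : X →L[ℝ] Z} {c : Z →L[ℝ] ℝ} {b : X} {β a : ℝ} {S : ℝ → X →L[ℝ] X}
  (H : RankOnePerturbation U N Q W V c b β a S)

include H

/-- Variation of constants: `S` as a perturbation of `U` on the domain of the generator. -/
theorem duhamel {t : ℝ} (ht : 0 ≤ t) (p : X) :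
    S t (N (p - ((1 - β) * c (V p)) • b)) =
      U t (N (p - ((1 - β) * c (V p)) • b)) -
        ∫ τ in (0 : ℝ)..t, ((1 - β) * c (V (S τ p))) • U (t - τ) b := by
  obtain ⟨M, hM⟩ := H.bounded
  obtain ⟨M', ω, -, -, -, hM'⟩ := H.stable'.exists_bound
  set x := N (p - ((1 - β) * c (V p)) • b) with hx
  have hUc := H.semigroup.continuousOn_uncurry hM
  have hSc := H.semigroup'.continuousOn hM'
  have hcont : ContinuousOn (fun τ => U (t - τ) (S τ x)) (uIcc 0 t) := by
    rw [uIcc_of_le ht]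
    refine hUc.comp (g := fun q : ℝ × X => U q.1 q.2) (f := fun τ => (t - τ, S τ x)) ?_ ?_
    · exact ((continuous_const.sub continuous_id).continuousOn).prodMk
        ((hSc x).mono fun τ hτ => hτ.1)
    · exact fun τ hτ => ⟨mem_Ici.2 (sub_nonneg.2 hτ.2), mem_univ _⟩
  have hcont' : ContinuousOn (fun τ => -(((1 - β) * c (V (S τ p))) • U (t - τ) b)) (uIcc 0 t) := by
    rw [uIcc_of_le ht]
    have e1 : ContinuousOn (fun τ => c (V (S τ p))) (Icc 0 t) :=
      (c.continuous.comp V.continuous).comp_continuousOn ((hSc p).mono fun τ hτ => hτ.1)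
    have e2 : ContinuousOn (fun τ => U (t - τ) b) (Icc 0 t) :=
      (H.semigroup.continuousOn hM b).comp (continuous_const.sub continuous_id).continuousOn
        fun τ hτ => mem_Ici.2 (sub_nonneg.2 hτ.2)
    exact ((e1.const_smul (1 - β)).smul e2).neg
  -- The right derivative is U(t−τ)(A_β − A) S(τ)x. It makes sense because S(τ)x stays in the range
  -- of N, so both difference quotients at S(τ)x converge.
  have hderiv : ∀ τ ∈ Ioo (min 0 t) (max 0 t), HasDerivWithinAt (fun τ => U (t - τ) (S τ x))
      (-(((1 - β) * c (V (S τ p))) • U (t - τ) b)) (Ioi τ) τ := by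
    intro τ hτ
    rw [min_eq_left ht, max_eq_right ht] at hτ
    obtain ⟨h0, h1⟩ := hτ
    rw [hasDerivWithinAt_iff_tendsto_slope' self_notMem_Ioi]
    set q := S τ p with hq
    have hv : S τ x = N (q - ((1 - β) * c (V q)) • b) := H.comm' τ h0.le p
    set v := S τ x
    have e1 : Tendsto (fun h : ℝ => h⁻¹ • (S h v - U h v)) (𝓝[>] 0)
        (𝓝 (-(((1 - β) * c (V q)) • b))) := by
      have d1 := H.tendsto' q
      have d2 := H.tendsto (q - ((1 - β) * c (V q)) • b)
      rw [← hv] at d1 d2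
      have d3 := d1.sub d2
      rw [show -q - -(q - ((1 - β) * c (V q)) • b) = -(((1 - β) * c (V q)) • b) by abel] at d3
      refine d3.congr fun h => ?_
      rw [← smul_sub]
      congr 1; abel
    have e2 : Tendsto (fun s : ℝ => s - τ) (𝓝[>] τ) (𝓝[>] 0) := by
      refine tendsto_nhdsWithin_iff.2 ⟨?_, ?_⟩
      · have : Continuous fun s : ℝ => s - τ := by fun_prop
        exact (this.tendsto' τ 0 (sub_self τ)).mono_left nhdsWithin_le_nhds
      · filter_upwards [self_mem_nhdsWithin] with s hs
        exact sub_pos.2 (mem_Ioi.1 hs)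
    have e3 : Tendsto (fun s : ℝ => t - s) (𝓝[>] τ) (𝓝 (t - τ)) :=
      ((continuous_const.sub continuous_id).tendsto τ).mono_left nhdsWithin_le_nhds
    have e4 : ContinuousAt (fun q : ℝ × X => U q.1 q.2)
        (t - τ, -(((1 - β) * c (V q)) • b)) :=
      hUc.continuousAt (prod_mem_nhds (Ici_mem_nhds (sub_pos.2 h1)) univ_mem)
    have e5 := Tendsto.comp (g := fun q : ℝ × X => U q.1 q.2) e4 (e3.prodMk_nhds (e1.comp e2))
    simp only [map_neg, map_smul] at e5
    refine e5.congr' ?_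
    filter_upwards [self_mem_nhdsWithin, mem_nhdsWithin_of_mem_nhds (Iio_mem_nhds h1)]
      with s hs hs'
    have hs : τ < s := hs
    have hs' : s < t := hs'
    rw [Function.comp_apply, slope_def_module, Function.comp_apply, map_smul, map_sub]
    congr 2
    · rw [← H.semigroup'.map_add_apply (sub_nonneg.2 hs.le) h0.le, sub_add_cancel]
    · rw [← H.semigroup.map_add_apply (sub_nonneg.2 hs'.le) (sub_nonneg.2 hs.le)]
      congr 2; ring
  have hF := intervalIntegral.integral_eq_sub_of_hasDeriv_right hcont hderiv
    hcont'.intervalIntegrable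
  rw [sub_self, H.semigroup.map_zero_apply, sub_zero, H.semigroup'.map_zero_apply,
    intervalIntegral.integral_neg] at hF
  rw [sub_eq_add_neg, hF]
  abel

theorem continuousOn_smooth : ContinuousOn (fun p : ℝ × X => W p.1 p.2) (Ioi 0 ×ˢ univ) := by
  obtain ⟨M, hM⟩ := H.bounded
  exact (H.semigroup.continuousOn_of_factor hM H.injective H.smooth).2

theorem intervalIntegrable_smooth {t : ℝ} (ht : 0 < t) {η : ℝ → ℝ} (hη : ContinuousOn η (Ici 0))
    {K : ℝ} (hK : ∀ τ, 0 < τ → τ ≤ t → |η τ| ≤ K * τ ^ (-a)) {B : ℝ}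
    (hB : ∀ τ, 0 < τ → ‖W τ b‖ ≤ B * τ ^ (-a)) :
    IntervalIntegrable (fun τ => η τ • W (t - τ) b) volume 0 t ∧
    ‖∫ τ in (0 : ℝ)..t, η τ • W (t - τ) b‖ ≤
      ∫ τ in (0 : ℝ)..t, K * B * (τ ^ (-a) * (t - τ) ^ (-a)) := by
  have hbi := (intervalIntegrable_rpow_mul_sub_rpow H.a_lt_one ht).const_mul (K * B)
  have hb : ∀ τ ∈ Ioo 0 t, ‖η τ • W (t - τ) b‖ ≤ K * B * (τ ^ (-a) * (t - τ) ^ (-a)) := by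
    intro τ hτ
    rw [norm_smul, Real.norm_eq_abs]
    calc |η τ| * ‖W (t - τ) b‖ ≤ (K * τ ^ (-a)) * (B * (t - τ) ^ (-a)) := by
          have h1 := hK τ hτ.1 hτ.2.le
          gcongr
          · exact (abs_nonneg _).trans h1
          · exact hB _ (sub_pos.2 hτ.2)
      _ = _ := by ring
  have hm : AEStronglyMeasurable (fun τ => η τ • W (t - τ) b) (volume.restrict (Ioo 0 t)) := by
    refine ContinuousOn.aestronglyMeasurable ?_ measurableSet_Ioo
    refine (hη.mono fun τ hτ => hτ.1.le).smul ?_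
    refine H.continuousOn_smooth.comp (g := fun p : ℝ × X => W p.1 p.2)
      (f := fun τ => (t - τ, b)) (by fun_prop) fun τ hτ => ⟨sub_pos.2 hτ.2, mem_univ _⟩
  -- W(t − τ) is controlled only for τ < t; the endpoint is a null set.
  have hae : ∀ᵐ τ, τ ∈ Ioc 0 t → ‖η τ • W (t - τ) b‖ ≤ K * B * (τ ^ (-a) * (t - τ) ^ (-a)) := by
    have : ∀ᵐ τ : ℝ, τ ≠ t := by simp [ae_iff]
    filter_upwards [this] with τ h1 h2
    exact hb τ ⟨h2.1, lt_of_le_of_ne h2.2 h1⟩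
  constructor
  · rw [intervalIntegrable_iff_integrableOn_Ioc_of_le ht.le] at hbi ⊢
    refine hbi.mono' ?_ ((ae_restrict_iff' measurableSet_Ioc).2 hae)
    rwa [← restrict_Ioo_eq_restrict_Ioc]
  · exact intervalIntegral.norm_integral_le_of_norm_le ht.le hae hbi

/-- The perturbed semigroup smooths as well, for small times. -/
theorem exists_bound_small : ∃ t₀ M : ℝ, 0 < t₀ ∧ t₀ ≤ 1 ∧ 0 ≤ M ∧ ∀ t, 0 < t → t ≤ t₀ → ∀ p : X,
    ∃ y : Z, Q y = S t (N (p - ((1 - β) * c (V p)) • b)) ∧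
      ‖y‖ ≤ M * t ^ (-a) * ‖N (p - ((1 - β) * c (V p)) • b)‖ := by
  obtain ⟨M, hM0, hM⟩ := H.smooth_bound
  obtain ⟨κ, hκ, hκI⟩ := exists_integral_rpow_mul_sub_rpow H.a_lt_one
  obtain ⟨M', ω, -, -, -, hM'⟩ := H.stable'.exists_bound
  have ha := H.a_pos
  have hβ := H.β_pos
  have hWb : ∀ x τ, 0 < τ → ‖W τ x‖ ≤ (M * ‖x‖) * τ ^ (-a) := fun x τ hτ => by
    refine ((W τ).le_of_opNorm_le (hM τ hτ) x).trans (le_of_eq (by ring))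
  set B := M * ‖b‖ with hB
  set δ := ‖c‖ * (|1 - β| / β * B * κ) with hδ
  have hδ0 : 0 ≤ δ := by positivity
  -- The threshold is 1/2 in disguise: it is the factor by which the singular integral will be
  -- absorbed.
  obtain ⟨t₀, ht₀, ht₀1, ht₀δ⟩ : ∃ t₀ : ℝ, 0 < t₀ ∧ t₀ ≤ 1 ∧ δ * t₀ ^ (1 - a) ≤ β⁻¹ * β / 2 := by
    have hc : Tendsto (fun t : ℝ => δ * t ^ (1 - a)) (𝓝[>] 0) (𝓝 0) := by
      have h1 : ContinuousAt (fun t : ℝ => δ * t ^ (1 - a)) 0 :=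
        continuousAt_const.mul
          (Real.continuousAt_rpow_const _ _ (Or.inr (sub_pos.2 H.a_lt_one).le))
      have h2 : Tendsto (fun t : ℝ => δ * t ^ (1 - a)) (𝓝[>] 0) (𝓝 (δ * 0 ^ (1 - a))) :=
        h1.tendsto.mono_left nhdsWithin_le_nhds
      rwa [Real.zero_rpow (sub_pos.2 H.a_lt_one).ne', mul_zero] at h2
    have h3 := hc.eventually (ge_mem_nhds (show (0 : ℝ) < β⁻¹ * β / 2 by positivity))
    have h4 : ∀ᶠ t : ℝ in 𝓝[>] 0, t ≤ 1 :=
      mem_nhdsWithin_of_mem_nhds (Iic_mem_nhds one_pos)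
    obtain ⟨t, h5, h6, h7⟩ := (h3.and (h4.and self_mem_nhdsWithin)).exists
    exact ⟨t, h7, h6, h5⟩
  rw [inv_mul_cancel₀ hβ.ne'] at ht₀δ
  refine ⟨t₀, M + |1 - β| / β * (2 * ‖c‖ * M) * B * κ, ht₀, ht₀1, by positivity, ?_⟩
  intro t ht htt p
  set x := N (p - ((1 - β) * c (V p)) • b) with hx
  set y : ℝ → ℝ := fun τ => β * c (V (S τ p)) with hy
  set η : ℝ → ℝ := fun τ => (1 - β) * c (V (S τ p)) with hη
  have hcV : ContinuousOn (fun τ => c (V (S τ p))) (Ici 0) :=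
    (c.continuous.comp V.continuous).comp_continuousOn (H.semigroup'.continuousOn hM' p)
  have hηc : ContinuousOn η (Ici 0) := continuousOn_const.mul hcV
  have hyc : ContinuousOn y (Ici 0) := continuousOn_const.mul hcV
  have hηy : ∀ τ, |η τ| = |1 - β| / β * |y τ| := fun τ => by
    simp only [hη, hy, abs_mul, abs_of_pos hβ]
    field_simp
  -- The Duhamel formula lifted through Q: a bound K τ^(-a) for y controls the correction term in Z
  -- linearly in K.
  have hsol : ∀ s, 0 < s → ∀ K, (∀ τ, 0 < τ → τ ≤ s → |y τ| ≤ K * τ ^ (-a)) →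
      Q (W s x - ∫ τ in (0 : ℝ)..s, η τ • W (s - τ) b) = S s x ∧
      ‖∫ τ in (0 : ℝ)..s, η τ • W (s - τ) b‖ ≤
        |1 - β| / β * K * B * κ * s ^ (1 - a) * s ^ (-a) := by
    intro s hs K hK
    obtain ⟨i1, i2⟩ := H.intervalIntegrable_smooth hs hηc (K := |1 - β| / β * K)
      (fun τ h0 h1 => by
        rw [hηy, mul_assoc]
        exact mul_le_mul_of_nonneg_left (hK τ h0 h1) (by positivity)) (hWb b)
    constructor
    · rw [map_sub, H.smooth s hs, H.duhamel hs.le, ← hx,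
        ← ContinuousLinearMap.intervalIntegral_comp_comm Q i1]
      congr 1
      refine intervalIntegral.integral_congr_ae ?_
      have : ∀ᵐ τ : ℝ, τ ≠ s := by simp [ae_iff]
      filter_upwards [this] with τ h1 h2
      rw [uIoc_of_le hs.le] at h2
      rw [map_smul, H.smooth _ (sub_pos.2 (lt_of_le_of_ne h2.2 h1))]
    · refine i2.trans (le_of_eq ?_)
      rw [intervalIntegral.integral_const_mul, hκI s hs]
      ring
  -- y(s) is the output C S(s)x: S(s)x stays in the domain of A_β, where ℓ(b) = 1 reduces C to β ℓ.
  have hcy : ∀ s, 0 ≤ s → ∀ u, Q u = S s x → c u = y s := by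
    intro s hs u hu
    rw [hx, H.comm' s hs, ← H.factor] at hu
    rw [H.injective hu, map_sub, map_sub, map_smul, map_smul, H.normalized, hy, smul_eq_mul]
    ring
  -- a bound for `t ^ a * |y t|` on `[0, t₀]`
  obtain ⟨s, ⟨hs0, hs1⟩, hmax⟩ := isCompact_Icc.exists_isMaxOn (nonempty_Icc.2 ht₀.le)
    (f := fun τ => τ ^ a * |y τ|) (ContinuousOn.mul
      (fun τ _ => (Real.continuousAt_rpow_const _ _ (Or.inr ha.le)).continuousWithinAt)
      ((hyc.mono fun τ hτ => hτ.1).abs))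
  set K := s ^ a * |y s| with hK
  have hyK : ∀ τ, 0 < τ → τ ≤ t₀ → |y τ| ≤ K * τ ^ (-a) := by
    intro τ h0 h1
    have := hmax (a := τ) ⟨h0.le, h1⟩
    simp only [mem_ofPred_eq] at this
    rw [Real.rpow_neg h0.le, ← div_eq_mul_inv, le_div_iff₀ (by positivity), mul_comm]
    exact this
  -- K is finite beforehand since y is continuous at 0. At the maximum point the lifted formula
  -- gives K ≤ ‖c‖ M ‖x‖ + K/2, a bound in terms of ‖x‖ alone.
  have hKb : K ≤ 2 * ‖c‖ * M * ‖x‖ := by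
    rcases hs0.eq_or_lt with rfl | hs0
    · rw [hK, Real.zero_rpow ha.ne', zero_mul]; positivity
    have hK0 : 0 ≤ K := by positivity
    obtain ⟨h1, h2⟩ := hsol s hs0 K fun τ h0 h1 => hyK τ h0 (h1.trans hs1)
    have h3 := hcy s hs0.le _ h1
    have hsa : s ^ a * s ^ (-a) = 1 := by rw [← Real.rpow_add hs0]; simp
    have h4 : |y s| ≤ ‖c‖ * (M * ‖x‖ * s ^ (-a) +
        |1 - β| / β * K * B * κ * s ^ (1 - a) * s ^ (-a)) := by
      rw [← h3, ← Real.norm_eq_abs]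
      refine (c.le_opNorm _).trans ?_
      gcongr
      exact (norm_sub_le _ _).trans (add_le_add (hWb x s hs0) h2)
    have h5 : K ≤ ‖c‖ * M * ‖x‖ + K * (δ * s ^ (1 - a)) := by
      calc K ≤ s ^ a * (‖c‖ * (M * ‖x‖ * s ^ (-a) +
              |1 - β| / β * K * B * κ * s ^ (1 - a) * s ^ (-a))) := by rw [hK]; gcongr
        _ = (s ^ a * s ^ (-a)) * (‖c‖ * M * ‖x‖ + K * (δ * s ^ (1 - a))) := by rw [hδ]; ring
        _ = _ := by rw [hsa, one_mul]
    have h6 : δ * s ^ (1 - a) ≤ 1 / 2 := by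
      refine le_trans ?_ ht₀δ
      gcongr
      exact (sub_pos.2 H.a_lt_one).le
    nlinarith
  obtain ⟨h1, h2⟩ := hsol t ht K fun τ h0 h1 => hyK τ h0 (h1.trans htt)
  refine ⟨_, h1, ?_⟩
  refine (norm_sub_le _ _).trans ((add_le_add (hWb x t ht) h2).trans ?_)
  have h3 : t ^ (1 - a) ≤ 1 := Real.rpow_le_one ht.le (htt.trans ht₀1) (sub_pos.2 H.a_lt_one).le
  have h4 : |1 - β| / β * K * B * κ * t ^ (1 - a) * t ^ (-a) ≤
      |1 - β| / β * (2 * ‖c‖ * M * ‖x‖) * B * κ * 1 * t ^ (-a) := by gcongr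
  refine (add_le_add_right h4 _).trans (le_of_eq ?_)
  ring

end RankOnePerturbation

end

/-! ### Smoothing of the perturbed semigroup on the whole space -/

noncomputable section

variable {Z X : Type*} [NormedAddCommGroup Z] [NormedSpace ℝ Z] [CompleteSpace Z]
  [NormedAddCommGroup X] [NormedSpace ℝ X] [CompleteSpace X]

/-- An operator that factors boundedly through `Q` on the range of a dense map does so everywhere. -/
theorem ContinuousLinearMap.exists_factor_of_denseRange {Y : Type*} [NormedAddCommGroup Y]
    [NormedSpace ℝ Y] {Q : Z →L[ℝ] X} (hQ : Function.Injective Q) (S : Y →L[ℝ] X) {i : Y →L[ℝ] Y}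
    (hi : DenseRange i) {K : ℝ} (hK : 0 ≤ K)
    (h : ∀ p, ∃ y, Q y = S (i p) ∧ ‖y‖ ≤ K * ‖i p‖) :
    ∃ R : Y →L[ℝ] Z, (∀ x, Q (R x) = S x) ∧ ‖R‖ ≤ K := by
  choose g hg hgK using h
  let f : Y →ₗ[ℝ] Z :=
    { toFun := g
      map_add' := fun x y => hQ (by simp [hg])
      map_smul' := fun r x => hQ (by simp [hg]) }
  have hd : DenseRange (i : Y →ₗ[ℝ] Y) := hi
  refine ⟨f.extendOfNorm (i : Y →ₗ[ℝ] Y), ?_, LinearMap.opNorm_extendOfNorm_le hd hK hgK⟩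
  intro x
  refine hd.induction_on (p := fun x => Q (f.extendOfNorm (i : Y →ₗ[ℝ] Y) x) = S x) x
    (isClosed_eq (by fun_prop) (by fun_prop)) fun p => ?_
  rw [LinearMap.extendOfNorm_eq hd ⟨K, hgK⟩]
  exact hg p

namespace RankOnePerturbation

variable {U : ℝ → X →L[ℝ] X} {N : X →L[ℝ] X} {Q : Z →L[ℝ] X} {W : ℝ → X →L[ℝ] Z}
  {V : X →L[ℝ] Z} {c : Z →L[ℝ] ℝ} {b : X} {β a : ℝ} {S : ℝ → X →L[ℝ] X}
  (H : RankOnePerturbation U N Q W V c b β a S)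

include H

/-- The perturbed semigroup has the same smoothing property, with exponential decay. -/
theorem exists_smooth : ∃ (R : ℝ → X →L[ℝ] Z) (M ω : ℝ), 0 ≤ M ∧ 0 < ω ∧
    (∀ t, 0 < t → ∀ x, Q (R t x) = S t x) ∧
    ∀ t, 0 < t → ‖R t‖ ≤ M * ((t ^ (-a) + 1) * Real.exp (-ω * t)) := by
  obtain ⟨t₀, M, ht₀, ht₀1, hM0, hM⟩ := H.exists_bound_small
  obtain ⟨M', ω, hM'0, hω, hM', -⟩ := H.stable'.exists_bound
  let i : X →L[ℝ] X := N.comp (ContinuousLinearMap.id ℝ X -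
    ((1 - β) • (c.comp V)).smulRight b)
  have hi : ∀ p, i p = N (p - ((1 - β) * c (V p)) • b) := fun p => by simp [i]
  -- x ↦ x − (1−β) ℓ(x) b multiplies b by β, hence is invertible; the witness is its inverse applied
  -- to q.
  have hdense : DenseRange i := by
    refine (H.dense).mono ?_
    rintro _ ⟨q, rfl⟩
    refine ⟨q + ((1 - β) / β * c (V q)) • b, ?_⟩
    have hβ := H.β_pos.ne'
    rw [hi]
    congr 1
    simp only [map_add, map_smul, H.normalized, smul_eq_mul, mul_one]
    rw [add_sub_assoc, ← sub_smul]
    have : (1 - β) / β * c (V q) - (1 - β) * (c (V q) + (1 - β) / β * c (V q)) = 0 := by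
      field_simp; ring
    rw [this, zero_smul, add_zero]
  have h1 : ∀ t, 0 < t → t ≤ t₀ → ∃ R : X →L[ℝ] Z, (∀ x, Q (R x) = S t x) ∧
      ‖R‖ ≤ M * t ^ (-a) := fun t h0 h1 => by
    refine ContinuousLinearMap.exists_factor_of_denseRange H.injective (S t) hdense
      (by positivity) fun p => ?_
    obtain ⟨y, hy, hyM⟩ := hM t h0 h1 p
    exact ⟨y, by rw [hy, hi], by rw [hi]; exact hyM⟩
  obtain ⟨R₀, hR₀, -⟩ := h1 t₀ ht₀ le_rfl
  choose! R hR hRM using h1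
  -- Beyond t₀ the factor S(t − t₀) supplies the decay. The constants e^ω and e^{ω t₀} compensate
  -- e^{-ωt} for t ≤ t₀ ≤ 1 and the time shift, respectively.
  refine ⟨fun t => if t ≤ t₀ then R t else R₀.comp (S (t - t₀)),
    M * Real.exp ω + ‖R₀‖ * M' * Real.exp (ω * t₀), ω, by positivity, hω, ?_, ?_⟩
  · intro t ht x
    beta_reduce
    split_ifs with h
    · exact hR t ht h x
    · rw [ContinuousLinearMap.comp_apply, hR₀,
        ← H.semigroup'.map_add_apply ht₀.le (by linarith), add_sub_cancel]
  · intro t ht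
    have e0 : 0 < t ^ (-a) := by positivity
    beta_reduce
    split_ifs with h
    · have e1 : 1 ≤ Real.exp ω * Real.exp (-ω * t) := by
        rw [← Real.exp_add]
        refine Real.one_le_exp ?_
        nlinarith
      calc ‖R t‖ ≤ M * t ^ (-a) := hRM t ht h
        _ ≤ M * (t ^ (-a) + 1) * (Real.exp ω * Real.exp (-ω * t)) := by
            refine (le_mul_of_one_le_right (by positivity) e1).trans' ?_
            gcongr; linarith
        _ = M * Real.exp ω * ((t ^ (-a) + 1) * Real.exp (-ω * t)) := by ring
        _ ≤ _ := by gcongr; exact le_add_of_nonneg_right (by positivity)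
    · calc ‖R₀.comp (S (t - t₀))‖ ≤ ‖R₀‖ * ‖S (t - t₀)‖ := ContinuousLinearMap.opNorm_comp_le _ _
        _ ≤ ‖R₀‖ * (M' * Real.exp (-ω * (t - t₀))) := by gcongr; exact hM' _ (by linarith)
        _ = ‖R₀‖ * M' * Real.exp (ω * t₀) * (1 * Real.exp (-ω * t)) := by
            rw [show -ω * (t - t₀) = ω * t₀ + -ω * t by ring, Real.exp_add]; ring
        _ ≤ ‖R₀‖ * M' * Real.exp (ω * t₀) * ((t ^ (-a) + 1) * Real.exp (-ω * t)) := by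
            gcongr; linarith
        _ ≤ _ := by gcongr; exact le_add_of_nonneg_left (by positivity)

/-- Since C A_β⁻¹ = −β ℓ, differentiating β ℓ(S(t)x) yields −C S(t)x. The limit is taken under the
bounded operator c R(t), so the unbounded C causes no trouble. This is what permits integration by
parts. -/
theorem hasDerivWithinAt {R : ℝ → X →L[ℝ] Z} (hR : ∀ t, 0 < t → ∀ x, Q (R t x) = S t x) {t : ℝ}
    (ht : 0 < t) (x : X) :
    HasDerivWithinAt (fun t => β * c (V (S t x))) (-(c (R t x))) (Ioi t) t := by
  rw [hasDerivWithinAt_iff_tendsto_slope' self_notMem_Ioi]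
  set x' := N (x - ((1 - β) * c (V x)) • b) with hx'
  have e1 : ∀ h, 0 ≤ h → β * c (V (S (t + h) x)) = c (R t (S h x')) := by
    intro h hh
    have e : Q (R t (S h x')) = Q (V (S (t + h) x - ((1 - β) * c (V (S (t + h) x))) • b)) := by
      rw [hR t ht, ← H.semigroup'.map_add_apply ht.le hh, hx', H.comm' _ (by linarith), H.factor]
    rw [H.injective e, map_sub, map_sub, map_smul, map_smul, H.normalized, smul_eq_mul]
    ring
  have e2 : Tendsto (fun s : ℝ => s - t) (𝓝[>] t) (𝓝[>] 0) := by
    refine tendsto_nhdsWithin_iff.2 ⟨?_, ?_⟩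
    · have : Continuous fun s : ℝ => s - t := by fun_prop
      exact (this.tendsto' t 0 (sub_self t)).mono_left nhdsWithin_le_nhds
    · filter_upwards [self_mem_nhdsWithin] with s hs
      exact sub_pos.2 (mem_Ioi.1 hs)
  have e3 := (((c.comp (R t)).continuous.tendsto _).comp ((H.tendsto' x).comp e2))
  rw [ContinuousLinearMap.comp_apply, map_neg, map_neg, ← hx'] at e3
  refine e3.congr' ?_
  filter_upwards [self_mem_nhdsWithin] with s hs
  have hs : t < s := hs
  have e4 := e1 (s - t) (sub_nonneg.2 hs.le)
  have e5 := e1 0 le_rfl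
  rw [add_sub_cancel] at e4
  rw [add_zero, H.semigroup'.map_zero_apply] at e5
  rw [slope_def_module, e4, e5]
  simp only [Function.comp_apply, ContinuousLinearMap.comp_apply, map_smul, map_sub]

end RankOnePerturbation

/-! ### Partially defined operators with a bounded inverse -/

namespace LinearPMap

variable {E F : Type*} [AddCommGroup E] [Module ℝ E] [AddCommGroup F] [Module ℝ F]

theorem total_eq_of_mem_graph {A : E →ₗ.[ℝ] F} {x : E} {y : F} (h : (x, y) ∈ A.graph) :
    A.total x = y := by
  obtain ⟨z, hz, hy⟩ := (A.mem_graph_iff).1 h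
  simp only at hz hy
  subst hz
  rw [LinearPMap.total, dif_pos z.2]
  exact hy

theorem inverse_total_eq {A : E →ₗ.[ℝ] F} {N : F →ₗ[ℝ] E}
    (h : ∀ x y, (x, y) ∈ A.graph ↔ x = -N y) (y : F) : A.inverse.total y = -N y := by
  refine total_eq_of_mem_graph ?_
  have hk : LinearMap.ker A.toFun = ⊥ := by
    rw [LinearMap.ker_eq_bot']
    intro x hx
    have h1 := A.mem_graph x
    have h2 : A x = 0 := hx
    rw [h2, h, _root_.map_zero, neg_zero] at h1
    exact Subtype.ext h1
  rw [inverse_graph hk]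
  exact ⟨(-N y, y), (h _ _).2 rfl, rfl⟩

end LinearPMap

end

noncomputable section

/-! ### The regulated system in terms of bounded operators -/

variable {Z X : Type*} [NormedAddCommGroup Z] [InnerProductSpace ℝ Z] [CompleteSpace Z]
  [NormedAddCommGroup X] [NormedSpace ℝ X] [CompleteSpace X]

namespace RegulatedSystem

/-- Bounded operators that describe the regulated system: `e^{A_β t} = Q R(t)` for `t > 0`, where
`Q` maps into `Z^{s₁}` and `C Q = c`, and `ℓ = -C A⁻¹`. -/
structure Realization (P : RegulatedSystem Z X) where
  ℓ : X →L[ℝ] ℝ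
  c : Z →L[ℝ] ℝ
  Q : Z →L[ℝ] X
  E : Z →L[ℝ] Z
  R : ℝ → X →L[ℝ] Z
  a : ℝ
  M : ℝ
  ω : ℝ
  a_pos : 0 < a
  a_lt_one : a < 1
  M_nonneg : 0 ≤ M
  ω_pos : 0 < ω
  ι_injective : Function.Injective P.ι
  negPow_injective : Function.Injective (negPow P.T P.s₁)
  Q_injective : Function.Injective Q
  Q_eq : ∀ y, P.ι (negPow P.T P.s₁ (E y)) = Q y
  Cx_Q : ∀ y, P.Cx (Q y) = c y
  R_eq : ∀ t, 0 < t → ∀ x, Q (R t x) = P.S t x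
  R_bound : ∀ t, 0 < t → ‖R t‖ ≤ M * ((t ^ (-a) + 1) * Real.exp (-ω * t))
  I₀_eq : ∀ x, P.I₀ x = x - ℓ x • P.b
  ℓ_b : ℓ P.b = 1
  K_eq : ∀ t, P.K t = ℓ (P.S t P.b)
  Kd_eq : ∀ t, P.Kd t = P.β * ℓ (P.S t (P.I₀ P.bd))
  deriv : ∀ t, 0 < t → ∀ x,
    HasDerivWithinAt (fun t => P.β * ℓ (P.S t x)) (-(c (R t x))) (Ioi t) t

theorem posNorm_apply {T : ℝ → Z →L[ℝ] Z} {ι : Z →L[ℝ] X} {s : ℝ}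
    (h : Function.Injective fun y => ι (negPow T s y)) (y : Z) :
    posNorm T ι s (ι (negPow T s y)) = ‖y‖ₑ := by
  refine le_antisymm (iInf₂_le (f := fun y' (_ : ι (negPow T s y') = ι (negPow T s y)) => ‖y'‖ₑ)
    y rfl) (le_iInf₂ fun y' hy' => ?_)
  rw [h hy']

theorem _root_.IsGenerator.map_mem_graph {E : Type*} [NormedAddCommGroup E] [NormedSpace ℝ E]
    {A : E →ₗ.[ℝ] E} {S : ℝ → E →L[ℝ] E} (hA : IsGenerator A S) (hS : IsC0Semigroup S) {t : ℝ}
    (ht : 0 ≤ t) {x y : E} (h : (x, y) ∈ A.graph) : (S t x, S t y) ∈ A.graph := by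
  rw [hA] at h ⊢
  refine (((S t).continuous.tendsto y).comp h).congr' ?_
  filter_upwards [self_mem_nhdsWithin] with h hh
  rw [Function.comp_apply, map_smul, map_sub, hS.comm_apply ht (le_of_lt hh)]

namespace Standing

variable {P : RegulatedSystem Z X} (hP : P.Standing)

include hP

theorem σ_lt_one : P.σ < 1 := by linarith [hP.s₁_add_σ, hP.s₁_pos]

theorem ι_injective : Function.Injective P.ι := by
  rw [injective_iff_map_eq_zero]
  intro φ h
  have h1 := hP.negSpace.norm_eq φ
  rw [h, norm_zero] at h1
  exact (injective_iff_map_eq_zero _).1 (negPow_injective hP.semigroup hP.stable hP.analytic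
    hP.σ_nonneg hP.σ_lt_one.le) φ (norm_eq_zero.1 h1.symm)

/-- ι and (−A)^{-σ} have dense ranges and equal norms, so X is a copy of Z. Conjugation by J then
carries operators on Z over to X. -/
theorem exists_equiv : ∃ J : X ≃L[ℝ] Z, ∀ φ, J (P.ι φ) = negPow P.T P.σ φ := by
  have h1 : DenseRange (P.ι : Z →ₗ[ℝ] X) := hP.negSpace.dense
  have h2 : DenseRange (negPow P.T P.σ : Z →ₗ[ℝ] Z) :=
    negPow_denseRange hP.semigroup hP.stable hP.analytic hP.σ_nonneg hP.σ_lt_one.le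
  refine ⟨(LinearEquiv.refl ℝ Z).extend (P.ι : Z →ₗ[ℝ] X) (negPow P.T P.σ : Z →ₗ[ℝ] Z) h1
    ⟨1, fun φ => ?_⟩ h2 ⟨1, fun φ => ?_⟩, fun φ => ?_⟩
  · simp [hP.negSpace.norm_eq]
  · simp [hP.negSpace.norm_eq]
  · exact LinearEquiv.extend_eq _ _ _ h1 _ h2 _ φ

/-- The right side is closed and contains the image of the graph of A. Conversely, its points depend
continuously on p, and p is a limit of vectors from Z. -/
theorem mem_graph_AX {J : X ≃L[ℝ] Z} (hJ : ∀ φ, J (P.ι φ) = negPow P.T P.σ φ) (x p : X) :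
    (x, p) ∈ P.AX.graph ↔ x = -J.symm (negPow P.T 1 (J p)) := by
  have hinj := negPow_one_injective hP.semigroup hP.stable hP.analytic
  set G := (P.A.graph.map ((P.ι.prodMap P.ι) : Z × Z →ₗ[ℝ] X × X)).topologicalClosure with hG
  have hmem : ∀ q : X × X, q ∈ G ↔ q.1 = -J.symm (negPow P.T 1 (J q.2)) := by
    have hclosed : IsClosed {q : X × X | q.1 = -J.symm (negPow P.T 1 (J q.2))} :=
      isClosed_eq (by fun_prop) (by fun_prop)
    have hι : ∀ y, P.ι (negPow P.T 1 y) = J.symm (negPow P.T 1 (J (P.ι y))) := by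
      intro y
      rw [ContinuousLinearEquiv.eq_symm_apply, hJ, hJ, negPow_comp_apply hP.semigroup hP.stable
        hP.analytic hP.σ_nonneg zero_le_one, negPow_comp_apply hP.semigroup hP.stable
        hP.analytic zero_le_one hP.σ_nonneg, add_comm]
    intro q
    constructor
    · intro hq
      refine closure_minimal ?_ hclosed hq
      rintro _ ⟨⟨x, y⟩, hxy, rfl⟩
      have hxy : (x, y) ∈ P.A.graph := hxy
      rw [hP.generator.mem_graph_iff hP.semigroup hP.stable hP.analytic] at hxy
      change P.ι x = -J.symm (negPow P.T 1 (J (P.ι y)))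
      rw [hxy, map_neg, hι]
    · intro hq
      let g : X → X × X := fun p => (-J.symm (negPow P.T 1 (J p)), p)
      have hg : Continuous g := by fun_prop
      have hq' : q = g q.2 := Prod.ext hq rfl
      have h1 : g q.2 ∈ closure (g '' range P.ι) :=
        image_closure_subset_closure_image hg ⟨q.2, hP.negSpace.dense q.2, rfl⟩
      rw [hq']
      refine closure_mono ?_ h1
      rintro _ ⟨_, ⟨y, rfl⟩, rfl⟩
      refine ⟨(-negPow P.T 1 y, y), ?_, ?_⟩
      · exact (hP.generator.mem_graph_iff hP.semigroup hP.stable hP.analytic _ _).2 rfl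
      · change (P.ι (-negPow P.T 1 y), P.ι y) = _
        rw [map_neg, hι]
  -- The closure is single valued because (−A)⁻¹ is injective, so `toLinearPMap` loses nothing.
  have hgr : P.AX.graph = G := by
    refine Submodule.toLinearPMap_graph_eq _ fun q hq hq1 => ?_
    have h1 := (hmem q).1 hq
    rw [hq1, eq_comm, neg_eq_zero] at h1
    have h2 : negPow P.T 1 (J q.2) = 0 := by simpa using h1
    have h3 := (injective_iff_map_eq_zero _).1 hinj _ h2
    simpa using h3
  rw [hgr, hmem]

/-- Boundedness of C on Z^{s_c} amounts to boundedness of C (−A)^{-s_c} on Z. -/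
theorem exists_output : ∃ c : Z →L[ℝ] ℝ, ∀ y, P.ι (negPow P.T P.sc y) ∈ posSpace P.T P.ι P.sc ∧
    P.Cx (P.ι (negPow P.T P.sc y)) = c y := by
  obtain ⟨k, hk⟩ := hP.C_bounded
  have hinj : Function.Injective fun y => P.ι (negPow P.T P.sc y) :=
    hP.ι_injective.comp (negPow_injective hP.semigroup hP.stable hP.analytic hP.sc_nonneg
      (by linarith [hP.sc_add_σ, hP.σ_nonneg]))
  let e : Z →ₗ[ℝ] posSpace P.T P.ι P.sc :=
    LinearMap.rangeRestrict ((P.ι.comp (negPow P.T P.sc)) : Z →ₗ[ℝ] X)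
  refine ⟨LinearMap.mkContinuous (P.C ∘ₗ e) k fun y => ?_, fun y => ⟨⟨y, rfl⟩, ?_⟩⟩
  · have h1 := hk (e y)
    have h2 : P.snorm P.sc (e y) = ‖y‖ₑ := posNorm_apply hinj y
    rw [h2] at h1
    have h3 : ‖P.C (e y)‖₊ ≤ k * ‖y‖₊ := by
      rw [← ENNReal.coe_le_coe, ENNReal.coe_mul]; exact h1
    exact_mod_cast h3
  · rw [Cx, LinearPMap.total, dif_pos (show P.ι (negPow P.T P.sc y) ∈ posSpace P.T P.ι P.sc from ⟨y, rfl⟩)]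
    rfl

theorem nonempty_realization : Nonempty P.Realization := by
  obtain ⟨J, hJ⟩ := hP.exists_equiv
  obtain ⟨c₀, hc₀⟩ := hP.exists_output
  have hsem := hP.semigroup
  have hst := hP.stable
  have han := hP.analytic
  have h_sc := hP.sc_nonneg
  have hσ := hP.σ_nonneg
  have hs₁ := hP.s₁_pos
  have hsum₁ := hP.s₁_add_σ
  have hsum₂ := hP.sc_add_σ
  have hβ := hP.β_pos
  -- The order of smoothing needed to get from Z^{-σ} into both Z^{s₁} and Z^{s_c}; the range of Q
  -- below is contained in both.
  set a := max (P.s₁ + P.σ) (P.sc + P.σ) with ha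
  have ha₁ : P.s₁ + P.σ ≤ a := le_max_left _ _
  have ha₂ : P.sc + P.σ ≤ a := le_max_right _ _
  have ha0 : 0 < a := by linarith
  have ha1 : a < 1 := max_lt hsum₁ hsum₂
  obtain ⟨W, M, hM, hW, hWM⟩ := exists_smoothing hsem hst han ha0 ha1
  have hneg : ∀ {s t : ℝ}, 0 ≤ s → 0 ≤ t → ∀ y,
      negPow P.T s (negPow P.T t y) = negPow P.T (s + t) y := fun h1 h2 y =>
    negPow_comp_apply hsem hst han h1 h2 y
  let U : ℝ → X →L[ℝ] X := fun t => (J.symm : Z →L[ℝ] X).comp ((P.T t).comp (J : X →L[ℝ] Z))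
  let N : X →L[ℝ] X := (J.symm : Z →L[ℝ] X).comp ((negPow P.T 1).comp (J : X →L[ℝ] Z))
  let Q : Z →L[ℝ] X := (J.symm : Z →L[ℝ] X).comp (negPow P.T a)
  let V : X →L[ℝ] Z := (negPow P.T (1 - a)).comp (J : X →L[ℝ] Z)
  let c : Z →L[ℝ] ℝ := c₀.comp (negPow P.T (a - (P.sc + P.σ)))
  let ℓ : X →L[ℝ] ℝ := c.comp V
  have hUx : ∀ t x, U t x = J.symm (P.T t (J x)) := fun t x => rfl
  have hNx : ∀ x, N x = J.symm (negPow P.T 1 (J x)) := fun x => rfl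
  have hQx : ∀ y, Q y = J.symm (negPow P.T a y) := fun y => rfl
  have hVx : ∀ x, V x = negPow P.T (1 - a) (J x) := fun x => rfl
  have hℓx : ∀ x, ℓ x = c (V x) := fun x => rfl
  have hQV : ∀ x, Q (V x) = N x := fun x => by
    rw [hQx, hVx, hNx, hneg ha0.le (by linarith)]
    congr 3; ring
  -- elements of the spaces `Z^s`
  have hιs : ∀ s, 0 ≤ s → s + P.σ ≤ a → ∀ y,
      P.ι (negPow P.T s (negPow P.T (a - (s + P.σ)) y)) = Q y := fun s h0 h1 y => by
    rw [hQx, ContinuousLinearEquiv.eq_symm_apply, hJ, hneg h0 (by linarith), hneg hσ (by linarith)]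
    congr 2; ring
  have hmem : ∀ y, Q y ∈ posSpace P.T P.ι P.sc := fun y => by
    rw [← hιs _ h_sc ha₂]
    exact (hc₀ _).1
  have hCQ : ∀ y, P.Cx (Q y) = c y := fun y => by
    rw [← hιs _ h_sc ha₂, (hc₀ _).2]; rfl
  have hCneg : ∀ y, P.Cx (-Q y) = -c y := fun y => by rw [← map_neg, hCQ, map_neg]
  have hCN : ∀ x, P.Cx (-N x) = -ℓ x := fun x => by rw [← hQV]; exact hCneg _
  -- the operator `A` on `X`
  have hAX : ∀ x p, (x, p) ∈ P.AX.graph ↔ x = -(N : X →ₗ[ℝ] X) p := hP.mem_graph_AX hJ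
  have hAInv : ∀ p, P.AInv p = -N p := fun p => LinearPMap.inverse_total_eq hAX p
  have hG : P.G = ℓ P.bIn := by rw [G, hAInv, hCN, neg_neg]
  have hb : ℓ P.b = 1 := by
    rw [b, map_smul, ← hG, smul_eq_mul, inv_mul_cancel₀ hP.G_ne_zero]
  have hI₀ : ∀ x, P.I₀ x = x - ℓ x • P.b := fun x => by
    rw [I₀, hAInv, hCN, neg_smul, sub_eq_add_neg]
  -- the operator `A_β`
  let Nβ : X →ₗ[ℝ] X := (N.comp (ContinuousLinearMap.id ℝ X -
    ((1 - P.β) • ℓ).smulRight P.b) : X →L[ℝ] X)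
  have hNβ : ∀ p, Nβ p = N (p - ((1 - P.β) * c (V p)) • P.b) := fun p => rfl
  have hNQ : ∀ p, N p = Q (V p) := fun p => (hQV p).symm
  have hCx : ∀ q (h : -N q ∈ posSpace P.T P.ι P.sc), P.C ⟨-N q, h⟩ = -ℓ q := fun q h => by
    have h1 := hCN q
    rwa [Cx, LinearPMap.total, dif_pos h] at h1
  -- With y = −N q one has A_β y = q + ((1−β)/β) ℓ(q) b = p. Applying ℓ gives ℓ(p) = ℓ(q)/β, whence
  -- q = p − (1−β) ℓ(p) b.
  have hAβ : ∀ x p, (x, p) ∈ P.Aβ.graph ↔ x = -Nβ p := by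
    intro x p
    rw [hNβ, LinearPMap.mem_graph_iff]
    constructor
    · rintro ⟨⟨y, hy⟩, rfl, hp⟩
      have hyA : y ∈ P.AX.domain := hy.1
      have hyC : y ∈ posSpace P.T P.ι P.sc := hy.2
      have h1 := P.AX.mem_graph ⟨y, hyA⟩
      obtain ⟨q, hq⟩ : ∃ q, P.AX ⟨y, hyA⟩ = q := ⟨_, rfl⟩
      rw [hq] at h1
      have h2 : y = -N q := (hAX _ _).1 h1
      subst h2
      have h3 : p = q - ((1 - P.β) / P.β) • (P.C ⟨-N q, hyC⟩ • P.b) := by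
        refine (show p = P.AX ⟨-N q, hyA⟩ - ((1 - P.β) / P.β) • (P.C ⟨-N q, hyC⟩ • P.b) from
          hp.symm).trans ?_
        rw [hq]
      rw [hCx] at h3
      have h4 : c (V p) = ℓ q / P.β := by
        rw [← hℓx, h3, map_sub, map_smul, map_smul, hb, smul_eq_mul, smul_eq_mul]
        field_simp; ring
      rw [h4, h3]
      simp only
      congr 2
      rw [sub_sub, smul_smul, ← add_smul]
      have : (1 - P.β) / P.β * -ℓ q + (1 - P.β) * (ℓ q / P.β) = 0 := by field_simp; ring
      rw [this, zero_smul, sub_zero]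
    · rintro rfl
      set q := p - ((1 - P.β) * c (V p)) • P.b with hq
      have h1 : (-N q, q) ∈ P.AX.graph := (hAX _ _).2 rfl
      obtain ⟨⟨y, hyA⟩, hy, hyq⟩ := P.AX.mem_graph_iff.1 h1
      simp only at hy hyq
      subst hy
      have hyC : -N q ∈ posSpace P.T P.ι P.sc := by
        rw [hNQ, ← map_neg]; exact hmem _
      refine ⟨⟨-N q, hyA, hyC⟩, rfl, ?_⟩
      change P.AX ⟨-N q, hyA⟩ - ((1 - P.β) / P.β) • (P.C ⟨-N q, hyC⟩ • P.b) = p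
      have h5 : ℓ q = P.β * c (V p) := by
        rw [hq, map_sub, map_smul, hb, smul_eq_mul, hℓx]; ring
      rw [hyq, hCx, h5, hq, sub_sub, smul_smul, ← add_smul]
      have : (1 - P.β) * c (V p) + (1 - P.β) / P.β * -(P.β * c (V p)) = 0 := by field_simp; ring
      rw [this, zero_smul, sub_zero]
  have hAβInv : ∀ p, P.Cx (P.AβInv p) = -(P.β * ℓ p) := fun p => by
    rw [AβInv, LinearPMap.inverse_total_eq hAβ p, hNβ, hCN, map_sub, map_smul, hb,
      smul_eq_mul, hℓx]
    ring
  -- the perturbation result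
  obtain ⟨Mt, -, hMt0, -, -, hMt⟩ := hst.exists_bound
  have hJs : ∀ z, J (J.symm z) = z := fun z => J.apply_symm_apply z
  have hQinj : Function.Injective Q :=
    J.symm.injective.comp (negPow_injective hsem hst han ha0.le ha1.le)
  have H : RankOnePerturbation U N Q (fun t => (W t).comp (J : X →L[ℝ] Z)) V c P.b P.β a P.S :=
    { semigroup :=
        { map_zero := by
            ext x
            rw [hUx, hsem.map_zero_apply, J.symm_apply_apply]; rfl
          map_add := fun s t h0 h1 => by
            ext x
            change J.symm (P.T (s + t) (J x)) = J.symm (P.T s (J (J.symm (P.T t (J x)))))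
            rw [hJs, hsem.map_add_apply h0 h1]
          tendsto_zero := fun x => by
            have := (J.symm.continuous.tendsto _).comp (hsem.tendsto_zero (J x))
            rw [J.symm_apply_apply] at this
            exact this }
      bounded := by
        refine ⟨‖(J.symm : Z →L[ℝ] X)‖ * (Mt * ‖(J : X →L[ℝ] Z)‖), fun t ht => ?_⟩
        refine (ContinuousLinearMap.opNorm_comp_le _ _).trans ?_
        gcongr
        refine (ContinuousLinearMap.opNorm_comp_le _ _).trans ?_
        gcongr
        exact hMt t ht
      tendsto := fun x => by
        have h1 := (J.symm.continuous.tendsto _).comp (tendsto_negPow_one hsem hst han (J x))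
        rw [map_neg, J.symm_apply_apply] at h1
        refine h1.congr fun h => ?_
        rw [Function.comp_apply, map_smul, map_sub, hUx, hNx, hJs]
      injective := hQinj
      smooth := fun t ht x => by
        change J.symm (negPow P.T a (W t (J x))) = J.symm (P.T t (J x))
        rw [hW t ht]
      smooth_bound := by
        refine ⟨M * ‖(J : X →L[ℝ] Z)‖, by positivity, fun t ht => ?_⟩
        refine (ContinuousLinearMap.opNorm_comp_le _ _).trans ?_
        rw [mul_right_comm]
        gcongr
        exact hWM t ht
      factor := hQV
      dense := by
        refine DenseRange.comp (g := J.symm) (f := negPow P.T 1 ∘ J) J.symm.surjective.denseRange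
          (DenseRange.comp (negPow_denseRange hsem hst han zero_le_one le_rfl)
            J.surjective.denseRange (negPow P.T 1).continuous) J.symm.continuous
      normalized := hb
      β_pos := hβ
      a_pos := ha0
      a_lt_one := ha1
      semigroup' := hP.semigroup_β
      stable' := hP.stable_β
      tendsto' := fun x => by
        have h1 := ((hP.generator_β _ _).1 ((hAβ _ x).2 rfl)).neg
        refine h1.congr fun h => ?_
        rw [← smul_neg, map_neg, hNβ]
        congr 1; abel
      comm' := fun t ht x => by
        have h1 := hP.generator_β.map_mem_graph hP.semigroup_β ht
          ((hAβ _ x).2 rfl)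
        rw [hAβ, map_neg] at h1
        exact neg_injective h1 }
  obtain ⟨R, M', ω, hM', hω, hR, hRM⟩ := H.exists_smooth
  exact ⟨{
    ℓ := ℓ
    c := c
    Q := Q
    E := negPow P.T (a - (P.s₁ + P.σ))
    R := R
    a := a
    M := M'
    ω := ω
    a_pos := ha0
    a_lt_one := ha1
    M_nonneg := hM'
    ω_pos := hω
    ι_injective := hP.ι_injective
    negPow_injective := negPow_injective hsem hst han hs₁.le (by linarith)
    Q_injective := hQinj
    Q_eq := hιs _ hs₁.le ha₁
    Cx_Q := hCQ
    R_eq := hR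
    R_bound := hRM
    I₀_eq := hI₀
    ℓ_b := hb
    K_eq := fun t => by
      rw [K, hAβInv]
      field_simp
    Kd_eq := fun t => by rw [Kd, hAβInv, neg_neg]
    deriv := fun t ht x => H.hasDerivWithinAt hR ht x }⟩

end Standing

end RegulatedSystem

end

noncomputable section

/-! ### Limits superior in `[0, ∞]` -/

namespace ENNReal

theorem limsup_le_iff_forall_pos {u : ℝ → ℝ≥0∞} {L : ℝ≥0∞} :
    limsup u atTop ≤ L ↔ ∀ δ : ℝ≥0, 0 < δ → ∀ᶠ t in atTop, u t ≤ L + δ := by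
  constructor
  · intro h δ hδ
    rcases eq_or_ne L ⊤ with rfl | hL
    · simp
    have h1 : limsup u atTop < L + δ :=
      h.trans_lt (ENNReal.lt_add_right hL (by exact_mod_cast hδ.ne'))
    exact (eventually_lt_of_limsup_lt h1).mono fun t ht => ht.le
  · intro h
    refine ENNReal.le_of_forall_pos_le_add fun δ hδ _ => ?_
    exact limsup_le_of_le (h := h δ hδ)

theorem limsup_add_le_of_le {u v : ℝ → ℝ≥0∞} {U V : ℝ≥0∞} (hu : limsup u atTop ≤ U)
    (hv : limsup v atTop ≤ V) : limsup (fun t => u t + v t) atTop ≤ U + V := by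
  rw [limsup_le_iff_forall_pos] at hu hv ⊢
  intro δ hδ
  filter_upwards [hu (δ / 2) (half_pos hδ), hv (δ / 2) (half_pos hδ)] with t h1 h2
  refine (add_le_add h1 h2).trans (le_of_eq ?_)
  rw [add_add_add_comm, ← ENNReal.coe_add, add_halves]

theorem limsup_mono {u v : ℝ → ℝ≥0∞} {V : ℝ≥0∞} (h : ∀ᶠ t in atTop, u t ≤ v t)
    (hv : limsup v atTop ≤ V) : limsup u atTop ≤ V :=
  (limsup_le_limsup h).trans hv

theorem limsup_const_mul_le {u : ℝ → ℝ≥0∞} {U c : ℝ≥0∞} (hc : c ≠ ⊤)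
    (hu : limsup u atTop ≤ U) : limsup (fun t => c * u t) atTop ≤ c * U := by
  rw [limsup_le_iff_forall_pos] at hu ⊢
  intro δ hδ
  lift c to ℝ≥0 using hc
  -- The added 1 covers c = 0.
  have h1 : 0 < δ / (c + 1) := by positivity
  filter_upwards [hu _ h1] with t ht
  refine (mul_le_mul_right ht _).trans ?_
  rw [mul_add]
  gcongr
  rw [← ENNReal.coe_mul, ENNReal.coe_le_coe, mul_div_assoc']
  rw [div_le_iff₀ (by positivity), mul_comm]
  gcongr
  exact le_self_add

theorem limsup_eq_zero_of_tendsto {u : ℝ → ℝ≥0∞} (h : Tendsto u atTop (𝓝 0)) :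
    limsup u atTop ≤ 0 := h.limsup_eq.le

end ENNReal

theorem tendsto_setLIntegral_Ioi {m : ℝ → ℝ} (hm : IntegrableOn m (Ioi 0)) :
    Tendsto (fun x : ℝ => ∫⁻ s in Ioi x, ENNReal.ofReal (m s)) atTop (𝓝 0) := by
  have h1 : AEMeasurable (fun s => ENNReal.ofReal (m s)) (volume.restrict (Ioi 0)) :=
    hm.aestronglyMeasurable.aemeasurable.ennreal_ofReal
  have h2 : Tendsto (fun x : ℝ => ∫⁻ s in Ioi (0 : ℝ), (Ioi x).indicator
      (fun s => ENNReal.ofReal (m s)) s) atTop (𝓝 (∫⁻ _ in Ioi (0 : ℝ), 0)) := by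
    refine tendsto_lintegral_filter_of_dominated_convergence'
      (fun s => ENNReal.ofReal (m s)) ?_ ?_ ?_ ?_
    · exact Eventually.of_forall fun x => h1.indicator measurableSet_Ioi
    · exact Eventually.of_forall fun x => ae_of_all _ fun s => indicator_le_self _ _ s
    · refine ne_of_lt ((lintegral_mono fun s => ?_).trans_lt hm.2)
      rw [← ofReal_norm]
      exact ENNReal.ofReal_le_ofReal (le_abs_self _)
    · refine ae_of_all _ fun s => tendsto_const_nhds.congr' ?_
      filter_upwards [eventually_ge_atTop s] with x hx
      rw [indicator_of_notMem (notMem_Ioi.2 hx)]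
  rw [lintegral_zero] at h2
  refine h2.congr' ?_
  filter_upwards [eventually_ge_atTop 0] with x hx
  rw [lintegral_indicator measurableSet_Ioi, Measure.restrict_restrict measurableSet_Ioi,
    inter_eq_left.2 (Ioi_subset_Ioi hx)]

/-- The limit superior of a convolution with an integrable kernel. -/
theorem limsup_convolution_le {k φ : ℝ → ℝ≥0∞} {m : ℝ → ℝ} (hm : IntegrableOn m (Ioi 0))
    (hk : ∀ s, 0 < s → k s ≤ ENNReal.ofReal (m s)) {t₀ : ℝ} {B : ℝ≥0∞} (hB : B ≠ ⊤)
    (hφ : ∀ τ, t₀ ≤ τ → φ τ ≤ B) :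
    limsup (fun t => ∫⁻ s in Ioc 0 (t - t₀), k s * φ (t - s)) atTop ≤
      (∫⁻ s in Ioi 0, k s) * limsup φ atTop := by
  set I := ∫⁻ s in Ioi 0, k s with hI
  set ℓ := limsup φ atTop with hℓ
  have hIm : I ≠ ⊤ := by
    refine ne_of_lt ((setLIntegral_mono' measurableSet_Ioi fun s hs => hk s hs).trans_lt ?_)
    refine (lintegral_mono fun s => ?_).trans_lt hm.2
    rw [← ofReal_norm]
    exact ENNReal.ofReal_le_ofReal (le_abs_self _)
  have hℓB : ℓ ≤ B := limsup_le_of_le (h := (eventually_ge_atTop t₀).mono hφ)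
  have hℓt : ℓ < ⊤ := hℓB.trans_lt hB.lt_top
  -- Past T₁ the signal is below L. Delays s ≤ t − T₁ contribute at most I L; the others at most B
  -- times a tail integral of m, which vanishes. Only monotonicity, subadditivity in the domain and
  -- finite constant factors are used, so k and φ need not be measurable.
  have key : ∀ L, ℓ < L → L ≠ ⊤ → limsup (fun t => ∫⁻ s in Ioc 0 (t - t₀), k s * φ (t - s)) atTop
      ≤ I * L := by
    intro L hL hLt
    obtain ⟨T₁, hT₁⟩ := eventually_atTop.1 (eventually_lt_of_limsup_lt hL)
    have htail : limsup (fun t => B * ∫⁻ s in Ioi (t - T₁), ENNReal.ofReal (m s)) atTop ≤ 0 := by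
      refine ENNReal.limsup_eq_zero_of_tendsto ?_
      have h1 := (tendsto_setLIntegral_Ioi hm).comp (tendsto_atTop_add_const_right atTop (-T₁)
        tendsto_id)
      have h2 := ENNReal.Tendsto.const_mul h1 (Or.inr hB)
      rw [mul_zero] at h2
      exact h2
    have hconst : limsup (fun _ : ℝ => I * L) atTop ≤ I * L := by simp
    have := ENNReal.limsup_add_le_of_le hconst htail
    rw [add_zero] at this
    refine ENNReal.limsup_mono ?_ this
    filter_upwards [eventually_ge_atTop T₁] with t ht
    have hsub : Ioc 0 (t - t₀) ⊆ Ioc 0 (t - T₁) ∪ (Ioi (t - T₁) ∩ Ioc 0 (t - t₀)) := by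
      intro s hs
      rcases le_or_gt s (t - T₁) with h | h
      · exact Or.inl ⟨hs.1, h⟩
      · exact Or.inr ⟨h, hs⟩
    refine (lintegral_mono_set hsub).trans ((lintegral_union_le _ _ _).trans ?_)
    gcongr ?_ + ?_
    · calc ∫⁻ s in Ioc 0 (t - T₁), k s * φ (t - s) ≤ ∫⁻ s in Ioc 0 (t - T₁), k s * L := by
            refine setLIntegral_mono' measurableSet_Ioc fun s hs => ?_
            gcongr
            exact (hT₁ _ (by linarith [hs.2])).le
        _ = (∫⁻ s in Ioc 0 (t - T₁), k s) * L := lintegral_mul_const' _ _ hLt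
        _ ≤ _ := by
            gcongr
            exact lintegral_mono_set Ioc_subset_Ioi_self
    · calc ∫⁻ s in Ioi (t - T₁) ∩ Ioc 0 (t - t₀), k s * φ (t - s)
          ≤ ∫⁻ s in Ioi (t - T₁) ∩ Ioc 0 (t - t₀), B * ENNReal.ofReal (m s) := by
            refine setLIntegral_mono' (measurableSet_Ioi.inter measurableSet_Ioc) fun s hs => ?_
            rw [mul_comm]
            gcongr
            · exact hφ _ (by linarith [hs.2.2])
            · exact hk s hs.2.1
        _ = B * ∫⁻ s in Ioi (t - T₁) ∩ Ioc 0 (t - t₀), ENNReal.ofReal (m s) :=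
            lintegral_const_mul' _ _ hB
        _ ≤ _ := by
            gcongr
            exact inter_subset_left
  have hne : (𝓝[>] ℓ).NeBot := nhdsGT_neBot_of_exists_gt ⟨⊤, hℓt⟩
  have htend : Tendsto (fun L => I * L) (𝓝[>] ℓ) (𝓝 (I * ℓ)) :=
    (ENNReal.Tendsto.const_mul tendsto_id (Or.inr hIm)).mono_left nhdsWithin_le_nhds
  refine ge_of_tendsto htend ?_
  filter_upwards [self_mem_nhdsWithin, mem_nhdsWithin_of_mem_nhds (Iio_mem_nhds hℓt)] with L h1 h2
  exact key L h1 (ne_of_lt h2)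

/-- Reverse Fatou lemma along `t → ∞`. -/
theorem limsup_setLIntegral_le {φ : ℝ → ℝ → ℝ≥0∞} {B : ℝ≥0∞} (hB : B ≠ ⊤) {T h : ℝ} {L : ℝ≥0∞}
    (hm : ∀ t, Measurable (φ t)) (hφ : ∀ t, T ≤ t → ∀ s, 0 < s → φ t s ≤ B)
    (hL : ∀ s ∈ Ioc 0 h, limsup (fun t => φ t s) atTop ≤ L) :
    limsup (fun t => ∫⁻ s in Ioc 0 h, φ t s) atTop ≤ L * ENNReal.ofReal h := by
  refine le_of_forall_lt_imp_le_of_dense fun c hc => ?_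
  -- The Fatou lemma is about sequences: pick times tending to infinity along which the integral
  -- exceeds c.
  have hfreq : ∃ᶠ t in atTop, T ≤ t ∧ c < ∫⁻ s in Ioc 0 h, φ t s :=
    ((frequently_lt_of_lt_limsup (h := hc)).and_eventually (eventually_ge_atTop T)).mono
      fun t ht => ht.symm
  obtain ⟨ns, hns, hns'⟩ := exists_seq_forall_of_frequently hfreq
  have h1 : limsup (fun n => ∫⁻ s in Ioc 0 h, φ (ns n) s) atTop ≤
      ∫⁻ s in Ioc 0 h, limsup (fun n => φ (ns n) s) atTop := by
    refine limsup_lintegral_le (fun _ => B) (fun n => hm _) (fun n => ?_) ?_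
    · exact (ae_restrict_iff' measurableSet_Ioc).2
        (ae_of_all _ fun s hs => hφ _ (hns' n).1 s hs.1)
    · rw [setLIntegral_const]
      exact ENNReal.mul_ne_top hB (by simp)
  have h2 : c ≤ limsup (fun n => ∫⁻ s in Ioc 0 h, φ (ns n) s) atTop :=
    le_limsup_of_frequently_le (Frequently.of_forall fun n => (hns' n).2.le)
  refine h2.trans (h1.trans ?_)
  calc ∫⁻ s in Ioc 0 h, limsup (fun n => φ (ns n) s) atTop ≤ ∫⁻ _ in Ioc 0 h, L := by
        refine setLIntegral_mono' measurableSet_Ioc fun s hs => (le_trans ?_ (hL s hs))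
        exact limsup_le_limsup_of_le (f := map ns atTop) (g := atTop) (u := fun t => φ t s) hns
    _ = _ := by rw [setLIntegral_const, Real.volume_Ioc, sub_zero]

end

/-! ### Convolutions with the smoothing operators `R` -/

noncomputable section

theorem ContinuousLinearMap.enorm_le_iSup_mul {E F : Type*} [NormedAddCommGroup E]
    [NormedSpace ℝ E] [NormedAddCommGroup F] [NormedSpace ℝ F] (L : E →L[ℝ] F) (x : E) :
    ‖L x‖ₑ ≤ (⨆ (φ : E) (_ : ‖φ‖ ≤ 1), ‖L φ‖ₑ) * ‖x‖ₑ := by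
  rcases eq_or_ne x 0 with rfl | hx
  · simp
  have h0 : ‖x‖ ≠ 0 := norm_ne_zero_iff.2 hx
  have h1 : x = ‖x‖ • (‖x‖⁻¹ • x) := by rw [smul_smul, mul_inv_cancel₀ h0, one_smul]
  have h2 : ‖‖x‖⁻¹ • x‖ ≤ 1 := by
    rw [norm_smul, norm_inv, norm_norm, inv_mul_cancel₀ h0]
  have h3 : ‖L x‖ₑ = ‖L (‖x‖⁻¹ • x)‖ₑ * ‖x‖ₑ := by
    conv_lhs => rw [h1, map_smul, enorm_smul, mul_comm]
    simp
  rw [h3]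
  gcongr
  exact le_iSup₂ (f := fun (φ : E) (_ : ‖φ‖ ≤ 1) => ‖L φ‖ₑ) (‖x‖⁻¹ • x) h2

theorem ContinuousLinearMap.iSup_enorm_le {E F : Type*} [NormedAddCommGroup E]
    [NormedSpace ℝ E] [NormedAddCommGroup F] [NormedSpace ℝ F] (L : E →L[ℝ] F) {C : ℝ}
    (h : ‖L‖ ≤ C) : (⨆ (φ : E) (_ : ‖φ‖ ≤ 1), ‖L φ‖ₑ) ≤ ENNReal.ofReal C := by
  refine iSup₂_le fun φ hφ => ?_
  rw [← ofReal_norm]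
  refine ENNReal.ofReal_le_ofReal ?_
  exact (L.le_opNorm φ).trans ((mul_le_of_le_one_right (norm_nonneg _) hφ).trans h)

variable {Z X : Type*} [NormedAddCommGroup Z] [InnerProductSpace ℝ Z] [CompleteSpace Z]
  [NormedAddCommGroup X] [NormedSpace ℝ X] [CompleteSpace X]

namespace RegulatedSystem.Realization

variable {P : RegulatedSystem Z X} (hP : P.Standing) (𝓡 : P.Realization)

/-- The integrable function that dominates the operators `R(t)`. -/
def majorant (s : ℝ) : ℝ := (s ^ (-𝓡.a) + 1) * Real.exp (-𝓡.ω * s)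

theorem majorant_nonneg {s : ℝ} (hs : 0 < s) : 0 ≤ 𝓡.majorant s := by
  unfold majorant; positivity

theorem integrableOn_majorant : IntegrableOn 𝓡.majorant (Ioi 0) := by
  have h1 := Real.integrableOn_rpow_mul_exp (s := -𝓡.a) (by linarith [𝓡.a_lt_one]) 𝓡.ω_pos
  have h2 := Real.integrableOn_rpow_mul_exp (s := 0) (by norm_num) 𝓡.ω_pos
  refine (h1.add h2).congr (ae_of_all _ fun s => ?_)
  simp only [majorant, Pi.add_apply, Real.rpow_zero]
  ring

theorem tendsto_majorant : Tendsto 𝓡.majorant atTop (𝓝 0) := by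
  have h1 : Tendsto (fun s : ℝ => 2 * Real.exp (-𝓡.ω * s)) atTop (𝓝 (2 * 0)) := by
    refine (Real.tendsto_exp_atBot.comp ?_).const_mul 2
    exact tendsto_id.const_mul_atTop_of_neg (neg_lt_zero.2 𝓡.ω_pos)
  rw [mul_zero] at h1
  refine squeeze_zero' ?_ ?_ h1
  · filter_upwards [eventually_gt_atTop 0] with s hs
    exact 𝓡.majorant_nonneg hs
  · filter_upwards [eventually_ge_atTop 1] with s hs
    have : s ^ (-𝓡.a) ≤ 1 := Real.rpow_le_one_of_one_le_of_nonpos hs (by linarith [𝓡.a_pos])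
    unfold majorant
    gcongr
    linarith

theorem norm_R_apply_le {s : ℝ} (hs : 0 < s) (x : X) : ‖𝓡.R s x‖ ≤ 𝓡.M * ‖x‖ * 𝓡.majorant s := by
  refine ((𝓡.R s).le_of_opNorm_le (𝓡.R_bound s hs) x).trans (le_of_eq ?_)
  rw [majorant]; ring

theorem norm_comp_R_le {Y : Type*} [NormedAddCommGroup Y] [NormedSpace ℝ Y] (Φ : Z →L[ℝ] Y)
    {s : ℝ} (hs : 0 < s) (x : X) : ‖Φ (𝓡.R s x)‖ ≤ ‖Φ‖ * 𝓡.M * ‖x‖ * 𝓡.majorant s := by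
  refine (Φ.le_opNorm _).trans ?_
  rw [mul_assoc, mul_assoc, ← mul_assoc 𝓡.M]
  gcongr
  exact 𝓡.norm_R_apply_le hs x

theorem tendsto_R_apply {Y : Type*} [NormedAddCommGroup Y] [NormedSpace ℝ Y] (Φ : Z →L[ℝ] Y)
    (x : X) (t₀ : ℝ) : Tendsto (fun t => ‖Φ (𝓡.R (t - t₀) x)‖ₑ) atTop (𝓝 0) := by
  have h1 := (𝓡.tendsto_majorant.comp (tendsto_atTop_add_const_right atTop (-t₀)
    tendsto_id)).const_mul (‖Φ‖ * 𝓡.M * ‖x‖)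
  rw [mul_zero] at h1
  have h2 := (ENNReal.continuous_ofReal.tendsto 0).comp h1
  rw [ENNReal.ofReal_zero] at h2
  refine tendsto_of_tendsto_of_tendsto_of_le_of_le' tendsto_const_nhds h2
    (Eventually.of_forall fun _ => zero_le) ?_
  filter_upwards [eventually_gt_atTop t₀] with t ht
  rw [← ofReal_norm]
  exact ENNReal.ofReal_le_ofReal (𝓡.norm_comp_R_le Φ (sub_pos.2 ht) x)

include hP in
theorem continuousOn_R : ContinuousOn (fun p : ℝ × X => 𝓡.R p.1 p.2) (Ioi 0 ×ˢ univ) := by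
  obtain ⟨M, ω, -, -, -, hM⟩ := hP.stable_β.exists_bound
  exact (hP.semigroup_β.continuousOn_of_factor hM 𝓡.Q_injective 𝓡.R_eq).2

/-- The convolution `∫_{t₀}^t R(t - τ) g(τ) dτ`. -/
def conv (t₀ : ℝ) (g : ℝ → X) (t : ℝ) : Z := ∫ s in (0 : ℝ)..(t - t₀), 𝓡.R s (g (t - s))

include hP in
theorem continuousOn_integrand {t₀ t : ℝ} {g : ℝ → X} (hg : ContinuousOn g (Ici t₀)) :
    ContinuousOn (fun s => 𝓡.R s (g (t - s))) (Ioc 0 (t - t₀)) := by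
  refine (𝓡.continuousOn_R hP).comp (g := fun p : ℝ × X => 𝓡.R p.1 p.2)
    (f := fun s => (s, g (t - s))) (continuousOn_id.prodMk ?_) fun s hs => ⟨hs.1, mem_univ _⟩
  exact hg.comp (by fun_prop) fun s hs => mem_Ici.2 (by linarith [hs.2])

theorem exists_bound_Icc {Y : Type*} [NormedAddCommGroup Y] {t₀ : ℝ} {g : ℝ → Y}
    (hg : ContinuousOn g (Ici t₀)) (t : ℝ) : ∃ B, 0 ≤ B ∧ ∀ τ ∈ Icc t₀ t, ‖g τ‖ ≤ B := by
  obtain ⟨B, hB⟩ := isCompact_Icc.exists_bound_of_continuousOn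
    (hg.mono (Icc_subset_Ici_self : Icc t₀ t ⊆ Ici t₀))
  exact ⟨max B 0, le_max_right _ _, fun τ hτ => (hB τ hτ).trans (le_max_left _ _)⟩

include hP in
theorem intervalIntegrable_conv {t₀ t : ℝ} (ht : t₀ ≤ t) {g : ℝ → X}
    (hg : ContinuousOn g (Ici t₀)) :
    IntervalIntegrable (fun s => 𝓡.R s (g (t - s))) volume 0 (t - t₀) := by
  rw [intervalIntegrable_iff_integrableOn_Ioc_of_le (sub_nonneg.2 ht)]
  obtain ⟨B, hB0, hB⟩ := exists_bound_Icc hg t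
  refine ((𝓡.integrableOn_majorant.mono_set Ioc_subset_Ioi_self).const_mul (𝓡.M * B)).mono'
    ((𝓡.continuousOn_integrand hP hg).aestronglyMeasurable measurableSet_Ioc) ?_
  refine (ae_restrict_iff' measurableSet_Ioc).2 (ae_of_all _ fun s hs => ?_)
  refine (𝓡.norm_R_apply_le hs.1 _).trans ?_
  have := 𝓡.majorant_nonneg hs.1
  have := 𝓡.M_nonneg
  gcongr
  exact hB _ ⟨by linarith [hs.2], by linarith [hs.1]⟩

include hP in
theorem conv_add {t₀ t : ℝ} (ht : t₀ ≤ t) {g h : ℝ → X} (hg : ContinuousOn g (Ici t₀))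
    (hh : ContinuousOn h (Ici t₀)) :
    𝓡.conv t₀ (fun τ => g τ + h τ) t = 𝓡.conv t₀ g t + 𝓡.conv t₀ h t := by
  unfold conv
  rw [← intervalIntegral.integral_add (𝓡.intervalIntegrable_conv hP ht hg)
    (𝓡.intervalIntegrable_conv hP ht hh)]
  simp only [map_add]

include hP in
theorem enorm_conv_le {Y : Type*} [NormedAddCommGroup Y] [NormedSpace ℝ Y] [CompleteSpace Y]
    (Φ : Z →L[ℝ] Y) {t₀ t : ℝ} (ht : t₀ ≤ t) {g : ℝ → X} (hg : ContinuousOn g (Ici t₀)) :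
    ‖Φ (𝓡.conv t₀ g t)‖ₑ ≤ ∫⁻ s in Ioc 0 (t - t₀), ‖Φ (𝓡.R s (g (t - s)))‖ₑ := by
  rw [conv, ← ContinuousLinearMap.intervalIntegral_comp_comm Φ
    (𝓡.intervalIntegrable_conv hP ht hg), intervalIntegral.integral_of_le (sub_nonneg.2 ht)]
  exact enorm_integral_le_lintegral_enorm _

-- Dominated convergence on the fixed domain (0, ∞): the moving endpoint becomes an indicator that
-- jumps only at the null set s = t₁ − t₀, and the majorant absorbs the singularity of R.
include hP in
theorem continuousOn_conv {t₀ : ℝ} {g : ℝ → X} (hg : ContinuousOn g (Ici t₀)) :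
    ContinuousOn (𝓡.conv t₀ g) (Ioi t₀) := by
  intro t₁ ht₁
  have ht₁ : t₀ < t₁ := ht₁
  obtain ⟨B, hB0, hB⟩ := exists_bound_Icc hg (t₁ + 1)
  have hM := 𝓡.M_nonneg
  have h1 : ContinuousAt (fun t => ∫ s in Ioi (0 : ℝ), (Ioc 0 (t - t₀)).indicator
      (fun s => 𝓡.R s (g (t - s))) s) t₁ := by
    refine continuousAt_of_dominated (bound := fun s => 𝓡.M * B * 𝓡.majorant s) ?_ ?_
      (𝓡.integrableOn_majorant.const_mul _) ?_
    · refine Eventually.of_forall fun t => ?_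
      refine AEStronglyMeasurable.mono_measure ?_ Measure.restrict_le_self
      rw [aestronglyMeasurable_indicator_iff measurableSet_Ioc]
      exact (𝓡.continuousOn_integrand hP hg).aestronglyMeasurable measurableSet_Ioc
    · filter_upwards [Iio_mem_nhds (show t₁ < t₁ + 1 by linarith)] with t ht
      have ht : t < t₁ + 1 := ht
      refine (ae_restrict_iff' measurableSet_Ioi).2 (ae_of_all _ fun s hs => ?_)
      have hm := 𝓡.majorant_nonneg hs
      by_cases h : s ∈ Ioc 0 (t - t₀)
      · rw [indicator_of_mem h]
        refine (𝓡.norm_R_apply_le h.1 _).trans ?_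
        gcongr
        exact hB _ ⟨by linarith [h.2], by linarith [h.1]⟩
      · rw [indicator_of_notMem h, norm_zero]
        positivity
    · have : ∀ᵐ s : ℝ ∂(volume.restrict (Ioi 0)), s ≠ t₁ - t₀ :=
        ae_restrict_of_ae (by simp [ae_iff])
      filter_upwards [this, ae_restrict_mem measurableSet_Ioi] with s hs hs0
      rcases lt_or_gt_of_ne hs with h | h
      · have h2 : ContinuousAt (fun t => 𝓡.R s (g (t - s))) t₁ := by
          refine (𝓡.R s).continuous.continuousAt.comp ?_
          refine ContinuousAt.comp (g := g) (f := fun t => t - s)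
            (hg.continuousAt (Ici_mem_nhds ?_)) (by fun_prop)
          linarith
        refine h2.congr ?_
        filter_upwards [Ioi_mem_nhds (show s + t₀ < t₁ by linarith)] with t ht
        have ht : s + t₀ < t := ht
        rw [indicator_of_mem]
        exact ⟨hs0, by linarith⟩
      · refine (continuousAt_const (y := (0 : Z))).congr ?_
        filter_upwards [Iio_mem_nhds (show t₁ < s + t₀ by linarith)] with t ht
        have ht : t < s + t₀ := ht
        rw [indicator_of_notMem]
        exact fun hmem => by linarith [hmem.2]
  refine (h1.congr ?_).continuousWithinAt
  filter_upwards [Ioi_mem_nhds ht₁] with t ht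
  have ht : t₀ < t := ht
  rw [integral_indicator measurableSet_Ioc, Measure.restrict_restrict measurableSet_Ioc,
    inter_eq_left.2 Ioc_subset_Ioi_self, conv, intervalIntegral.integral_of_le (by linarith)]

include hP in
theorem Q_conv {t₀ t : ℝ} (ht : t₀ ≤ t) {g : ℝ → X} (hg : ContinuousOn g (Ici t₀)) :
    𝓡.Q (𝓡.conv t₀ g t) = ∫ τ in t₀..t, P.S (t - τ) (g τ) := by
  rw [conv, ← ContinuousLinearMap.intervalIntegral_comp_comm 𝓡.Q
    (𝓡.intervalIntegrable_conv hP ht hg)]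
  have h1 := intervalIntegral.integral_comp_sub_left (a := t₀) (b := t)
    (fun s => P.S s (g (t - s))) t
  simp only [sub_sub_cancel, sub_self] at h1
  rw [h1]
  refine intervalIntegral.integral_congr_ae (ae_of_all _ fun s hs => ?_)
  rw [uIoc_of_le (sub_nonneg.2 ht)] at hs
  exact 𝓡.R_eq s hs.1 _

include hP in
theorem intervalIntegrable_semigroup {g : ℝ → X} (hg : ContinuousOn g (Ioi 0)) {t a b : ℝ}
    (ha : 0 ≤ a) (hab : a ≤ b) (hb : b ≤ t) (hi : IntervalIntegrable g volume a b) :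
    IntervalIntegrable (fun τ => P.S (t - τ) (g τ)) volume a b := by
  obtain ⟨M, ω, hM0, -, -, hM⟩ := hP.stable_β.exists_bound
  rw [intervalIntegrable_iff_integrableOn_Ioc_of_le hab] at hi ⊢
  refine (hi.norm.const_mul M).mono' ?_ ?_
  · refine ContinuousOn.aestronglyMeasurable ?_ measurableSet_Ioc
    refine (hP.semigroup_β.continuousOn_uncurry hM).comp (g := fun p : ℝ × X => P.S p.1 p.2)
      (f := fun τ => (t - τ, g τ)) ((by fun_prop : ContinuousOn (fun τ => t - τ) _).prodMk
        (hg.mono fun τ hτ => mem_Ioi.2 (ha.trans_lt hτ.1))) fun τ hτ => ⟨?_, mem_univ _⟩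
    exact mem_Ici.2 (by linarith [hτ.2])
  · refine (ae_restrict_iff' measurableSet_Ioc).2 (ae_of_all _ fun τ hτ => ?_)
    exact (P.S _).le_of_opNorm_le (hM _ (by linarith [hτ.2])) _

include hP in
/-- A mild solution, restarted at positive times, in terms of the smoothing operators `R`. -/
theorem exists_representation {z₀ : Z} {g : ℝ → X} {z : ℝ → Z} (hz : P.IsMildSolution z₀ g z)
    (hg : ContinuousOn g (Ioi 0)) : ∃ v : ℝ → Z, ContinuousOn v (Ioi 0) ∧
      (∀ t, 0 < t → 𝓡.Q (v t) = P.ι (z t)) ∧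
      ∀ t₀ t, 0 < t₀ → t₀ < t → v t = 𝓡.R (t - t₀) (P.ι (z t₀)) + 𝓡.conv t₀ g t := by
  have hgI : ∀ t₀, 0 < t₀ → ContinuousOn g (Ici t₀) := fun t₀ h =>
    hg.mono (Ici_subset_Ioi.2 h)
  have key : ∀ t₀ t, 0 < t₀ → t₀ < t →
      𝓡.Q (𝓡.R (t - t₀) (P.ι (z t₀)) + 𝓡.conv t₀ g t) = P.ι (z t) := by
    intro t₀ t h0 ht
    have i0 := intervalIntegrable_semigroup hP hg le_rfl h0.le le_rfl (hz.integrable t₀ h0.le)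
    have i1 := intervalIntegrable_semigroup hP hg le_rfl h0.le ht.le (hz.integrable t₀ h0.le)
    have i2 := intervalIntegrable_semigroup hP hg h0.le ht.le le_rfl
      ((hz.integrable t (h0.trans ht).le).mono_set (by
        rw [uIcc_of_le ht.le, uIcc_of_le (h0.trans ht).le]
        exact Icc_subset_Icc_left h0.le))
    rw [map_add, 𝓡.R_eq _ (sub_pos.2 ht), 𝓡.Q_conv hP ht.le (hgI _ h0), hz.eq t (h0.trans ht).le,
      hz.eq t₀ h0.le, map_add, ← intervalIntegral.integral_add_adjacent_intervals i1 i2,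
      ← hP.semigroup_β.map_add_apply (sub_nonneg.2 ht.le) h0.le, sub_add_cancel,
      ← ContinuousLinearMap.intervalIntegral_comp_comm _ i0, add_assoc]
    congr 2
    refine intervalIntegral.integral_congr fun τ hτ => ?_
    rw [uIcc_of_le h0.le] at hτ
    rw [← hP.semigroup_β.map_add_apply (sub_nonneg.2 ht.le) (sub_nonneg.2 hτ.2)]
    congr 2; ring
  -- Any positive restart time would do, as Q is injective. Restarting at t/2 stays away from 0,
  -- near which g is merely integrable.
  let v : ℝ → Z := fun t => 𝓡.R (t - t / 2) (P.ι (z (t / 2))) + 𝓡.conv (t / 2) g t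
  have hv : ∀ t, 0 < t → 𝓡.Q (v t) = P.ι (z t) := fun t ht =>
    key (t / 2) t (half_pos ht) (half_lt_self ht)
  have hv' : ∀ t₀ t, 0 < t₀ → t₀ < t →
      v t = 𝓡.R (t - t₀) (P.ι (z t₀)) + 𝓡.conv t₀ g t := fun t₀ t h0 ht =>
    𝓡.Q_injective (by rw [hv t (h0.trans ht), key t₀ t h0 ht])
  refine ⟨v, fun t ht => ?_, hv, hv'⟩
  have ht : 0 < t := ht
  have h2 : t / 2 < t := half_lt_self ht
  have h3 : ContinuousAt (fun s => 𝓡.R (s - t / 2) (P.ι (z (t / 2))) + 𝓡.conv (t / 2) g s) t := by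
    refine ContinuousAt.add ?_ ((𝓡.continuousOn_conv hP (hgI _ (half_pos ht))).continuousAt
      (Ioi_mem_nhds h2))
    exact ContinuousAt.comp (g := fun p : ℝ × X => 𝓡.R p.1 p.2)
      (f := fun s => (s - t / 2, P.ι (z (t / 2)))) (x := t)
      ((𝓡.continuousOn_R hP).continuousAt
        (prod_mem_nhds (Ioi_mem_nhds (sub_pos.2 h2)) univ_mem)) (by fun_prop)
  refine (h3.congr ?_).continuousWithinAt
  filter_upwards [Ioi_mem_nhds h2] with s hs
  exact (hv' _ _ (half_pos ht) hs).symm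

include hP in
/-- Integration by parts in the output of a convolution with a scalar signal. -/
theorem c_conv_smul {t₀ t : ℝ} (ht : t₀ < t) {ρ ρ' : ℝ → ℝ} (hρ : ContinuousOn ρ (Ici t₀))
    (hρ' : ContinuousOn ρ' (Ici t₀)) (hd : ∀ τ, t₀ < τ → HasDerivAt ρ (ρ' τ) τ) (x : X) :
    𝓡.c (𝓡.conv t₀ (fun τ => ρ τ • x) t) = P.β * 𝓡.ℓ x * ρ t -
      P.β * 𝓡.ℓ (P.S (t - t₀) x) * ρ t₀ -
      ∫ s in (0 : ℝ)..(t - t₀), P.β * 𝓡.ℓ (P.S s x) * ρ' (t - s) := by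
  have hT : 0 ≤ t - t₀ := sub_nonneg.2 ht.le
  obtain ⟨M, ω, hM0, -, -, hM⟩ := hP.stable_β.exists_bound
  have hgc : ContinuousOn (fun τ => ρ τ • x) (Ici t₀) := hρ.smul continuousOn_const
  have hi := 𝓡.intervalIntegrable_conv hP ht.le hgc
  have hci : IntervalIntegrable (fun s => 𝓡.c (𝓡.R s (ρ (t - s) • x))) volume 0 (t - t₀) :=
    ⟨𝓡.c.integrable_comp hi.1, 𝓡.c.integrable_comp hi.2⟩
  have hmaps : ∀ s ∈ Icc 0 (t - t₀), t - s ∈ Ici t₀ := fun s hs => mem_Ici.2 (by linarith [hs.2])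
  have hℓc : ContinuousOn (fun s => P.β * 𝓡.ℓ (P.S s x)) (Icc 0 (t - t₀)) :=
    continuousOn_const.mul (𝓡.ℓ.continuous.comp_continuousOn
      ((hP.semigroup_β.continuousOn hM x).mono fun s hs => hs.1))
  have hρc : ContinuousOn (fun s => ρ (t - s)) (Icc 0 (t - t₀)) :=
    hρ.comp (by fun_prop) hmaps
  have hρ'c : ContinuousOn (fun s => ρ' (t - s)) (Icc 0 (t - t₀)) :=
    hρ'.comp (by fun_prop) hmaps
  have hi2 : IntervalIntegrable (fun s => P.β * 𝓡.ℓ (P.S s x) * ρ' (t - s)) volume 0 (t - t₀) := by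
    refine ContinuousOn.intervalIntegrable ?_
    rw [uIcc_of_le hT]
    exact hℓc.mul hρ'c
  -- The derivative is singular at s = 0 but integrable, and right derivatives suffice.
  have hF := intervalIntegral.integral_eq_sub_of_hasDeriv_right
    (f := fun s => P.β * 𝓡.ℓ (P.S s x) * ρ (t - s))
    (f' := fun s => -(𝓡.c (𝓡.R s (ρ (t - s) • x)) + P.β * 𝓡.ℓ (P.S s x) * ρ' (t - s)))
    (a := 0) (b := t - t₀) (by rw [uIcc_of_le hT]; exact hℓc.mul hρc) (fun s hs => ?_)
    (hci.add hi2).neg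
  · rw [intervalIntegral.integral_neg, intervalIntegral.integral_add hci hi2,
      hP.semigroup_β.map_zero_apply, sub_zero, sub_sub_cancel] at hF
    rw [conv, ← ContinuousLinearMap.intervalIntegral_comp_comm 𝓡.c hi]
    linarith
  · rw [min_eq_left hT, max_eq_right hT] at hs
    have h1 := 𝓡.deriv s hs.1 x
    have h2 := (HasDerivAt.comp_const_sub t s (hd (t - s) (by linarith [hs.2]))).hasDerivWithinAt
      (s := Ioi s)
    refine (h1.mul h2).congr_deriv ?_
    rw [map_smul, map_smul, smul_eq_mul]
    ring

end RegulatedSystem.Realization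

end

/-! ### Trajectories: kernels, decomposition, boundedness -/

noncomputable section

variable {Z X : Type*} [NormedAddCommGroup Z] [InnerProductSpace ℝ Z] [CompleteSpace Z]
  [NormedAddCommGroup X] [NormedSpace ℝ X] [CompleteSpace X]

namespace RegulatedSystem.Realization

variable {P : RegulatedSystem Z X} (hP : P.Standing) (𝓡 : P.Realization)
  {Y : Type*} [NormedAddCommGroup Y] [NormedSpace ℝ Y] [CompleteSpace Y]

/-- `I₀` as a bounded operator. -/
def I₀L : X →L[ℝ] X := ContinuousLinearMap.id ℝ X - 𝓡.ℓ.smulRight P.b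

theorem I₀L_apply (x : X) : 𝓡.I₀L x = P.I₀ x := by
  rw [𝓡.I₀_eq]; simp [I₀L]

/-- I₀ is the projection onto ker ℓ along b. Hence the disturbance leaves no undifferentiated term
after integration by parts. -/
theorem ℓ_I₀ (x : X) : 𝓡.ℓ (P.I₀ x) = 0 := by
  rw [𝓡.I₀_eq, map_sub, map_smul, 𝓡.ℓ_b]; simp

/-- The operator `Φ R(s) I₀` on `Z`. -/
def kernelOp (Φ : Z →L[ℝ] Y) (s : ℝ) : Z →L[ℝ] Y :=
  Φ.comp ((𝓡.R s).comp (𝓡.I₀L.comp P.ι))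

theorem kernelOp_apply (Φ : Z →L[ℝ] Y) (s : ℝ) (φ : Z) :
    𝓡.kernelOp Φ s φ = Φ (𝓡.R s (P.I₀ (P.ι φ))) := by
  rw [← 𝓡.I₀L_apply]; rfl

/-- The norm of `Φ R(s) I₀` as an operator on `Z`. -/
def opKernel (Φ : Z →L[ℝ] Y) (s : ℝ) : ℝ≥0∞ :=
  ⨆ (φ : Z) (_ : ‖φ‖ ≤ 1), ‖𝓡.kernelOp Φ s φ‖ₑ

/-- The norm of `Φ R(s) x`. -/
def vecKernel (Φ : Z →L[ℝ] Y) (x : X) (s : ℝ) : ℝ≥0∞ := ‖Φ (𝓡.R s x)‖ₑ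

theorem exists_opKernel_le (Φ : Z →L[ℝ] Y) : ∃ C : ℝ, ∀ s, 0 < s →
    𝓡.opKernel Φ s ≤ ENNReal.ofReal (C * 𝓡.majorant s) := by
  refine ⟨‖Φ‖ * (𝓡.M * ‖𝓡.I₀L.comp P.ι‖), fun s hs => ?_⟩
  refine ContinuousLinearMap.iSup_enorm_le _ ?_
  refine (ContinuousLinearMap.opNorm_comp_le _ _).trans ?_
  rw [mul_assoc]
  gcongr
  refine (ContinuousLinearMap.opNorm_comp_le _ _).trans ?_
  rw [mul_right_comm]
  gcongr
  exact 𝓡.R_bound s hs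

theorem exists_vecKernel_le (Φ : Z →L[ℝ] Y) (x : X) : ∃ C : ℝ, ∀ s, 0 < s →
    𝓡.vecKernel Φ x s ≤ ENNReal.ofReal (C * 𝓡.majorant s) := by
  refine ⟨‖Φ‖ * 𝓡.M * ‖x‖, fun s hs => ?_⟩
  rw [vecKernel, ← ofReal_norm]
  exact ENNReal.ofReal_le_ofReal (𝓡.norm_comp_R_le Φ hs x)

theorem lintegral_ne_top_of_le {k : ℝ → ℝ≥0∞} (h : ∃ C : ℝ, ∀ s, 0 < s →
    k s ≤ ENNReal.ofReal (C * 𝓡.majorant s)) : ∫⁻ s in Ioi 0, k s ≠ ⊤ := by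
  obtain ⟨C, hC⟩ := h
  refine ne_of_lt ((setLIntegral_mono' measurableSet_Ioi fun s hs => hC s hs).trans_lt ?_)
  refine (lintegral_mono fun s => ?_).trans_lt (𝓡.integrableOn_majorant.const_mul C).2
  rw [← ofReal_norm]
  exact ENNReal.ofReal_le_ofReal (le_abs_self _)

theorem limsup_conv_le {k φ : ℝ → ℝ≥0∞} (h : ∃ C : ℝ, ∀ s, 0 < s →
    k s ≤ ENNReal.ofReal (C * 𝓡.majorant s)) {t₀ : ℝ} (hB : ∃ B : ℝ≥0∞, B ≠ ⊤ ∧ ∀ τ, t₀ ≤ τ → φ τ ≤ B)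
    {I L : ℝ≥0∞} (hI : ∫⁻ s in Ioi 0, k s = I) (hL : limsup φ atTop ≤ L) :
    limsup (fun t => ∫⁻ s in Ioc 0 (t - t₀), k s * φ (t - s)) atTop ≤ I * L := by
  obtain ⟨C, hC⟩ := h
  obtain ⟨B, hB, hφ⟩ := hB
  refine (limsup_convolution_le (𝓡.integrableOn_majorant.const_mul C) hC hB hφ).trans ?_
  rw [hI]
  gcongr

theorem lintegral_conv_le {k φ : ℝ → ℝ≥0∞} {t₀ t : ℝ} {B : ℝ≥0∞} (hB : B ≠ ⊤)
    (hφ : ∀ τ ∈ Icc t₀ t, φ τ ≤ B) :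
    ∫⁻ s in Ioc 0 (t - t₀), k s * φ (t - s) ≤ (∫⁻ s in Ioi 0, k s) * B := by
  calc ∫⁻ s in Ioc 0 (t - t₀), k s * φ (t - s) ≤ ∫⁻ s in Ioc 0 (t - t₀), k s * B := by
        refine setLIntegral_mono' measurableSet_Ioc fun s hs => ?_
        gcongr
        exact hφ _ ⟨by linarith [hs.2], by linarith [hs.1]⟩
    _ = (∫⁻ s in Ioc 0 (t - t₀), k s) * B := lintegral_mul_const' _ _ hB
    _ ≤ _ := by
        gcongr
        exact Ioc_subset_Ioi_self

/-- `v` represents a mild solution of `y' = A_β y + I₀ (F + B_d δ) + (1/β) B ρ`, `y(t₀) = x₀`. -/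
structure IsTrajectory (t₀ : ℝ) (x₀ : X) (F : ℝ → Z) (ρ δ : ℝ → ℝ) (v : ℝ → Z) : Prop where
  F_cont : ContinuousOn F (Ici t₀)
  ρ_cont : ContinuousOn ρ (Ici t₀)
  δ_cont : ContinuousOn δ (Ici t₀)
  v_cont : ContinuousOn v (Ici t₀)
  eq : ∀ t, t₀ < t → v t = 𝓡.R (t - t₀) x₀ + 𝓡.conv t₀
    (fun τ => P.I₀ (P.ι (F τ) + δ τ • P.bd) + (1 / P.β) • (ρ τ • P.b)) t

include 𝓡 in
theorem continuousOn_I₀ {t₀ : ℝ} {F : ℝ → Z} (hF : ContinuousOn F (Ici t₀)) :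
    ContinuousOn (fun τ => P.I₀ (P.ι (F τ))) (Ici t₀) := by
  have : ContinuousOn (fun τ => 𝓡.I₀L (P.ι (F τ))) (Ici t₀) :=
    𝓡.I₀L.continuous.comp_continuousOn (P.ι.continuous.comp_continuousOn hF)
  exact this.congr fun τ _ => (𝓡.I₀L_apply _).symm

include hP in
theorem enorm_conv_op_le (Φ : Z →L[ℝ] Y) {t₀ t : ℝ} (ht : t₀ ≤ t) {F : ℝ → Z}
    (hF : ContinuousOn F (Ici t₀)) : ‖Φ (𝓡.conv t₀ (fun τ => P.I₀ (P.ι (F τ))) t)‖ₑ ≤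
      ∫⁻ s in Ioc 0 (t - t₀), 𝓡.opKernel Φ s * ‖F (t - s)‖ₑ := by
  refine (𝓡.enorm_conv_le hP Φ ht (𝓡.continuousOn_I₀ hF)).trans ?_
  refine lintegral_mono fun s => ?_
  simp only
  rw [← 𝓡.kernelOp_apply]
  exact ContinuousLinearMap.enorm_le_iSup_mul _ _

include hP in
theorem enorm_conv_vec_le (Φ : Z →L[ℝ] Y) {t₀ t : ℝ} (ht : t₀ ≤ t) {ρ : ℝ → ℝ}
    (hρ : ContinuousOn ρ (Ici t₀)) (x : X) : ‖Φ (𝓡.conv t₀ (fun τ => ρ τ • x) t)‖ₑ ≤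
      ∫⁻ s in Ioc 0 (t - t₀), 𝓡.vecKernel Φ x s * ‖ρ (t - s)‖ₑ := by
  have hc : ContinuousOn (fun τ => ρ τ • x) (Ici t₀) := hρ.smul continuousOn_const
  refine (𝓡.enorm_conv_le hP Φ ht hc).trans ?_
  refine lintegral_mono fun s => ?_
  simp only
  rw [map_smul, map_smul, enorm_smul, mul_comm]
  rfl

theorem enorm_integral_mul_le {t₀ t : ℝ} (ht : t₀ ≤ t) (K ρ : ℝ → ℝ) :
    ‖∫ s in (0 : ℝ)..(t - t₀), K s * ρ (t - s)‖ₑ ≤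
      ∫⁻ s in Ioc 0 (t - t₀), ‖K s‖ₑ * ‖ρ (t - s)‖ₑ := by
  rw [intervalIntegral.integral_of_le (sub_nonneg.2 ht)]
  refine (enorm_integral_le_lintegral_enorm _).trans (lintegral_mono fun s => ?_)
  rw [enorm_mul]

namespace IsTrajectory

variable {𝓡} {t₀ : ℝ} {x₀ : X} {F : ℝ → Z} {ρ δ : ℝ → ℝ} {v : ℝ → Z}
  (h : 𝓡.IsTrajectory t₀ x₀ F ρ δ v)

include hP h

theorem decomposition {t : ℝ} (ht : t₀ < t) : v t = 𝓡.R (t - t₀) x₀ +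
    (𝓡.conv t₀ (fun τ => P.I₀ (P.ι (F τ))) t +
      (𝓡.conv t₀ (fun τ => δ τ • P.I₀ P.bd) t +
        𝓡.conv t₀ (fun τ => ρ τ • ((1 / P.β) • P.b)) t)) := by
  have hδ : ContinuousOn (fun τ => δ τ • P.I₀ P.bd) (Ici t₀) := h.δ_cont.smul continuousOn_const
  have hρ : ContinuousOn (fun τ => ρ τ • ((1 / P.β) • P.b)) (Ici t₀) :=
    h.ρ_cont.smul continuousOn_const
  have hδρ : ContinuousOn (fun τ => δ τ • P.I₀ P.bd + ρ τ • ((1 / P.β) • P.b)) (Ici t₀) :=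
    hδ.add hρ
  rw [h.eq t ht, ← 𝓡.conv_add hP ht.le hδ hρ,
    ← 𝓡.conv_add hP ht.le (𝓡.continuousOn_I₀ h.F_cont) hδρ]
  congr 2
  funext τ
  rw [← 𝓡.I₀L_apply, ← 𝓡.I₀L_apply, ← 𝓡.I₀L_apply, map_add, map_smul,
    smul_comm (1 / P.β) (ρ τ) P.b, add_assoc]

theorem enorm_le (Φ : Z →L[ℝ] Y) {t : ℝ} (ht : t₀ < t) : ‖Φ (v t)‖ₑ ≤
    ‖Φ (𝓡.R (t - t₀) x₀)‖ₑ +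
    ((∫⁻ s in Ioc 0 (t - t₀), 𝓡.opKernel Φ s * ‖F (t - s)‖ₑ) +
      ((∫⁻ s in Ioc 0 (t - t₀), 𝓡.vecKernel Φ (P.I₀ P.bd) s * ‖δ (t - s)‖ₑ) +
        ∫⁻ s in Ioc 0 (t - t₀), 𝓡.vecKernel Φ ((1 / P.β) • P.b) s * ‖ρ (t - s)‖ₑ)) := by
  rw [h.decomposition hP ht, map_add, map_add, map_add]
  refine (enorm_add_le _ _).trans ?_
  gcongr
  refine (enorm_add_le _ _).trans ?_
  gcongr
  · exact 𝓡.enorm_conv_op_le hP Φ ht.le h.F_cont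
  refine (enorm_add_le _ _).trans ?_
  gcongr
  · exact 𝓡.enorm_conv_vec_le hP Φ ht.le h.δ_cont _
  · exact 𝓡.enorm_conv_vec_le hP Φ ht.le h.ρ_cont _

/-- R(t − t₀)x₀ may blow up as t ↓ t₀, so on [t₀, t₀+1] the bound comes from continuity of v; the
kernel estimates take over afterwards. -/
theorem exists_initial_bound (Φ : Z →L[ℝ] Y) : ∃ B : ℝ≥0∞, B ≠ ⊤ ∧
    (∀ t, t₀ ≤ t → t ≤ t₀ + 1 → ‖Φ (v t)‖ₑ ≤ B) ∧
    ∀ t, t₀ + 1 ≤ t → ‖Φ (𝓡.R (t - t₀) x₀)‖ₑ ≤ B := by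
  obtain ⟨B, -, hB⟩ := exists_bound_Icc h.v_cont (t₀ + 1)
  have h1 : ∀ t, t₀ + 1 ≤ t → ‖Φ (𝓡.R (t - t₀) x₀)‖ ≤ ‖Φ‖ * 𝓡.M * ‖x₀‖ * 2 := by
    intro t ht
    have hM := 𝓡.M_nonneg
    refine (𝓡.norm_comp_R_le Φ (by linarith) x₀).trans ?_
    gcongr
    unfold majorant
    have e1 : (t - t₀) ^ (-𝓡.a) ≤ 1 :=
      Real.rpow_le_one_of_one_le_of_nonpos (by linarith) (by linarith [𝓡.a_pos])
    have e2 : Real.exp (-𝓡.ω * (t - t₀)) ≤ 1 :=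
      Real.exp_le_one_iff.2 (by nlinarith [𝓡.ω_pos])
    have e3 : 0 < (t - t₀) ^ (-𝓡.a) := Real.rpow_pos_of_pos (by linarith) _
    calc _ ≤ (1 + 1) * (1 : ℝ) := by gcongr
      _ = 2 := by norm_num
  refine ⟨ENNReal.ofReal (‖Φ‖ * B) + ENNReal.ofReal (‖Φ‖ * 𝓡.M * ‖x₀‖ * 2),
    ENNReal.add_ne_top.2 ⟨ENNReal.ofReal_ne_top, ENNReal.ofReal_ne_top⟩, ?_, ?_⟩
  · intro t h2 h3
    refine le_add_right ?_
    rw [← ofReal_norm]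
    refine ENNReal.ofReal_le_ofReal ((Φ.le_opNorm _).trans ?_)
    gcongr
    exact hB t ⟨h2, h3⟩
  · intro t ht
    refine le_add_left ?_
    rw [← ofReal_norm]
    exact ENNReal.ofReal_le_ofReal (h1 t ht)

/-- The output of a trajectory with bounded forcing is bounded. -/
theorem exists_bound (Φ : Z →L[ℝ] Y) {BF Bρ Bδ : ℝ≥0∞} (hF : BF ≠ ⊤) (hρ : Bρ ≠ ⊤)
    (hδ : Bδ ≠ ⊤) (hBF : ∀ τ, t₀ ≤ τ → ‖F τ‖ₑ ≤ BF) (hBρ : ∀ τ, t₀ ≤ τ → ‖ρ τ‖ₑ ≤ Bρ)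
    (hBδ : ∀ τ, t₀ ≤ τ → ‖δ τ‖ₑ ≤ Bδ) : ∃ B : ℝ≥0∞, B ≠ ⊤ ∧ ∀ t, t₀ ≤ t → ‖Φ (v t)‖ₑ ≤ B := by
  obtain ⟨B, hB, h1, h2⟩ := h.exists_initial_bound hP Φ
  have i1 := 𝓡.lintegral_ne_top_of_le (𝓡.exists_opKernel_le Φ)
  have i2 := 𝓡.lintegral_ne_top_of_le (𝓡.exists_vecKernel_le Φ (P.I₀ P.bd))
  have i3 := 𝓡.lintegral_ne_top_of_le (𝓡.exists_vecKernel_le Φ ((1 / P.β) • P.b))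
  refine ⟨B + ((∫⁻ s in Ioi 0, 𝓡.opKernel Φ s) * BF +
    ((∫⁻ s in Ioi 0, 𝓡.vecKernel Φ (P.I₀ P.bd) s) * Bδ +
      (∫⁻ s in Ioi 0, 𝓡.vecKernel Φ ((1 / P.β) • P.b) s) * Bρ)), ?_, fun t ht => ?_⟩
  · exact ENNReal.add_ne_top.2 ⟨hB, ENNReal.add_ne_top.2 ⟨ENNReal.mul_ne_top i1 hF,
      ENNReal.add_ne_top.2 ⟨ENNReal.mul_ne_top i2 hδ, ENNReal.mul_ne_top i3 hρ⟩⟩⟩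
  · rcases le_total t (t₀ + 1) with h3 | h3
    · exact le_add_right (h1 t ht h3)
    · refine (h.enorm_le hP Φ (by linarith)).trans ?_
      gcongr
      · exact h2 t h3
      · exact lintegral_conv_le (φ := fun τ => ‖F τ‖ₑ) hF fun τ hτ => hBF τ hτ.1
      · exact lintegral_conv_le (φ := fun τ => ‖δ τ‖ₑ) hδ fun τ hτ => hBδ τ hτ.1
      · exact lintegral_conv_le (φ := fun τ => ‖ρ τ‖ₑ) hρ fun τ hτ => hBρ τ hτ.1

/-- Boundedness by the small gain condition. -/
theorem exists_bound_of_small_gain {Φ : Z →L[ℝ] Y} {ε : ℝ≥0}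
    (hε : ε * ∫⁻ s in Ioi 0, 𝓡.opKernel Φ s < 1) (hF : ∀ τ, t₀ ≤ τ → ‖F τ‖ₑ ≤ ε * ‖Φ (v τ)‖ₑ)
    {Bρ Bδ : ℝ≥0∞} (hρ : Bρ ≠ ⊤) (hδ : Bδ ≠ ⊤) (hBρ : ∀ τ, t₀ ≤ τ → ‖ρ τ‖ₑ ≤ Bρ)
    (hBδ : ∀ τ, t₀ ≤ τ → ‖δ τ‖ₑ ≤ Bδ) : ∃ B : ℝ≥0∞, B ≠ ⊤ ∧ ∀ t, t₀ ≤ t → ‖Φ (v t)‖ₑ ≤ B := by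
  obtain ⟨B, hB, h1, h2⟩ := h.exists_initial_bound hP Φ
  set I := ∫⁻ s in Ioi 0, 𝓡.opKernel Φ s with hI
  have i2 := 𝓡.lintegral_ne_top_of_le (𝓡.exists_vecKernel_le Φ (P.I₀ P.bd))
  have i3 := 𝓡.lintegral_ne_top_of_le (𝓡.exists_vecKernel_le Φ ((1 / P.β) • P.b))
  set q := B + ((∫⁻ s in Ioi 0, 𝓡.vecKernel Φ (P.I₀ P.bd) s) * Bδ +
      (∫⁻ s in Ioi 0, 𝓡.vecKernel Φ ((1 / P.β) • P.b) s) * Bρ) with hq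
  have hqt : q ≠ ⊤ := ENNReal.add_ne_top.2 ⟨hB, ENNReal.add_ne_top.2
    ⟨ENNReal.mul_ne_top i2 hδ, ENNReal.mul_ne_top i3 hρ⟩⟩
  have hgap : 1 - ε * I ≠ 0 := (tsub_pos_of_lt hε).ne'
  refine ⟨q / (1 - ε * I), ENNReal.div_ne_top hqt hgap, fun t₁ ht₁ => ?_⟩
  -- Over a compact interval the supremum is finite in advance, so m ≤ ε I m + q can be solved for
  -- m, with a result independent of t₁.
  set m := ⨆ τ ∈ Icc t₀ t₁, ‖Φ (v τ)‖ₑ with hm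
  have hmt : m ≠ ⊤ := by
    obtain ⟨b, -, hb⟩ := exists_bound_Icc h.v_cont t₁
    refine ne_top_of_le_ne_top (b := ENNReal.ofReal (‖Φ‖ * b)) ENNReal.ofReal_ne_top (iSup₂_le fun τ hτ => ?_)
    rw [← ofReal_norm]
    refine ENNReal.ofReal_le_ofReal ((Φ.le_opNorm _).trans ?_)
    gcongr
    exact hb τ hτ
  have hle : ∀ τ ∈ Icc t₀ t₁, ‖Φ (v τ)‖ₑ ≤ m := fun τ hτ =>
    le_iSup₂ (f := fun τ (_ : τ ∈ Icc t₀ t₁) => ‖Φ (v τ)‖ₑ) τ hτ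
  have hmq : m ≤ ε * I * m + q := by
    refine iSup₂_le fun t ht => ?_
    rcases le_total t (t₀ + 1) with h3 | h3
    · exact le_add_left (le_add_right (h1 t ht.1 h3))
    · refine (h.enorm_le hP Φ (by linarith)).trans ?_
      rw [hq, add_left_comm]
      gcongr ?_ + (?_ + (?_ + ?_))
      · rw [mul_comm (ε : ℝ≥0∞) I, mul_assoc]
        refine lintegral_conv_le (φ := fun τ => ‖F τ‖ₑ)
          (ENNReal.mul_ne_top ENNReal.coe_ne_top hmt) fun τ hτ => (hF τ hτ.1).trans ?_
        gcongr
        exact hle τ ⟨hτ.1, hτ.2.trans ht.2⟩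
      · exact h2 t h3
      · exact lintegral_conv_le (φ := fun τ => ‖δ τ‖ₑ) hδ fun τ hτ => hBδ τ hτ.1
      · exact lintegral_conv_le (φ := fun τ => ‖ρ τ‖ₑ) hρ fun τ hτ => hBρ τ hτ.1
  refine (hle t₁ ⟨ht₁, le_rfl⟩).trans ?_
  rw [ENNReal.le_div_iff_mul_le (Or.inl hgap) (Or.inr hqt), ENNReal.mul_sub (fun _ _ => hmt),
    mul_one, tsub_le_iff_left, mul_comm m]
  exact hmq

end IsTrajectory

end RegulatedSystem.Realization

end

noncomputable section

variable {Z X : Type*} [NormedAddCommGroup Z] [InnerProductSpace ℝ Z] [CompleteSpace Z]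
  [NormedAddCommGroup X] [NormedSpace ℝ X] [CompleteSpace X]

namespace RegulatedSystem.Realization

variable {P : RegulatedSystem Z X} (hP : P.Standing) (𝓡 : P.Realization)
  {Y : Type*} [NormedAddCommGroup Y] [NormedSpace ℝ Y] [CompleteSpace Y]

/-! ### The constants in terms of the kernels -/

include 𝓡 in
theorem snorm_Q (y : Z) : P.snorm P.s₁ (𝓡.Q y) = ‖𝓡.E y‖ₑ := by
  rw [← 𝓡.Q_eq]
  exact posNorm_apply (𝓡.ι_injective.comp 𝓡.negPow_injective) _

theorem snorm_semigroup {s : ℝ} (hs : 0 < s) (x : X) :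
    P.snorm P.s₁ (P.S s x) = ‖𝓡.E (𝓡.R s x)‖ₑ := by
  rw [← 𝓡.R_eq s hs, 𝓡.snorm_Q]

theorem Cx_semigroup {s : ℝ} (hs : 0 < s) (x : X) : P.Cx (P.S s x) = 𝓡.c (𝓡.R s x) := by
  rw [← 𝓡.R_eq s hs, 𝓡.Cx_Q]

theorem lintegral_opKernel_E : ∫⁻ s in Ioi 0, 𝓡.opKernel 𝓡.E s = P.DA :=
  setLIntegral_congr_fun measurableSet_Ioi fun s hs => by
    simp only [opKernel, kernelOp_apply, 𝓡.snorm_semigroup hs]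

theorem lintegral_opKernel_c : ∫⁻ s in Ioi 0, 𝓡.opKernel 𝓡.c s = P.DH :=
  setLIntegral_congr_fun measurableSet_Ioi fun s hs => by
    simp only [opKernel, kernelOp_apply, 𝓡.Cx_semigroup hs]

theorem lintegral_vecKernel_b :
    ∫⁻ s in Ioi 0, 𝓡.vecKernel 𝓡.E ((1 / P.β) • P.b) s = P.DB :=
  setLIntegral_congr_fun measurableSet_Ioi fun s hs => by
    simp only [vecKernel, ← map_smul (P.S s), 𝓡.snorm_semigroup hs]

theorem lintegral_vecKernel_bd : ∫⁻ s in Ioi 0, 𝓡.vecKernel 𝓡.E (P.I₀ P.bd) s = P.DBd :=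
  setLIntegral_congr_fun measurableSet_Ioi fun s hs => by
    simp only [vecKernel, 𝓡.snorm_semigroup hs]

/-- The functional `β ℓ Q`. -/
def boundary : Z →L[ℝ] ℝ := P.β • 𝓡.ℓ.comp 𝓡.Q

/-- Expresses β ℓ(S(s)x) through R(s)x, so that K and K_d fall under the same kernel estimates as
the other constants. -/
theorem boundary_R {s : ℝ} (hs : 0 < s) (x : X) :
    𝓡.boundary (𝓡.R s x) = P.β * 𝓡.ℓ (P.S s x) := by
  rw [← 𝓡.R_eq s hs]; rfl

include hP in
theorem lintegral_boundary_b :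
    ∫⁻ s in Ioi 0, 𝓡.vecKernel 𝓡.boundary ((1 / P.β) • P.b) s = P.D :=
  setLIntegral_congr_fun measurableSet_Ioi fun s hs => by
    have := hP.β_pos.ne'
    simp only [vecKernel]
    rw [𝓡.boundary_R hs, map_smul, map_smul, 𝓡.K_eq, smul_eq_mul, one_div,
      mul_inv_cancel_left₀ this]

theorem lintegral_boundary_bd :
    ∫⁻ s in Ioi 0, 𝓡.vecKernel 𝓡.boundary (P.I₀ P.bd) s = P.Dd :=
  setLIntegral_congr_fun measurableSet_Ioi fun s hs => by
    simp only [vecKernel, 𝓡.boundary_R hs, 𝓡.Kd_eq]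

include hP 𝓡 in
theorem D_ne_top : P.D ≠ ⊤ :=
  𝓡.lintegral_boundary_b hP ▸ 𝓡.lintegral_ne_top_of_le (𝓡.exists_vecKernel_le _ _)

include 𝓡 in
theorem Dd_ne_top : P.Dd ≠ ⊤ :=
  𝓡.lintegral_boundary_bd ▸ 𝓡.lintegral_ne_top_of_le (𝓡.exists_vecKernel_le _ _)

include 𝓡 in
theorem DH_ne_top : P.DH ≠ ⊤ :=
  𝓡.lintegral_opKernel_c ▸ 𝓡.lintegral_ne_top_of_le (𝓡.exists_opKernel_le _)

include 𝓡 in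
theorem DB_ne_top : P.DB ≠ ⊤ :=
  𝓡.lintegral_vecKernel_b ▸ 𝓡.lintegral_ne_top_of_le (𝓡.exists_vecKernel_le _ _)

include 𝓡 in
theorem DBd_ne_top : P.DBd ≠ ⊤ :=
  𝓡.lintegral_vecKernel_bd ▸ 𝓡.lintegral_ne_top_of_le (𝓡.exists_vecKernel_le _ _)

-- K(t) = ℓ(S(t)b) tends to ℓ(b) = 1 as t ↓ 0, so |K| ≥ 1/2 on some interval.
include hP 𝓡 in
theorem D_pos : 0 < P.D := by
  have h1 : Tendsto (fun s => |P.K s|) (𝓝[>] 0) (𝓝 1) := by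
    have := ((𝓡.ℓ.continuous.tendsto _).comp (hP.semigroup_β.tendsto_zero P.b)).abs
    rw [𝓡.ℓ_b, abs_one] at this
    exact this.congr fun s => by rw [𝓡.K_eq]; rfl
  obtain ⟨η, hη, hs⟩ := mem_nhdsGT_iff_exists_Ioc_subset.1
    (h1.eventually (eventually_ge_nhds (show (1 / 2 : ℝ) < 1 by norm_num)))
  have hη : 0 < η := hη
  calc (0 : ℝ≥0∞) < ENNReal.ofReal (1 / 2) * ENNReal.ofReal η := by
        refine ENNReal.mul_pos ?_ ?_ <;> simp [hη]
    _ = ∫⁻ _ in Ioc 0 η, ENNReal.ofReal (1 / 2) := by simp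
    _ ≤ ∫⁻ s in Ioc 0 η, ‖P.K s‖ₑ := by
        refine setLIntegral_mono' measurableSet_Ioc fun s h => ?_
        rw [← ofReal_norm]
        exact ENNReal.ofReal_le_ofReal (hs h)
    _ ≤ P.D := lintegral_mono_set Ioc_subset_Ioi_self

/-! ### Asymptotic bounds -/

-- Integration by parts leaves a boundary term at t₀, which decays, and a convolution of ρ' with β
-- ℓ(S(s)x). This kernel is K for x = b/β and K_d for x = I₀ b_d.
include hP in
theorem limsup_sub_c_conv_le {t₀ : ℝ} {ρ ρ' : ℝ → ℝ} (hρ : ContinuousOn ρ (Ici t₀))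
    (hρ' : ContinuousOn ρ' (Ici t₀)) (hd : ∀ τ, t₀ < τ → HasDerivAt ρ (ρ' τ) τ)
    (hB : ∃ B : ℝ≥0∞, B ≠ ⊤ ∧ ∀ τ, t₀ ≤ τ → ‖ρ' τ‖ₑ ≤ B) {L : ℝ≥0∞}
    (hL : limsup (fun t => ‖ρ' t‖ₑ) atTop ≤ L) (x : X) :
    limsup (fun t => ‖P.β * 𝓡.ℓ x * ρ t - 𝓡.c (𝓡.conv t₀ (fun τ => ρ τ • x) t)‖ₑ) atTop ≤
      (∫⁻ s in Ioi 0, 𝓡.vecKernel 𝓡.boundary x s) * L := by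
  have h1 : limsup (fun t => ‖ρ t₀‖ₑ * ‖𝓡.boundary (𝓡.R (t - t₀) x)‖ₑ) atTop ≤ ‖ρ t₀‖ₑ * 0 :=
    ENNReal.limsup_const_mul_le enorm_ne_top
      (ENNReal.limsup_eq_zero_of_tendsto (𝓡.tendsto_R_apply _ _ _))
  have h2 := 𝓡.limsup_conv_le (𝓡.exists_vecKernel_le 𝓡.boundary x) hB rfl hL
  have h3 := ENNReal.limsup_add_le_of_le h1 h2
  rw [mul_zero, zero_add] at h3
  refine ENNReal.limsup_mono ?_ h3
  filter_upwards [eventually_gt_atTop t₀] with t ht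
  rw [𝓡.c_conv_smul hP ht hρ hρ' hd, sub_sub, sub_sub_cancel, ← 𝓡.boundary_R (sub_pos.2 ht),
    mul_comm _ (ρ t₀)]
  refine (enorm_add_le _ _).trans ?_
  rw [enorm_mul]
  gcongr
  refine (enorm_integral_mul_le ht.le _ _).trans (le_of_eq ?_)
  refine setLIntegral_congr_fun measurableSet_Ioc fun s hs => ?_
  simp only [vecKernel]
  rw [𝓡.boundary_R hs.1]

namespace IsTrajectory

variable {𝓡} {t₀ : ℝ} {x₀ : X} {F : ℝ → Z} {ρ δ : ℝ → ℝ} {v : ℝ → Z}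
  (h : 𝓡.IsTrajectory t₀ x₀ F ρ δ v)

include hP h

/-- The asymptotic bound for the state under the small gain condition. -/
theorem limsup_state_le {ε : ℝ≥0} (hε : ε * P.DA < 1)
    (hF : ∀ τ, t₀ ≤ τ → ‖F τ‖ₑ ≤ ε * ‖𝓡.E (v τ)‖ₑ)
    (hρ : ∃ B : ℝ≥0∞, B ≠ ⊤ ∧ ∀ τ, t₀ ≤ τ → ‖ρ τ‖ₑ ≤ B)
    (hδ : ∃ B : ℝ≥0∞, B ≠ ⊤ ∧ ∀ τ, t₀ ≤ τ → ‖δ τ‖ₑ ≤ B) {Lρ Lδ : ℝ≥0∞}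
    (hLρ : limsup (fun t => ‖ρ t‖ₑ) atTop ≤ Lρ) (hLδ : limsup (fun t => ‖δ t‖ₑ) atTop ≤ Lδ) :
    limsup (fun t => ‖𝓡.E (v t)‖ₑ) atTop ≤ (P.DBd * Lδ + P.DB * Lρ) / (1 - ε * P.DA) := by
  obtain ⟨Bρ, hBρ, hρ'⟩ := hρ
  obtain ⟨Bδ, hBδ, hδ'⟩ := hδ
  obtain ⟨B, hB, hv⟩ := h.exists_bound_of_small_gain hP (Φ := 𝓡.E)
    (by rwa [𝓡.lintegral_opKernel_E]) hF hBρ hBδ hρ' hδ'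
  set m := limsup (fun t => ‖𝓡.E (v t)‖ₑ) atTop with hm
  have hmB : m ≠ ⊤ := by
    refine ne_top_of_le_ne_top hB ((ENNReal.limsup_mono (v := fun _ => B) ?_ (limsup_const B).le))
    filter_upwards [eventually_ge_atTop t₀] with t ht using hv t ht
  have hLF : limsup (fun t => ‖F t‖ₑ) atTop ≤ ε * m :=
    ENNReal.limsup_mono (by filter_upwards [eventually_ge_atTop t₀] with t ht using hF t ht)
      (ENNReal.limsup_const_mul_le ENNReal.coe_ne_top hm.le)
  -- The limsup m reproduces itself with the factor ε D_{A_β} < 1; being finite, it can be solved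
  -- for.
  have h1 : m ≤ 0 + (P.DA * (ε * m) + (P.DBd * Lδ + P.DB * Lρ)) := by
    refine ENNReal.limsup_mono ?_ (ENNReal.limsup_add_le_of_le
      (ENNReal.limsup_eq_zero_of_tendsto (𝓡.tendsto_R_apply 𝓡.E x₀ t₀))
      (ENNReal.limsup_add_le_of_le (𝓡.limsup_conv_le (t₀ := t₀) (φ := fun τ => ‖F τ‖ₑ)
        (𝓡.exists_opKernel_le 𝓡.E)
        ⟨ε * B, ENNReal.mul_ne_top ENNReal.coe_ne_top hB, fun τ hτ => (hF τ hτ).trans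
          (mul_le_mul_right (hv τ hτ) _)⟩ 𝓡.lintegral_opKernel_E hLF)
      (ENNReal.limsup_add_le_of_le (𝓡.limsup_conv_le (t₀ := t₀) (φ := fun τ => ‖δ τ‖ₑ)
        (𝓡.exists_vecKernel_le 𝓡.E _) ⟨Bδ, hBδ, hδ'⟩ 𝓡.lintegral_vecKernel_bd hLδ)
        (𝓡.limsup_conv_le (t₀ := t₀) (φ := fun τ => ‖ρ τ‖ₑ)
        (𝓡.exists_vecKernel_le 𝓡.E _) ⟨Bρ, hBρ, hρ'⟩ 𝓡.lintegral_vecKernel_b hLρ))))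
    filter_upwards [eventually_gt_atTop t₀] with t ht using h.enorm_le hP 𝓡.E ht
  have hgap : 1 - ε * P.DA ≠ 0 := (tsub_pos_of_lt hε).ne'
  rw [ENNReal.le_div_iff_mul_le (Or.inl hgap) (Or.inl (ne_top_of_le_ne_top ENNReal.one_ne_top
    tsub_le_self)), ENNReal.mul_sub (fun _ _ => hmB), mul_one, tsub_le_iff_left]
  rw [zero_add, ← mul_assoc, mul_comm P.DA, mul_comm _ m] at h1
  exact h1

/-- The asymptotic bound for the output error `ρ - C y`; the driver `ρ` need not be
differentiable but is compared with the differentiable function `p`. -/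
theorem limsup_error_le {p p' δ' : ℝ → ℝ} (hp : ContinuousOn p (Ici t₀))
    (hp' : ContinuousOn p' (Ici t₀)) (hdp : ∀ τ, t₀ < τ → HasDerivAt p (p' τ) τ)
    (hδ' : ContinuousOn δ' (Ici t₀)) (hdδ : ∀ τ, t₀ < τ → HasDerivAt δ (δ' τ) τ)
    (hBp : ∃ B : ℝ≥0∞, B ≠ ⊤ ∧ ∀ τ, t₀ ≤ τ → ‖p' τ‖ₑ ≤ B)
    (hBδ : ∃ B : ℝ≥0∞, B ≠ ⊤ ∧ ∀ τ, t₀ ≤ τ → ‖δ' τ‖ₑ ≤ B)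
    (hBF : ∃ B : ℝ≥0∞, B ≠ ⊤ ∧ ∀ τ, t₀ ≤ τ → ‖F τ‖ₑ ≤ B)
    (hBρ : ∃ B : ℝ≥0∞, B ≠ ⊤ ∧ ∀ τ, t₀ ≤ τ → ‖ρ τ - p τ‖ₑ ≤ B) {Lp Lδ LF Lρ : ℝ≥0∞}
    (hLp : limsup (fun t => ‖p' t‖ₑ) atTop ≤ Lp) (hLδ : limsup (fun t => ‖δ' t‖ₑ) atTop ≤ Lδ)
    (hLF : limsup (fun t => ‖F t‖ₑ) atTop ≤ LF)
    (hLρ : limsup (fun t => ‖ρ t - p t‖ₑ) atTop ≤ Lρ) :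
    limsup (fun t => ‖ρ t - 𝓡.c (v t)‖ₑ) atTop ≤
      P.D * Lp + (P.Dd * Lδ + (P.DH * LF +
        (Lρ + (∫⁻ s in Ioi 0, 𝓡.vecKernel 𝓡.c ((1 / P.β) • P.b) s) * Lρ))) := by
  have hβ := hP.β_pos.ne'
  have hdc : ContinuousOn (fun τ => ρ τ - p τ) (Ici t₀) := h.ρ_cont.sub hp
  have a1 := 𝓡.limsup_sub_c_conv_le hP hp hp' hdp hBp hLp ((1 / P.β) • P.b)
  rw [𝓡.lintegral_boundary_b hP] at a1
  have a2 := 𝓡.limsup_sub_c_conv_le hP h.δ_cont hδ' hdδ hBδ hLδ (P.I₀ P.bd)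
  rw [𝓡.lintegral_boundary_bd] at a2
  have a3 := 𝓡.limsup_conv_le (t₀ := t₀) (φ := fun τ => ‖F τ‖ₑ) (𝓡.exists_opKernel_le 𝓡.c) hBF
    𝓡.lintegral_opKernel_c hLF
  -- ρ − p cannot be integrated by parts. A crude finite constant suffices, since in the application
  -- p tends to ρ.
  have a4 := 𝓡.limsup_conv_le (t₀ := t₀) (φ := fun τ => ‖ρ τ - p τ‖ₑ)
    (𝓡.exists_vecKernel_le 𝓡.c ((1 / P.β) • P.b)) hBρ rfl hLρ
  have a5 := ENNReal.limsup_eq_zero_of_tendsto (𝓡.tendsto_R_apply 𝓡.c x₀ t₀)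
  have a6 := ENNReal.limsup_add_le_of_le a1 (ENNReal.limsup_add_le_of_le a2
    (ENNReal.limsup_add_le_of_le (ENNReal.limsup_add_le_of_le a3 a5)
      (ENNReal.limsup_add_le_of_le hLρ a4)))
  rw [add_zero] at a6
  refine ENNReal.limsup_mono ?_ a6
  filter_upwards [eventually_gt_atTop t₀] with t ht
  have hpc : ContinuousOn (fun τ => p τ • ((1 / P.β) • P.b)) (Ici t₀) := hp.smul continuousOn_const
  have hdc' : ContinuousOn (fun τ => (ρ τ - p τ) • ((1 / P.β) • P.b)) (Ici t₀) :=
    hdc.smul continuousOn_const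
  have e1 : 𝓡.conv t₀ (fun τ => ρ τ • ((1 / P.β) • P.b)) t =
      𝓡.conv t₀ (fun τ => p τ • ((1 / P.β) • P.b)) t +
        𝓡.conv t₀ (fun τ => (ρ τ - p τ) • ((1 / P.β) • P.b)) t := by
    rw [← 𝓡.conv_add hP ht.le hpc hdc']
    congr 1
    funext τ
    rw [← add_smul, add_sub_cancel]
  -- Here β ℓ(b/β) = 1 matches the term p(t), while ℓ(I₀ b_d) = 0 removes δ(t).
  have e2 : ρ t - 𝓡.c (v t) =
      (P.β * 𝓡.ℓ ((1 / P.β) • P.b) * p t -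
        𝓡.c (𝓡.conv t₀ (fun τ => p τ • ((1 / P.β) • P.b)) t)) +
      ((P.β * 𝓡.ℓ (P.I₀ P.bd) * δ t - 𝓡.c (𝓡.conv t₀ (fun τ => δ τ • P.I₀ P.bd) t)) +
      ((-𝓡.c (𝓡.conv t₀ (fun τ => P.I₀ (P.ι (F τ))) t) + -𝓡.c (𝓡.R (t - t₀) x₀)) +
      ((ρ t - p t) + -𝓡.c (𝓡.conv t₀ (fun τ => (ρ τ - p τ) • ((1 / P.β) • P.b)) t)))) := by
    rw [h.decomposition hP ht, e1, 𝓡.ℓ_I₀, map_smul, 𝓡.ℓ_b, smul_eq_mul, mul_one,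
      mul_one_div_cancel hβ]
    simp only [map_add]
    ring
  rw [e2]
  refine (enorm_add_le _ _).trans (add_le_add le_rfl ?_)
  refine (enorm_add_le _ _).trans (add_le_add le_rfl ?_)
  refine (enorm_add_le _ _).trans (add_le_add ?_ ?_)
  · refine (enorm_add_le _ _).trans (add_le_add ?_ ?_)
    · rw [enorm_neg]
      exact 𝓡.enorm_conv_op_le hP 𝓡.c ht.le h.F_cont
    · rw [enorm_neg]
  · refine (enorm_add_le _ _).trans (add_le_add le_rfl ?_)
    rw [enorm_neg]
    exact 𝓡.enorm_conv_vec_le hP 𝓡.c ht.le hdc _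

end IsTrajectory

end RegulatedSystem.Realization

end

noncomputable section

/-! ### Difference quotients and averages -/

theorem exists_enorm_quotient_eq {f f' : ℝ → ℝ} {t h : ℝ} (hh : 0 < h)
    (hf : ∀ τ, t ≤ τ → HasDerivAt f (f' τ) τ) :
    ∃ ξ, t < ξ ∧ ‖h⁻¹ * (f (t + h) - f t)‖ₑ = ‖f' ξ‖ₑ := by
  obtain ⟨ξ, hξ, h1⟩ := exists_hasDerivAt_eq_slope f f' (lt_add_of_pos_right t hh)
    (fun τ hτ => (hf τ hτ.1).continuousAt.continuousWithinAt) fun τ hτ => hf τ hτ.1.le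
  refine ⟨ξ, hξ.1, ?_⟩
  rw [h1, add_sub_cancel_left, div_eq_inv_mul]

theorem limsup_quotient_le {f f' : ℝ → ℝ} {t₀ h : ℝ} (hh : 0 < h)
    (hf : ∀ τ, t₀ ≤ τ → HasDerivAt f (f' τ) τ) {L : ℝ≥0∞}
    (hL : limsup (fun t => ‖f' t‖ₑ) atTop ≤ L) :
    limsup (fun t => ‖h⁻¹ * (f (t + h) - f t)‖ₑ) atTop ≤ L := by
  rw [ENNReal.limsup_le_iff_forall_pos] at hL ⊢
  intro δ hδ
  obtain ⟨T, hT⟩ := eventually_atTop.1 (hL δ hδ)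
  filter_upwards [eventually_ge_atTop T, eventually_ge_atTop t₀] with t h1 h2
  obtain ⟨ξ, hξ, he⟩ := exists_enorm_quotient_eq hh fun τ hτ => hf τ (h2.trans hτ)
  rw [he]
  exact hT ξ (h1.trans hξ.le)

/-- The average of `e` over `[t, t + h]`. -/
def movingAverage (h : ℝ) (e : ℝ → ℝ) (t : ℝ) : ℝ := h⁻¹ * ∫ s in t..(t + h), e s

theorem hasDerivAt_movingAverage {e : ℝ → ℝ} (he : Continuous e) (h t : ℝ) :
    HasDerivAt (movingAverage h e) (h⁻¹ * (e (t + h) - e t)) t := by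
  have h1 : ∀ x, HasDerivAt (fun y => ∫ s in (0 : ℝ)..y, e s) (e x) x := fun x =>
    intervalIntegral.integral_hasDerivAt_right (he.intervalIntegrable _ _)
      (he.stronglyMeasurableAtFilter _ _) he.continuousAt
  have h2 : movingAverage h e = fun t => h⁻¹ * ((∫ s in (0 : ℝ)..(t + h), e s) -
      ∫ s in (0 : ℝ)..t, e s) := by
    funext t
    rw [movingAverage, intervalIntegral.integral_interval_sub_left (he.intervalIntegrable _ _)
      (he.intervalIntegrable _ _)]
  rw [h2]
  exact (((h1 (t + h)).comp_add_const t h).sub (h1 t)).const_mul _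

theorem enorm_sub_movingAverage_le {e : ℝ → ℝ} (he : Continuous e) {h : ℝ} (hh : 0 < h) (t : ℝ) :
    ‖e t - movingAverage h e t‖ₑ ≤
      ENNReal.ofReal h⁻¹ * ∫⁻ s in Ioc 0 h, ‖e (t + s) - e t‖ₑ := by
  have h1 : e t - movingAverage h e t = -(h⁻¹ * ∫ s in (0 : ℝ)..h, (e (t + s) - e t)) := by
    have h2 : ∫ s in (0 : ℝ)..h, e (t + s) = ∫ s in t..(t + h), e s := by
      rw [intervalIntegral.integral_comp_add_left, add_zero]
    have h3 : Continuous fun s => e (t + s) := by fun_prop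
    rw [intervalIntegral.integral_sub (h3.intervalIntegrable _ _)
      (continuous_const.intervalIntegrable _ _), h2, movingAverage,
      intervalIntegral.integral_const, smul_eq_mul, sub_zero]
    field_simp
    ring
  rw [h1, enorm_neg, enorm_mul, Real.enorm_eq_ofReal (inv_nonneg.2 hh.le),
    intervalIntegral.integral_of_le hh.le]
  gcongr
  exact enorm_integral_le_lintegral_enorm _

/-- The difference is a mean of increments e(t+s) − e(t), each asymptotically at most s L. These
bounds are not uniform in s, which is why the reverse Fatou lemma is needed. -/
theorem limsup_sub_movingAverage_le {e : ℝ → ℝ} (he : Continuous e) {t₀ : ℝ}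
    (hB : ∃ B : ℝ≥0∞, B ≠ ⊤ ∧ ∀ τ, t₀ ≤ τ → ‖e τ‖ₑ ≤ B) {L : ℝ≥0∞}
    (hL : ∀ h, 0 < h → limsup (fun t => ‖h⁻¹ * (e (t + h) - e t)‖ₑ) atTop ≤ L)
    {h : ℝ} (hh : 0 < h) :
    limsup (fun t => ‖e t - movingAverage h e t‖ₑ) atTop ≤ L * ENNReal.ofReal h := by
  obtain ⟨B, hB, heB⟩ := hB
  have h1 : limsup (fun t => ∫⁻ s in Ioc 0 h, ‖e (t + s) - e t‖ₑ) atTop ≤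
      (ENNReal.ofReal h * L) * ENNReal.ofReal h := by
    refine limsup_setLIntegral_le (B := B + B) (T := t₀) (ENNReal.add_ne_top.2 ⟨hB, hB⟩)
      (fun t => ?_) (fun t ht s hs => ?_) fun s hs => ?_
    · exact ((he.comp (by fun_prop)).sub continuous_const).enorm.measurable
    · exact (enorm_sub_le).trans (add_le_add (heB _ (by linarith)) (heB _ ht))
    · have h2 := ENNReal.limsup_const_mul_le (c := ENNReal.ofReal s) ENNReal.ofReal_ne_top
        (hL s hs.1)
      refine ENNReal.limsup_mono (Eventually.of_forall fun t => ?_) (h2.trans ?_)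
      · rw [← Real.enorm_eq_ofReal hs.1.le, ← enorm_mul, mul_inv_cancel_left₀ hs.1.ne']
      · gcongr
        exact hs.2
  have h3 := ENNReal.limsup_const_mul_le (c := ENNReal.ofReal h⁻¹) ENNReal.ofReal_ne_top h1
  refine ENNReal.limsup_mono
    (Eventually.of_forall fun t => enorm_sub_movingAverage_le he hh t) (h3.trans (le_of_eq ?_))
  rw [← mul_assoc, ← mul_assoc, ← ENNReal.ofReal_mul (inv_nonneg.2 hh.le),
    inv_mul_cancel₀ hh.ne', ENNReal.ofReal_one, one_mul]

/-! ### Errors under differentiable and under merely continuous drivers -/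

variable {Z X : Type*} [NormedAddCommGroup Z] [InnerProductSpace ℝ Z] [CompleteSpace Z]
  [NormedAddCommGroup X] [NormedSpace ℝ X] [CompleteSpace X]

namespace RegulatedSystem.Realization

variable {P : RegulatedSystem Z X} (hP : P.Standing) (𝓡 : P.Realization)

include hP in
theorem conv_smul_sub {t₀ t : ℝ} (ht : t₀ ≤ t) {g h : ℝ → X} (hg : ContinuousOn g (Ici t₀))
    (hh : ContinuousOn h (Ici t₀)) (a : ℝ) :
    𝓡.conv t₀ (fun τ => a • (g τ - h τ)) t = a • (𝓡.conv t₀ g t - 𝓡.conv t₀ h t) := by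
  unfold conv
  rw [← intervalIntegral.integral_sub (𝓡.intervalIntegrable_conv hP ht hg)
    (𝓡.intervalIntegrable_conv hP ht hh), ← intervalIntegral.integral_smul]
  simp only [map_smul, map_sub]

include 𝓡 in
theorem continuousOn_forcing {s : Set ℝ} {F : ℝ → Z} {ρ δ : ℝ → ℝ} (hF : ContinuousOn F s)
    (hρ : ContinuousOn ρ s) (hδ : ContinuousOn δ s) : ContinuousOn
      (fun τ => P.I₀ (P.ι (F τ) + δ τ • P.bd) + (1 / P.β) • (ρ τ • P.b)) s := by
  have h1 : ContinuousOn (fun τ => 𝓡.I₀L (P.ι (F τ) + δ τ • P.bd) + (1 / P.β) • (ρ τ • P.b)) s :=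
    (𝓡.I₀L.continuous.comp_continuousOn ((P.ι.continuous.comp_continuousOn hF).add
      (hδ.smul continuousOn_const))).add ((hρ.smul continuousOn_const).const_smul _)
  exact h1.congr fun τ _ => by simp only [𝓡.I₀L_apply]

namespace IsTrajectory

variable {𝓡} {t₀ : ℝ} {x₀ : X} {F : ℝ → Z} {ρ δ : ℝ → ℝ} {v : ℝ → Z}

theorem shift {h : ℝ} (H : 𝓡.IsTrajectory (t₀ + h) x₀ F ρ δ v) :
    𝓡.IsTrajectory t₀ x₀ (fun τ => F (τ + h)) (fun τ => ρ (τ + h)) (fun τ => δ (τ + h))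
      (fun τ => v (τ + h)) := by
  have hm : MapsTo (fun τ => τ + h) (Ici t₀) (Ici (t₀ + h)) := fun τ hτ =>
    add_le_add_left (mem_Ici.1 hτ) h
  have hc : ContinuousOn (fun τ : ℝ => τ + h) (Ici t₀) := by fun_prop
  refine ⟨H.F_cont.comp hc hm, H.ρ_cont.comp hc hm, H.δ_cont.comp hc hm, H.v_cont.comp hc hm,
    fun t ht => ?_⟩
  rw [H.eq (t + h) (by linarith), conv, conv, add_sub_add_right_eq_sub]
  simp only [sub_add_eq_add_sub]

-- Combined with `shift`, this makes difference quotients of trajectories trajectories again, driven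
-- by the quotients of F, ρ and δ.
include hP in
theorem smul_sub {x₁ : X} {F₁ : ℝ → Z} {ρ₁ δ₁ : ℝ → ℝ} {v₁ : ℝ → Z}
    (H₁ : 𝓡.IsTrajectory t₀ x₁ F₁ ρ₁ δ₁ v₁) (H : 𝓡.IsTrajectory t₀ x₀ F ρ δ v) (a : ℝ) :
    𝓡.IsTrajectory t₀ (a • (x₁ - x₀)) (fun τ => a • (F₁ τ - F τ)) (fun τ => a * (ρ₁ τ - ρ τ))
      (fun τ => a * (δ₁ τ - δ τ)) (fun τ => a • (v₁ τ - v τ)) := by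
  refine ⟨(H₁.F_cont.sub H.F_cont).const_smul a, continuousOn_const.mul (H₁.ρ_cont.sub H.ρ_cont),
    continuousOn_const.mul (H₁.δ_cont.sub H.δ_cont), (H₁.v_cont.sub H.v_cont).const_smul a,
    fun t ht => ?_⟩
  have e : (fun τ => P.I₀ (P.ι (a • (F₁ τ - F τ)) + (a * (δ₁ τ - δ τ)) • P.bd) +
      (1 / P.β) • ((a * (ρ₁ τ - ρ τ)) • P.b)) = fun τ => a •
      ((P.I₀ (P.ι (F₁ τ) + δ₁ τ • P.bd) + (1 / P.β) • (ρ₁ τ • P.b)) -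
        (P.I₀ (P.ι (F τ) + δ τ • P.bd) + (1 / P.β) • (ρ τ • P.b))) := by
    funext τ
    simp only [← 𝓡.I₀L_apply, map_add, map_smul, map_sub]
    module
  rw [e, 𝓡.conv_smul_sub hP ht.le (𝓡.continuousOn_forcing H₁.F_cont H₁.ρ_cont H₁.δ_cont)
    (𝓡.continuousOn_forcing H.F_cont H.ρ_cont H.δ_cont), H₁.eq t ht, H.eq t ht, map_smul, map_sub]
  module

/-- The left side is the nonlinear contribution to the error: the asymptotic state bound, multiplied
by ε and passed through D_H. -/
theorem gain_mul_eq (P : RegulatedSystem Z X) (Lr Ld : ℝ≥0∞) :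
    P.DH * (P.ε * ((P.DBd * Ld + P.DB * Lr) / (1 - P.ε * P.DA))) =
      P.calDd * Ld + P.calD * Lr := by
  simp only [calD, calDd, div_eq_mul_inv]
  ring

include hP in
/-- The error of a trajectory with continuously differentiable driving signals. -/
theorem limsup_error_le_of_deriv (H : 𝓡.IsTrajectory t₀ x₀ F ρ δ v) (hε : P.ε * P.DA < 1)
    (hF : ∀ τ, t₀ ≤ τ → ‖F τ‖ₑ ≤ P.ε * ‖𝓡.E (v τ)‖ₑ) {ρ' δ' : ℝ → ℝ}
    (hρ' : ContinuousOn ρ' (Ici t₀)) (hdρ : ∀ τ, t₀ < τ → HasDerivAt ρ (ρ' τ) τ)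
    (hδ' : ContinuousOn δ' (Ici t₀)) (hdδ : ∀ τ, t₀ < τ → HasDerivAt δ (δ' τ) τ)
    (hBρ : ∃ B : ℝ≥0∞, B ≠ ⊤ ∧ ∀ τ, t₀ ≤ τ → ‖ρ τ‖ₑ ≤ B)
    (hBδ : ∃ B : ℝ≥0∞, B ≠ ⊤ ∧ ∀ τ, t₀ ≤ τ → ‖δ τ‖ₑ ≤ B)
    (hBρ' : ∃ B : ℝ≥0∞, B ≠ ⊤ ∧ ∀ τ, t₀ ≤ τ → ‖ρ' τ‖ₑ ≤ B)
    (hBδ' : ∃ B : ℝ≥0∞, B ≠ ⊤ ∧ ∀ τ, t₀ ≤ τ → ‖δ' τ‖ₑ ≤ B) {Lr Ld : ℝ≥0∞}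
    (hρL : limsup (fun t => ‖ρ t‖ₑ) atTop ≤ Lr) (hδL : limsup (fun t => ‖δ t‖ₑ) atTop ≤ Ld)
    (hρL' : limsup (fun t => ‖ρ' t‖ₑ) atTop ≤ Lr) (hδL' : limsup (fun t => ‖δ' t‖ₑ) atTop ≤ Ld) :
    (∃ B : ℝ≥0∞, B ≠ ⊤ ∧ ∀ τ, t₀ ≤ τ → ‖F τ‖ₑ ≤ B) ∧
    limsup (fun t => ‖ρ t - 𝓡.c (v t)‖ₑ) atTop ≤
      (P.D + P.calD) * Lr + (P.Dd + P.calDd) * Ld := by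
  have h1 := H.limsup_state_le hP hε hF hBρ hBδ hρL hδL
  have h2 : limsup (fun t => ‖F t‖ₑ) atTop ≤ _ :=
    ENNReal.limsup_mono (by filter_upwards [eventually_ge_atTop t₀] with t ht using hF t ht)
      (ENNReal.limsup_const_mul_le ENNReal.coe_ne_top h1)
  have hBF : ∃ B : ℝ≥0∞, B ≠ ⊤ ∧ ∀ τ, t₀ ≤ τ → ‖F τ‖ₑ ≤ B := by
    obtain ⟨Bρ, b1, b2⟩ := hBρ
    obtain ⟨Bδ, b3, b4⟩ := hBδ
    obtain ⟨B, hB, hv⟩ := H.exists_bound_of_small_gain hP (Φ := 𝓡.E)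
      (by rwa [𝓡.lintegral_opKernel_E]) hF b1 b3 b2 b4
    exact ⟨P.ε * B, ENNReal.mul_ne_top ENNReal.coe_ne_top hB, fun τ hτ => (hF τ hτ).trans
      (mul_le_mul_right (hv τ hτ) _)⟩
  refine ⟨hBF, ?_⟩
  have h3 := H.limsup_error_le hP H.ρ_cont hρ' hdρ hδ' hdδ hBρ' hBδ' hBF
    ⟨0, ENNReal.zero_ne_top, fun τ _ => by simp⟩ hρL' hδL' h2 (Lρ := 0) (by simp)
  refine h3.trans (le_of_eq ?_)
  rw [gain_mul_eq]
  ring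

include hP in
/-- The error of a trajectory driven by a continuous signal without disturbance. -/
theorem limsup_error_le_of_quotient (H : 𝓡.IsTrajectory t₀ x₀ F ρ (fun _ => 0) v)
    (hε : P.ε * P.DA < 1) (hF : ∀ τ, t₀ ≤ τ → ‖F τ‖ₑ ≤ P.ε * ‖𝓡.E (v τ)‖ₑ)
    (hBρ : ∃ B : ℝ≥0∞, B ≠ ⊤ ∧ ∀ τ, t₀ ≤ τ → ‖ρ τ‖ₑ ≤ B) {L : ℝ≥0∞} (hLt : L ≠ ⊤)
    (hL : limsup (fun t => ‖ρ t‖ₑ) atTop ≤ L)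
    (hLq : ∀ h, 0 < h → limsup (fun t => ‖h⁻¹ * (ρ (t + h) - ρ t)‖ₑ) atTop ≤ L) :
    limsup (fun t => ‖ρ t - 𝓡.c (v t)‖ₑ) atTop ≤ (P.D + P.calD) * L := by
  have hB0 : ∃ B : ℝ≥0∞, B ≠ ⊤ ∧ ∀ τ, t₀ ≤ τ → ‖(0 : ℝ)‖ₑ ≤ B :=
    ⟨0, ENNReal.zero_ne_top, fun τ _ => by simp⟩
  have hL0 : limsup (fun _ : ℝ => ‖(0 : ℝ)‖ₑ) atTop ≤ 0 := by simp
  have h1 := H.limsup_state_le hP hε hF hBρ hB0 hL hL0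
  have h2 : limsup (fun t => ‖F t‖ₑ) atTop ≤ _ :=
    ENNReal.limsup_mono (by filter_upwards [eventually_ge_atTop t₀] with t ht using hF t ht)
      (ENNReal.limsup_const_mul_le ENNReal.coe_ne_top h1)
  obtain ⟨Bρ, b1, b2⟩ := hBρ
  have hBF : ∃ B : ℝ≥0∞, B ≠ ⊤ ∧ ∀ τ, t₀ ≤ τ → ‖F τ‖ₑ ≤ B := by
    obtain ⟨Bδ, b3, b4⟩ := hB0
    obtain ⟨B, hB, hv⟩ := H.exists_bound_of_small_gain hP (Φ := 𝓡.E)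
      (by rwa [𝓡.lintegral_opKernel_E]) hF b1 b3 b2 b4
    exact ⟨P.ε * B, ENNReal.mul_ne_top ENNReal.coe_ne_top hB, fun τ hτ => (hF τ hτ).trans
      (mul_le_mul_right (hv τ hτ) _)⟩
  -- Continuous extension to the left of t₀, so that the moving average is differentiable
  -- everywhere.
  set e : ℝ → ℝ := fun τ => ρ (max τ t₀) with he_def
  have he : Continuous e := by
    refine H.ρ_cont.comp_continuous (by fun_prop) fun τ => mem_Ici.2 (le_max_right _ _)
  have heρ : ∀ τ, t₀ ≤ τ → e τ = ρ τ := fun τ hτ => by simp [he_def, hτ]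
  have hBe : ∀ τ, ‖e τ‖ₑ ≤ Bρ := fun τ => b2 _ (le_max_right _ _)
  have hLe : ∀ h, 0 < h → limsup (fun t => ‖h⁻¹ * (e (t + h) - e t)‖ₑ) atTop ≤ L := by
    intro h hh
    refine ENNReal.limsup_mono ?_ (hLq h hh)
    filter_upwards [eventually_ge_atTop t₀] with t ht
    rw [heρ t ht, heρ _ (by linarith)]
  set κ := ∫⁻ s in Ioi 0, 𝓡.vecKernel 𝓡.c ((1 / P.β) • P.b) s with hκ
  have hκt : κ ≠ ⊤ := 𝓡.lintegral_ne_top_of_le (𝓡.exists_vecKernel_le _ _)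
  -- The comparison function is the moving average: its derivative is a difference quotient,
  -- asymptotically at most L, and its distance to ρ is at most L h. The excess (1+κ) L h vanishes
  -- as h → 0 because κ and L are finite.
  have key : ∀ h : ℝ, 0 < h → limsup (fun t => ‖ρ t - 𝓡.c (v t)‖ₑ) atTop ≤
      (P.D + P.calD) * L + (1 + κ) * L * ENNReal.ofReal h := by
    intro h hh
    have hd := fun τ => hasDerivAt_movingAverage he h τ
    have hqc : Continuous fun τ => h⁻¹ * (e (τ + h) - e τ) := by fun_prop
    have hLav : limsup (fun t => ‖ρ t - movingAverage h e t‖ₑ) atTop ≤ L * ENNReal.ofReal h := by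
      refine ENNReal.limsup_mono ?_ (limsup_sub_movingAverage_le he (t₀ := t₀)
        ⟨Bρ, b1, fun τ _ => hBe τ⟩ hLe hh)
      filter_upwards [eventually_ge_atTop t₀] with t ht
      rw [heρ t ht]
    have hB2 : ∀ τ, ∀ s, ‖e (τ + s) - e τ‖ₑ ≤ Bρ + Bρ := fun τ s =>
      enorm_sub_le.trans (add_le_add (hBe _) (hBe _))
    have h2B : Bρ + Bρ ≠ ⊤ := ENNReal.add_ne_top.2 ⟨b1, b1⟩
    have h3 := H.limsup_error_le hP (p := movingAverage h e)
      (continuous_iff_continuousAt.2 fun τ => (hd τ).continuousAt).continuousOn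
      hqc.continuousOn (fun τ _ => hd τ) (δ' := fun _ => 0) continuousOn_const
      (fun τ _ => hasDerivAt_const τ 0)
      ⟨‖h⁻¹‖ₑ * (Bρ + Bρ), ENNReal.mul_ne_top enorm_ne_top h2B, fun τ _ => by
        rw [enorm_mul]
        gcongr
        exact hB2 τ h⟩ hB0 hBF
      ⟨ENNReal.ofReal h⁻¹ * ((Bρ + Bρ) * ENNReal.ofReal h), ENNReal.mul_ne_top
        ENNReal.ofReal_ne_top (ENNReal.mul_ne_top h2B ENNReal.ofReal_ne_top), fun τ hτ => by
        rw [← heρ τ hτ]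
        refine (enorm_sub_movingAverage_le he hh τ).trans ?_
        gcongr
        refine (setLIntegral_mono' measurableSet_Ioc fun s _ => hB2 τ s).trans (le_of_eq ?_)
        simp⟩
      (hLe h hh) hL0 h2 hLav
    refine h3.trans (le_of_eq ?_)
    rw [gain_mul_eq]
    ring
  have ht : Tendsto (fun h : ℝ => (P.D + P.calD) * L + (1 + κ) * L * ENNReal.ofReal h) (𝓝[>] 0)
      (𝓝 ((P.D + P.calD) * L + (1 + κ) * L * ENNReal.ofReal 0)) := by
    refine Tendsto.mono_left ?_ nhdsWithin_le_nhds
    refine tendsto_const_nhds.add (ENNReal.Tendsto.const_mul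
      (ENNReal.continuous_ofReal.tendsto 0) (Or.inr ?_))
    exact ENNReal.mul_ne_top (ENNReal.add_ne_top.2 ⟨ENNReal.one_ne_top, hκt⟩) hLt
  rw [ENNReal.ofReal_zero, mul_zero, add_zero] at ht
  exact ge_of_tendsto ht (by filter_upwards [self_mem_nhdsWithin] with h hh using key h hh)

end IsTrajectory

end RegulatedSystem.Realization

end

noncomputable section

/-! ### Signals -/

namespace IsCb

variable {N : ℕ} {φ : ℝ → ℝ} (h : IsCb N φ)

include h

theorem continuousOn {j : ℕ} (hj : j ≤ N) :
    ContinuousOn (iteratedDerivWithin j φ (Ici 0)) (Ici 0) :=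
  h.1.continuousOn_iteratedDerivWithin (by exact_mod_cast hj) (uniqueDiffOn_Ici 0)

theorem hasDerivAt {j : ℕ} (hj : j < N) {t : ℝ} (ht : 0 < t) :
    HasDerivAt (iteratedDerivWithin j φ (Ici 0)) (iteratedDerivWithin (j + 1) φ (Ici 0) t) t := by
  have h1 := (h.1.differentiableOn_iteratedDerivWithin (m := j) (by exact_mod_cast hj)
    (uniqueDiffOn_Ici 0) t ht.le).hasDerivWithinAt.hasDerivAt (Ici_mem_nhds ht)
  rwa [← iteratedDerivWithin_succ] at h1

theorem exists_enorm_le : ∃ B : ℝ≥0∞, B ≠ ⊤ ∧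
    ∀ j ≤ N, ∀ t : ℝ, 0 ≤ t → ‖iteratedDerivWithin j φ (Ici 0) t‖ₑ ≤ B := by
  obtain ⟨M, hM⟩ := h.2
  refine ⟨ENNReal.ofReal M, ENNReal.ofReal_ne_top, fun j hj t ht => ?_⟩
  rw [← ofReal_norm]
  exact ENNReal.ofReal_le_ofReal (hM j hj t ht)

theorem limsupNorm_ne_top : limsupNorm N φ ≠ ⊤ := by
  obtain ⟨B, hB, hb⟩ := h.exists_enorm_le
  refine ne_top_of_le_ne_top hB (ENNReal.limsup_mono (v := fun _ => B) ?_ (limsup_const B).le)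
  filter_upwards [eventually_ge_atTop 0] with t ht
  exact Finset.sup_le fun j hj => hb j (Nat.lt_succ_iff.1 (Finset.mem_range.1 hj)) t ht

omit h in
theorem limsup_le {j : ℕ} (hj : j ≤ N) :
    limsup (fun t => ‖iteratedDerivWithin j φ (Ici 0) t‖ₑ) atTop ≤ limsupNorm N φ :=
  ENNReal.limsup_mono (Eventually.of_forall fun t =>
    Finset.le_sup (f := fun j => ‖iteratedDerivWithin j φ (Ici 0) t‖ₑ)
      (Finset.mem_range.2 (Nat.lt_succ_iff.2 hj))) le_rfl

end IsCb

variable {Z X : Type*} [NormedAddCommGroup Z] [InnerProductSpace ℝ Z] [CompleteSpace Z]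
  [NormedAddCommGroup X] [NormedSpace ℝ X] [CompleteSpace X]

namespace RegulatedSystem

variable {P : RegulatedSystem Z X} (hP : P.Standing)

/-! ### Mild solutions as trajectories -/

include hP in
theorem Standing.enorm_f_sub_le (𝓡 : P.Realization) (a b : Z) :
    ‖P.f (negPow P.T P.s₁ a) - P.f (negPow P.T P.s₁ b)‖ₑ ≤ P.ε * ‖a - b‖ₑ := by
  refine (hP.f_lipschitz (negPow P.T P.s₁ a) (negPow P.T P.s₁ b) ⟨a, rfl⟩ ⟨b, rfl⟩).trans
    (le_of_eq ?_)
  rw [← map_sub, snorm, posNorm_apply (𝓡.ι_injective.comp 𝓡.negPow_injective)]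

include hP in
theorem Standing.continuous_f (𝓡 : P.Realization) :
    Continuous fun y => P.f (negPow P.T P.s₁ y) := by
  refine LipschitzWith.continuous (K := P.ε) fun a b => ?_
  rw [edist_eq_enorm_sub, edist_eq_enorm_sub]
  exact hP.enorm_f_sub_le 𝓡 a b

/-- These coordinates come straight from the definition of a mild solution. They make f(z(t))
continuous, which must be known before the representation by `R` applies. -/
theorem IsMildSolution.exists_continuousOn (𝓡 : P.Realization) {z₀ : Z} {g : ℝ → X} {z : ℝ → Z}
    (hz : P.IsMildSolution z₀ g z) :
    ∃ u : ℝ → Z, ContinuousOn u (Ioi 0) ∧ ∀ t, 0 < t → z t = negPow P.T P.s₁ (u t) := by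
  have h1 : ∀ t, ∃ y : Z, 0 < t → z t = negPow P.T P.s₁ y := by
    intro t
    by_cases ht : 0 < t
    · obtain ⟨y, hy⟩ := hz.mem t ht
      exact ⟨y, fun _ => (𝓡.ι_injective hy).symm⟩
    · exact ⟨0, fun h => absurd h ht⟩
  choose u hu using h1
  refine ⟨u, fun t ht => ContinuousAt.continuousWithinAt ?_, hu⟩
  have ht : 0 < t := ht
  rw [ContinuousAt, tendsto_iff_edist_tendsto_0]
  refine (hz.continuous t ht).congr' ?_
  filter_upwards [Ioi_mem_nhds ht] with τ hτ
  rw [hu τ hτ, hu t ht, ← map_sub, snorm,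
    posNorm_apply (𝓡.ι_injective.comp 𝓡.negPow_injective), edist_eq_enorm_sub]

include hP in
theorem IsMildSolution.exists_isTrajectory (𝓡 : P.Realization) {z₀ : Z} {z : ℝ → Z} {F : ℝ → Z}
    {ρ δ : ℝ → ℝ} (hz : P.IsMildSolution z₀
      (fun τ => P.I₀ (P.ι (F τ) + δ τ • P.bd) + (1 / P.β) • (ρ τ • P.b)) z)
    (hF : ContinuousOn F (Ioi 0)) (hρ : ContinuousOn ρ (Ioi 0)) (hδ : ContinuousOn δ (Ioi 0)) :
    ∃ v : ℝ → Z, ContinuousOn v (Ioi 0) ∧ (∀ t, 0 < t → z t = negPow P.T P.s₁ (𝓡.E (v t))) ∧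
      (∀ t, 0 < t → P.Cx (P.ι (z t)) = 𝓡.c (v t)) ∧
      ∀ t₀, 0 < t₀ → 𝓡.IsTrajectory t₀ (P.ι (z t₀)) F ρ δ v := by
  obtain ⟨v, hv, hQ, hvt⟩ := 𝓡.exists_representation hP hz (𝓡.continuousOn_forcing hF hρ hδ)
  refine ⟨v, hv, fun t ht => 𝓡.ι_injective ?_, fun t ht => ?_, fun t₀ ht₀ => ?_⟩
  · rw [𝓡.Q_eq, hQ t ht]
  · rw [← hQ t ht, 𝓡.Cx_Q]
  · have hs : Ici t₀ ⊆ Ioi 0 := Ici_subset_Ioi.2 ht₀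
    exact ⟨hF.mono hs, hρ.mono hs, hδ.mono hs, hv.mono hs, fun t ht => hvt t₀ t ht₀ ht⟩

/-! ### The first iteration -/

include hP in
/-- The error of the first iteration and its difference quotients. -/
theorem IsStepZero.limsup_error_le (𝓡 : P.Realization) (hε : P.ε * P.DA < 1) {r d : ℝ → ℝ}
    (hr : IsCb 2 r) (hd : IsCb 2 d) {z₀ : Z} {z : ℝ → Z} (hz : P.IsStepZero r d z₀ z) :
    ContinuousOn (P.e₀ r z) (Ioi 0) ∧
    (∃ B : ℝ≥0∞, B ≠ ⊤ ∧ ∀ τ, 1 ≤ τ → ‖P.e₀ r z τ‖ₑ ≤ B) ∧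
    limsup (fun t => ‖P.e₀ r z t‖ₑ) atTop ≤
      (P.D + P.calD) * limsupNorm 2 r + (P.Dd + P.calDd) * limsupNorm 2 d ∧
    ∀ h, 0 < h → limsup (fun t => ‖h⁻¹ * (P.e₀ r z (t + h) - P.e₀ r z t)‖ₑ) atTop ≤
      (P.D + P.calD) * limsupNorm 2 r + (P.Dd + P.calDd) * limsupNorm 2 d := by
  have hfc := hP.continuous_f 𝓡
  obtain ⟨u, hu, hzu⟩ := IsMildSolution.exists_continuousOn 𝓡 hz
  have hF : ContinuousOn (fun t => P.f (z t)) (Ioi 0) :=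
    (hfc.comp_continuousOn hu).congr fun t ht => by rw [hzu t ht]; rfl
  have hsub : Ioi (0 : ℝ) ⊆ Ici 0 := Ioi_subset_Ici_self
  have hsub1 : Ici (1 : ℝ) ⊆ Ici 0 := Ici_subset_Ici.2 zero_le_one
  have hr0 := hr.continuousOn (j := 0) (by norm_num)
  have hd0 := hd.continuousOn (j := 0) (by norm_num)
  have hr1 := (hr.continuousOn (j := 1) (by norm_num)).mono hsub1
  have hd1 := (hd.continuousOn (j := 1) (by norm_num)).mono hsub1
  have hr2 := (hr.continuousOn (j := 2) (by norm_num)).mono hsub1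
  have hd2 := (hd.continuousOn (j := 2) (by norm_num)).mono hsub1
  have dr0 := fun t => hr.hasDerivAt (j := 0) (by norm_num) (t := t)
  have dd0 := fun t => hd.hasDerivAt (j := 0) (by norm_num) (t := t)
  have dr1 := fun t => hr.hasDerivAt (j := 1) (by norm_num) (t := t)
  have dd1 := fun t => hd.hasDerivAt (j := 1) (by norm_num) (t := t)
  have Lr0 := IsCb.limsup_le (φ := r) (N := 2) (j := 0) (by norm_num)
  have Ld0 := IsCb.limsup_le (φ := d) (N := 2) (j := 0) (by norm_num)
  have Lr1 := IsCb.limsup_le (φ := r) (N := 2) (j := 1) (by norm_num)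
  have Ld1 := IsCb.limsup_le (φ := d) (N := 2) (j := 1) (by norm_num)
  have Lr2 := IsCb.limsup_le (φ := r) (N := 2) (j := 2) (by norm_num)
  have Ld2 := IsCb.limsup_le (φ := d) (N := 2) (j := 2) (by norm_num)
  obtain ⟨Br, hBr, br⟩ := hr.exists_enorm_le
  obtain ⟨Bd, hBd, bd⟩ := hd.exists_enorm_le
  simp only [iteratedDerivWithin_zero, zero_add] at hr0 hd0 dr0 dd0 Lr0 Ld0
  simp only [one_add_one_eq_two] at dr1 dd1
  set r₁ := iteratedDerivWithin 1 r (Ici 0)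
  set d₁ := iteratedDerivWithin 1 d (Ici 0)
  set r₂ := iteratedDerivWithin 2 r (Ici 0)
  set d₂ := iteratedDerivWithin 2 d (Ici 0)
  have br0 := br 0 (by norm_num)
  have bd0 := bd 0 (by norm_num)
  simp only [iteratedDerivWithin_zero] at br0 bd0
  have pos : ∀ {t : ℝ}, 1 ≤ t → 0 < t := fun h => one_pos.trans_le h
  obtain ⟨v, hv, hzv, hcv, H⟩ := IsMildSolution.exists_isTrajectory hP 𝓡 hz hF (hr0.mono hsub)
    (hd0.mono hsub)
  have he : ∀ t, 0 < t → P.e₀ r z t = r t - 𝓡.c (v t) := fun t ht => by rw [e₀, hcv t ht]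
  have hgain : ∀ τ, 1 ≤ τ → ‖P.f (z τ)‖ₑ ≤ P.ε * ‖𝓡.E (v τ)‖ₑ := by
    intro τ hτ
    have h1 := hP.enorm_f_sub_le 𝓡 (𝓡.E (v τ)) 0
    rwa [map_zero, hP.f_zero, sub_zero, sub_zero, ← hzv τ (pos hτ)] at h1
  obtain ⟨⟨BF, hBF, bF⟩, E0⟩ := (H 1 one_pos).limsup_error_le_of_deriv hP hε hgain hr1
    (fun τ hτ => dr0 τ (pos hτ.le)) hd1 (fun τ hτ => dd0 τ (pos hτ.le))
    ⟨Br, hBr, fun τ hτ => br0 τ (pos hτ).le⟩ ⟨Bd, hBd, fun τ hτ => bd0 τ (pos hτ).le⟩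
    ⟨Br, hBr, fun τ hτ => br 1 (by norm_num) τ (pos hτ).le⟩
    ⟨Bd, hBd, fun τ hτ => bd 1 (by norm_num) τ (pos hτ).le⟩ Lr0 Ld0 Lr1 Ld1
  refine ⟨?_, ?_, ?_, fun h hh => ?_⟩
  · exact ((hr0.mono hsub).sub (𝓡.c.continuous.comp_continuousOn hv)).congr he
  · obtain ⟨B, hB, hb⟩ := (H 1 one_pos).exists_bound hP 𝓡.c hBF hBr hBd bF
      (fun τ hτ => br0 τ (pos hτ).le) (fun τ hτ => bd0 τ (pos hτ).le)
    refine ⟨Br + B, ENNReal.add_ne_top.2 ⟨hBr, hB⟩, fun τ hτ => ?_⟩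
    rw [he τ (pos hτ)]
    exact enorm_sub_le.trans (add_le_add (br0 τ (pos hτ).le) (hb τ hτ))
  · refine ENNReal.limsup_mono ?_ E0
    filter_upwards [eventually_gt_atTop 0] with t ht
    rw [he t ht]
  -- The quotients of r and d are bounded by r' and d', their derivatives by r'' and d''; this is
  -- where second derivatives enter. The Lipschitz bound of f keeps the gain ε for the quotient of
  -- f(z⁰).
  · have H1 := (H (1 + h) (by linarith)).shift.smul_sub hP (H 1 one_pos) h⁻¹
    have hq : ∀ {B : ℝ≥0∞} {f f' : ℝ → ℝ}, (∀ t, 0 < t → HasDerivAt f (f' t) t) →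
        (∀ t, 0 ≤ t → ‖f' t‖ₑ ≤ B) → ∀ τ, 1 ≤ τ → ‖h⁻¹ * (f (τ + h) - f τ)‖ₑ ≤ B := by
      intro B f f' hf hb τ hτ
      obtain ⟨ξ, hξ, h1⟩ := exists_enorm_quotient_eq hh fun s hs => hf s (pos (hτ.trans hs))
      rw [h1]
      exact hb ξ (by linarith)
    have hm : MapsTo (fun τ => τ + h) (Ici (1 : ℝ)) (Ici 1) := fun τ hτ =>
      mem_Ici.2 (by linarith [mem_Ici.1 hτ])
    have hqc : ∀ {f : ℝ → ℝ}, ContinuousOn f (Ici 1) →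
        ContinuousOn (fun τ => h⁻¹ * (f (τ + h) - f τ)) (Ici 1) := fun hf =>
      continuousOn_const.mul ((hf.comp (by fun_prop) hm).sub hf)
    have hqd : ∀ {f f' : ℝ → ℝ}, (∀ t, 0 < t → HasDerivAt f (f' t) t) → ∀ τ, 1 < τ →
        HasDerivAt (fun τ => h⁻¹ * (f (τ + h) - f τ)) (h⁻¹ * (f' (τ + h) - f' τ)) τ :=
      fun hf τ hτ => (((hf (τ + h) (by linarith)).comp_add_const τ h).sub
        (hf τ (by linarith))).const_mul _
    have hgain1 : ∀ τ, 1 ≤ τ → ‖h⁻¹ • (P.f (z (τ + h)) - P.f (z τ))‖ₑ ≤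
        P.ε * ‖𝓡.E (h⁻¹ • (v (τ + h) - v τ))‖ₑ := by
      intro τ hτ
      have h1 := hP.enorm_f_sub_le 𝓡 (𝓡.E (v (τ + h))) (𝓡.E (v τ))
      rw [← hzv τ (pos hτ), ← hzv (τ + h) (by linarith),
        ← map_sub] at h1
      rw [map_smul, enorm_smul, enorm_smul, mul_left_comm]
      gcongr
    have E1 := (H1.limsup_error_le_of_deriv hP hε hgain1 (hqc hr1) (hqd dr0) (hqc hd1) (hqd dd0)
      ⟨Br, hBr, hq dr0 (br 1 (by norm_num))⟩ ⟨Bd, hBd, hq dd0 (bd 1 (by norm_num))⟩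
      ⟨Br, hBr, hq dr1 (br 2 (by norm_num))⟩ ⟨Bd, hBd, hq dd1 (bd 2 (by norm_num))⟩
      (limsup_quotient_le hh (fun τ hτ => dr0 τ (pos hτ)) Lr1)
      (limsup_quotient_le hh (fun τ hτ => dd0 τ (pos hτ)) Ld1)
      (limsup_quotient_le hh (fun τ hτ => dr1 τ (pos hτ)) Lr2)
      (limsup_quotient_le hh (fun τ hτ => dd1 τ (pos hτ)) Ld2)).2
    refine ENNReal.limsup_mono ?_ E1
    filter_upwards [eventually_gt_atTop 0] with t ht
    rw [he t ht, he (t + h) (by linarith), map_smul, map_sub, smul_eq_mul]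
    exact le_of_eq (congrArg _ (by ring))

/-! ### The second iteration -/

-- A trajectory with zero disturbance: F₁ has gain ε in z¹ by the Lipschitz bound based at z⁰, and
-- the driver e₀ enters only through its size and its difference quotients.
include hP in
theorem IsStepOne.limsup_error_le (𝓡 : P.Realization) (hε : P.ε * P.DA < 1) {r d : ℝ → ℝ}
    {z₀ : Z} {z w : ℝ → Z} (hz : P.IsStepZero r d z₀ z) (hw : P.IsStepOne r z w)
    (hec : ContinuousOn (P.e₀ r z) (Ioi 0))
    (heB : ∃ B : ℝ≥0∞, B ≠ ⊤ ∧ ∀ τ, 1 ≤ τ → ‖P.e₀ r z τ‖ₑ ≤ B) {L : ℝ≥0∞} (hLt : L ≠ ⊤)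
    (hL : limsup (fun t => ‖P.e₀ r z t‖ₑ) atTop ≤ L)
    (hLq : ∀ h, 0 < h →
      limsup (fun t => ‖h⁻¹ * (P.e₀ r z (t + h) - P.e₀ r z t)‖ₑ) atTop ≤ L) :
    limsup (fun t => ‖P.e₁ r z w t‖ₑ) atTop ≤ (P.D + P.calD) * L := by
  have hfc := hP.continuous_f 𝓡
  obtain ⟨u, hu, hzu⟩ := IsMildSolution.exists_continuousOn 𝓡 hz
  obtain ⟨y, hy, hwy⟩ := IsMildSolution.exists_continuousOn 𝓡 hw
  have hF : ContinuousOn (fun t => P.f (z t + w t) - P.f (z t)) (Ioi 0) := by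
    refine ((hfc.comp_continuousOn (hu.add hy)).sub
      (hfc.comp_continuousOn hu)).congr fun t ht => ?_
    simp only [hzu t ht, hwy t ht, ← map_add]
    rfl
  have hw' : P.IsMildSolution 0 (fun t => P.I₀ (P.ι (P.f (z t + w t) - P.f (z t)) +
      (0 : ℝ) • P.bd) + (1 / P.β) • (P.e₀ r z t • P.b)) w := by
    simp only [zero_smul, add_zero]
    exact hw
  obtain ⟨v, hv, hwv, hcv, H⟩ := IsMildSolution.exists_isTrajectory hP 𝓡 hw' hF hec
    continuousOn_const
  have hgain : ∀ τ, 1 ≤ τ → ‖P.f (z τ + w τ) - P.f (z τ)‖ₑ ≤ P.ε * ‖𝓡.E (v τ)‖ₑ := by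
    intro τ hτ
    have hτ : 0 < τ := one_pos.trans_le hτ
    have h1 := hP.enorm_f_sub_le 𝓡 (u τ + 𝓡.E (v τ)) (u τ)
    rwa [add_sub_cancel_left, map_add, ← hzu τ hτ,
      ← hwv τ hτ] at h1
  have E := (H 1 one_pos).limsup_error_le_of_quotient hP hε hgain heB hLt hL hLq
  refine ENNReal.limsup_mono ?_ E
  filter_upwards [eventually_gt_atTop 0] with t ht
  rw [e₁, hcv t ht]

end RegulatedSystem

end

/-! ### The theorem -/

theorem mainTheorem5 {Z X : Type*}
    [NormedAddCommGroup Z] [InnerProductSpace ℝ Z] [CompleteSpace Z]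
    [NormedAddCommGroup X] [NormedSpace ℝ X] [CompleteSpace X]
    (P : RegulatedSystem Z X) (hP : P.Standing)
    (hε : (P.ε : ENNReal) * P.DA < 1)
    (r d : ℝ → ℝ) (hr : IsCb 2 r) (hd : IsCb 2 d)
    (z₀ : Z) (z w : ℝ → Z) (hz : P.IsStepZero r d z₀ z) (hw : P.IsStepOne r z w) :
    0 < P.D + P.calD ∧ P.D + P.calD < ⊤ ∧ P.Dd + P.calDd < ⊤ ∧
    Filter.limsup (fun t : ℝ => ‖P.e₁ r z w t‖ₑ) Filter.atTop ≤
      (P.D + P.calD) ^ 2 *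
        (limsupNorm 2 r + (P.Dd + P.calDd) / (P.D + P.calD) * limsupNorm 2 d) := by
  obtain ⟨𝓡⟩ := hP.nonempty_realization
  have hgap : 1 - (P.ε : ENNReal) * P.DA ≠ 0 := (tsub_pos_of_lt hε).ne'
  have h0 : 0 < P.D + P.calD := add_pos_of_pos_of_nonneg (𝓡.D_pos hP) zero_le
  have h1 : P.D + P.calD ≠ ⊤ := ENNReal.add_ne_top.2 ⟨𝓡.D_ne_top hP,
    ENNReal.mul_ne_top 𝓡.DH_ne_top (ENNReal.div_ne_top
      (ENNReal.mul_ne_top 𝓡.DB_ne_top ENNReal.coe_ne_top) hgap)⟩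
  have h2 : P.Dd + P.calDd ≠ ⊤ := ENNReal.add_ne_top.2 ⟨𝓡.Dd_ne_top,
    ENNReal.mul_ne_top 𝓡.DH_ne_top (ENNReal.div_ne_top
      (ENNReal.mul_ne_top 𝓡.DBd_ne_top ENNReal.coe_ne_top) hgap)⟩
  refine ⟨h0, h1.lt_top, h2.lt_top, ?_⟩
  obtain ⟨e1, e2, e3, e4⟩ := hz.limsup_error_le hP 𝓡 hε hr hd
  have hLt : (P.D + P.calD) * limsupNorm 2 r + (P.Dd + P.calDd) * limsupNorm 2 d ≠ ⊤ :=
    ENNReal.add_ne_top.2 ⟨ENNReal.mul_ne_top h1 hr.limsupNorm_ne_top,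
      ENNReal.mul_ne_top h2 hd.limsupNorm_ne_top⟩
  refine (hw.limsup_error_le hP 𝓡 hε hz e1 e2 hLt e3 e4).trans (le_of_eq ?_)
  -- Factoring D + 𝒟 out of the first bound is legitimate in [0, ∞] because 0 < D + 𝒟 < ∞.
  rw [pow_two, mul_assoc]
  congr 1
  rw [mul_add (P.D + P.calD) (limsupNorm 2 r), ← mul_assoc (P.D + P.calD) (_ / _),
    ENNReal.mul_div_cancel h0.ne' h1]
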